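/- **Setting.** Let $\varepsilon_1,\dots,\varepsilon_4$ be the standard basis of $\mathbb R^4$, $\Phi=\{\pm\varepsilon_i\pm\varepsilon_j : i\ne j\}$ the root system $D_4$ with simple system $\pi$: $\alpha_1=\varepsilon_1-\varepsilon_2$, $\alpha_2=\varepsilon_2-\varepsilon_3$, $\alpha_3=\varepsilon_3-\varepsilon_4$, $\alpha_4=\varepsilon_3+\varepsilon_4$, positive roots $\Phi^+$ and Weyl group $W=W(D_4)$ generated by the reflections $\tau_\alpha$, $\alpha\in\Phi$; write $\tau_i=\tau_{\alpha_i}$, $s(w)=(-1)^{l(w)}$, and $abcd$ for $a\alpha_1+b\alpha_2+c\alpha_3+d\alpha_4$. Let $K$ be a field of characteristic $0$. For subgroups $H,H'\le W$ let $M=K[W/H]$ be the permutation module on the left cosets $\{wH\}$ (tabloids), $\kappa_{H'}=\sum_{\sigma\in H'}s(\sigma)\sigma$, $e=\kappa_{H'}\{H\}$, and let the generalized Specht module $S^{H,H'}\subseteq M$ be the span of all $we$, $w\in W$. For sets of roots $J,J'$ let $W(J)$ be the group generated by $\tau_\alpha$, $\alpha\in J$, and $S^{J,J'}=S^{W(J),W(J')}$,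 $e_{J,J'}=e$. For simple systems $J,J'\subset\Phi^+$ of additively closed subsystems $\Psi,\Psi'$ of $\Phi$ with $\Psi'\subseteq\Phi\setminus\Psi$, the pair $\{J,J'\}$ is a *useful system* if $W(J)\cap W(J')=1$ and $W(\Psi^\perp)\cap W(\Psi'^\perp)=1$, where $\Psi^\perp$ is the set of roots orthogonal to $\Psi$. It is a *good system* if moreover, for every $d\in W$ with $dJ\subset\Phi^+$ and $d\Psi\cap\Psi'=\emptyset$, the tabloid $\{dW(J)\}$ has nonzero coefficient in $e_{J,J'}$. An *extended subsystem*, with simple system $J$ and group $W(J)\le W$ (a *Steinberg–Weyl subgroup*), is one obtained, up to conjugacy, from $\pi$ and $W$ by repeatedly adding the negative of the highest root of a component to the Dynkin diagram and deleting at least one node of the extended component, passing to the dual system, and folding along a diagram symmetry: if $\tau$ is the isometry of $\operatorname{span}J$ inducing the symmetry, one takes the projections of $J$ to the fixed space of $\tau$ (one from each set of positive multiples) and the elements of the group that commute with $\tau$ on $\operatorname{span}J$. For Steinberg–Weyl subgroups $H,H'$, $H'$ is a *useful dual* of $H$ if $H\cap H'=1$, and a *good dual* if moreover $\kappa_{H'}\{wH\}\ne0$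 implies that $\{wH\}$ has nonzero coefficient in $\kappa_{H'}\{H\}$. **Statement.** The elements $1$, $\tau_2$, $\tau_1\tau_2$, $\tau_1\tau_3\tau_2$, $\tau_1\tau_2\tau_1\tau_3\tau_2\tau_1$, $\tau_1\tau_4\tau_2$, $\tau_1\tau_2\tau_1\tau_4\tau_2\tau_1$, $\tau_3\tau_4\tau_2$, $\tau_2\tau_3\tau_2\tau_4\tau_2\tau_3$, $\tau_1\tau_3\tau_4\tau_2$, $\tau_1\tau_2\tau_1\tau_3\tau_2\tau_1\tau_4\tau_2\tau_1\tau_3\tau_2\tau_4$, $\tau_2\tau_1\tau_3\tau_4\tau_2$, $\tau_2\tau_1\tau_4\tau_2\tau_1\tau_3$ represent the conjugacy classes $C_1,\dots,C_{13}$ of $W$, each exactly once. Let $\chi_1,\dots,\chi_{13}$ be the class functions $$\begin{array}{r|rrrrrrrrrrrrr} &C_1&C_2&C_3&C_4&C_5&C_6&C_7&C_8&C_9&C_{10}&C_{11}&C_{12}&C_{13}\\\hline \chi_1&1&1&1&1&1&1&1&1&1&1&1&1&1\\ \chi_2&1&-1&1&-1&1&-1&1&-1&1&1&1&-1&1\\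 \chi_3&2&0&-1&0&2&0&2&0&2&-1&2&0&2\\ \chi_4&3&1&0&1&3&-1&-1&-1&-1&0&3&1&-1\\ \chi_5&3&1&0&-1&-1&-1&-1&1&3&0&3&1&-1\\ \chi_6&3&-1&0&-1&3&1&-1&1&-1&0&3&-1&-1\\ \chi_7&3&-1&0&1&-1&1&-1&-1&3&0&3&-1&-1\\ \chi_8&3&-1&0&1&-1&-1&3&1&-1&0&3&-1&-1\\ \chi_9&3&1&0&-1&-1&1&3&-1&-1&0&3&1&-1\\ \chi_{10}&4&-2&1&0&0&0&0&0&0&-1&-4&2&0\\ \chi_{11}&4&2&1&0&0&0&0&0&0&-1&-4&-2&0\\ \chi_{12}&6&0&0&0&-2&0&-2&0&-2&0&6&0&2\\ \chi_{13}&8&0&-1&0&0&0&0&0&0&1&-8&0&0 \end{array}$$ 1. For each of the following pairs, $J$ and $J'$ are simple systems of extended subsystems, $\{J,J'\}$ is a good system, $W(J')$ is a good dual of $W(J)$, and $S^{J,J'}$ is irreducible with the character given: $$\begin{array}{l|l|l} J&J'&\text{character}\\\hline 1000,0100,0010\ (A_3)&1101,0111\ (2A_1)&\chi_4\\ 1000,0100,0001\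 (A_3')&1110,0111\ (2A_1')&\chi_9\\ 0100,0010,0001\ (A_3'')&1110,1101\ (2A_1'')&\chi_5\\ 1000,1211,0010,0001\ (4A_1)&1100,0110,0101\ (3A_1)&\chi_3\\ 1000,0010,0001\ (3A_1)&1111,0100\ (A_2)&\chi_{13}\\ 1000,0100\ (A_2)&1110,1101,0111\ (3A_1)&\chi_{13}\\ 1000,0010\ (2A_1)&0001,1100,0110\ (A_3)&\chi_6\\ 1000,0001\ (2A_1')&0010,0101,1100\ (A_3')&\chi_8\\ 0010,0001\ (2A_1'')&1000,0101,0110\ (A_3'')&\chi_7\\ 1000,0100,0010,0001\ (D_4)&\emptyset&\chi_1\\ \emptyset&1000,0100,0010,0001\ (D_4)&\chi_2 \end{array}$$ 2. In the case $J_1=\{1000,0100,0010\}$, $J_1'=\{1101,0111\}$, the tabloids $t_w=\{wW(J_1)\}$ for $w=1$, $\tau_4$, $\tau_2\tau_4$, $\tau_1\tau_2\tau_4$, $\tau_3\tau_2\tau_4$, $\tau_1\tau_3\tau_2\tau_4$, $\tau_2\tau_1\tau_3\tau_2\tau_4$, $\tau_4\tau_2\tau_1\tau_3\tau_2\tau_4$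 are all the tabloids, without repetition. With $u=t_{\tau_1\tau_2\tau_4}+t_{\tau_3\tau_2\tau_4}$ and $e=e_{J_1,J_1'}$ one has $e=t_1-u+t_{\tau_4\tau_2\tau_1\tau_3\tau_2\tau_4}$, $\tau_4e=t_{\tau_4}-u+t_{\tau_2\tau_1\tau_3\tau_2\tau_4}$, $\tau_2\tau_4e=t_{\tau_2\tau_4}-u+t_{\tau_1\tau_3\tau_2\tau_4}$. These three elements form a basis of $S^{J_1,J_1'}$; $\tau_2$ fixes the first and interchanges the other two. 3. Let $W(G_2)=\langle\tau_2,\ \tau_1\tau_3\tau_4\rangle$. It is the Steinberg–Weyl subgroup of an extended subsystem with simple system $\{0100,\frac13(1000+0010+0001)\}$. For $J'=\{0001,0110\}$ ($A_2$), $W(J')$ is a good dual of $W(G_2)$ and $S^{W(G_2),W(J')}$ is irreducible with character $\chi_{12}$. 4. For $J_1,J_1'$ as in 2 and $J_2'=\{1101\}$ ($A_1$), $W(J_1')$ is a good dual and $W(J_2')$ a useful dual of $W(J_1)$, $W(J_2')$ is a Steinberg–Weyl subgroup of $W(J_1')$, $S^{J_1,J_1'}\subseteq S^{J_1,J_2'}$,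 and $S^{J_1,J_2'}/S^{J_1,J_1'}$ is irreducible with character $\chi_{11}$. 5. Let $W(B_3)=\langle\tau_2,\ \tau_4,\ \tau_{1000}\tau_{1211}\rangle$. It is the Steinberg–Weyl subgroup of an extended subsystem with simple system $\{0100,0001,\frac12(1000-1211)\}$. For $J=\{1000\}$ ($A_1$) and $J'=\{0100,0001,0010\}$ ($A_3$), $W(J')$ is a useful dual and $W(B_3)$ a good dual of $W(J)$, $W(J')$ is a Steinberg–Weyl subgroup of $W(B_3)$, $S^{W(J),W(B_3)}\subseteq S^{W(J),W(J')}$, and $S^{W(J),W(J')}/S^{W(J),W(B_3)}$ is irreducible with character $\chi_{10}$. 6. Every irreducible $KW$-module is isomorphic to one of the modules in 1, 3, 4, 5, and its character is exactly one of $\chi_1,\dots,\chi_{13}$. -/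

import Mathlib

noncomputable section

namespace WeylSpecht

open scoped NNReal RealInnerProductSpace

/-! ## Reflections, Weyl groups, subsystems -/

section RootSystems

variable {E : Type*} [NormedAddCommGroup E] [InnerProductSpace ℝ E]

/-- The reflection `τ_α` of a Euclidean space in the hyperplane orthogonal to `α`. -/
def refl (α : E) : E ≃ₗᵢ[ℝ] E := (ℝ ∙ α)ᗮ.reflection

/-- The group `W(Φ)` of isometries generated by the `τ_α`, `α ∈ Φ`. -/
def weyl (Φ : Set E) : Subgroup (E ≃ₗᵢ[ℝ] E) := Subgroup.closure (refl '' Φ)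

/-- The subgroup `W(J)` of `W(Φ)` generated by the reflections `τ_α`, `α ∈ J`. -/
def reflSubgroup (Φ J : Set E) : Subgroup (weyl Φ) :=
  Subgroup.closure {w | ∃ α ∈ J, (w : E ≃ₗᵢ[ℝ] E) = refl α}

/-- The length of `w` with respect to the simple system `π`: the least number of factors in an
expression of `w` as a product of simple reflections. -/
def length (Φ π : Set E) (w : weyl Φ) : ℕ :=
  sInf {n | ∃ l : List (weyl Φ),
    (∀ x ∈ l, ∃ α ∈ π, (x : E ≃ₗᵢ[ℝ] E) = refl α) ∧ l.prod = w ∧ l.length = n}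

/-- The sign `s(w) = (-1) ^ l(w)`. -/
def sign (Φ π : Set E) (w : weyl Φ) : ℤ := (-1) ^ length Φ π w

/-- The positive roots: the roots that are nonnegative combinations of simple roots. -/
def positive (Φ π : Set E) : Set E := {α ∈ Φ | α ∈ Submodule.span ℝ≥0 π}

/-- An additively closed subsystem `Ψ` of a root system `Φ`. (A subset of a root system is a root
system in its span as soon as it is stable under its own reflections.) -/
def IsSubsystem (Φ Ψ : Set E) : Prop :=
  Ψ ⊆ Φ ∧ (∀ α ∈ Ψ, ∀ β ∈ Ψ, refl α β ∈ Ψ) ∧ ∀ α ∈ Ψ, ∀ β ∈ Ψ, α + β ∈ Φ → α + β ∈ Ψ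

/-- `J` is a simple system of `Ψ`. -/
def IsSimpleSystem (Ψ J : Set E) : Prop :=
  J ⊆ Ψ ∧ LinearIndependent ℝ (Subtype.val : J → E) ∧
    ∀ α ∈ Ψ, α ∈ Submodule.span ℝ≥0 J ∨ -α ∈ Submodule.span ℝ≥0 J

/-- The subsystem `Ψ = W(J) J` which has `J` as simple system. -/
def rootsOf (Φ J : Set E) : Set E :=
  {v | ∃ w ∈ reflSubgroup Φ J, ∃ j ∈ J, v = (w : E ≃ₗᵢ[ℝ] E) j}

/-- The largest subsystem `Ψ^⊥` of `Φ` orthogonal to `Ψ`. -/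
def orth (Φ Ψ : Set E) : Set E := {α ∈ Φ | ∀ β ∈ Ψ, ⟪α, β⟫ = 0}

/-- The distinguished coset representatives `D_Ψ = {w | w j ∈ Φ⁺ for all j ∈ J}`. -/
def distinguished (Φ π J : Set E) : Set (weyl Φ) :=
  {w | ∀ j ∈ J, (w : E ≃ₗᵢ[ℝ] E) j ∈ positive Φ π}

/-- The pair `{J, J'}` is a useful system in `Φ`. -/
structure IsUsefulSystem (Φ π J J' : Set E) : Prop where
  subsystem_left : IsSubsystem Φ (rootsOf Φ J)
  simple_left : IsSimpleSystem (rootsOf Φ J) J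
  positive_left : J ⊆ positive Φ π
  subsystem_right : IsSubsystem Φ (rootsOf Φ J')
  simple_right : IsSimpleSystem (rootsOf Φ J') J'
  positive_right : J' ⊆ positive Φ π
  disjoint : rootsOf Φ J' ⊆ Φ \ rootsOf Φ J
  inf_eq_bot : reflSubgroup Φ J ⊓ reflSubgroup Φ J' = ⊥
  orth_inf_eq_bot :
    reflSubgroup Φ (orth Φ (rootsOf Φ J)) ⊓ reflSubgroup Φ (orth Φ (rootsOf Φ J')) = ⊥

/-! ## Extended subsystems and Steinberg–Weyl subgroups -/

variable [FiniteDimensional ℝ E]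

/-- `IsExtendedSubsystem Φ J₀ G₀ J G`: the simple system `J` and the group `G = W(J) ≤ W(Φ)`, which
acts on `span J` as the reflection group with simple roots `J`, are obtained (up to conjugacy) from
`J₀` and `G₀ = W(J₀)` by repeatedly extending the Dynkin diagram and deleting nodes, passing to the
dual system, and folding along a symmetry of the Dynkin diagram (Steinberg's construction). -/
inductive IsExtendedSubsystem (Φ : Set E) (J₀ : Set E) (G₀ : Subgroup (weyl Φ)) :
    Set E → Subgroup (weyl Φ) → Prop
  | base : IsExtendedSubsystem Φ J₀ G₀ J₀ G₀
  | conj {J : Set E} {G : Subgroup (weyl Φ)} (h : IsExtendedSubsystem Φ J₀ G₀ J G)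
      (w : weyl Φ) (hw : w ∈ G₀) :
      IsExtendedSubsystem Φ J₀ G₀ ((w : E ≃ₗᵢ[ℝ] E) '' J) (G.map (MulAut.conj w).toMonoidHom)
  /-- `C` is a connected component of the diagram `J`, and `a` is the highest root of the
  corresponding component of the root system `G J`; the node `-a` is added and one or more nodes
  of the extended component (and any other nodes) are deleted, which leaves `K`. -/
  | delete {J : Set E} {G : Subgroup (weyl Φ)} (h : IsExtendedSubsystem Φ J₀ G₀ J G)
      (C : Set E) (hC : C ⊆ J) (hCorth : ∀ α ∈ C, ∀ β ∈ J \ C, ⟪α, β⟫ = 0)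
      (a : E) (ha : ∃ g ∈ G, ∃ j ∈ J, a = (g : E ≃ₗᵢ[ℝ] E) j) (haC : a ∈ Submodule.span ℝ C)
      (hmax : ∀ g ∈ G, ∀ j ∈ J, (g : E ≃ₗᵢ[ℝ] E) j ∈ Submodule.span ℝ C →
        a - (g : E ≃ₗᵢ[ℝ] E) j ∈ Submodule.span ℝ≥0 C)
      (K : Set E) (hK : K ⊆ insert (-a) J) (hdel : ¬ insert (-a) C ⊆ K) :
      IsExtendedSubsystem Φ J₀ G₀ K
        (Subgroup.closure {g | g ∈ G ∧ ∃ α ∈ K, ∀ v ∈ Submodule.span ℝ J,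
          (g : E ≃ₗᵢ[ℝ] E) v = refl α v})
  | dual {J : Set E} {G : Subgroup (weyl Φ)} (h : IsExtendedSubsystem Φ J₀ G₀ J G) :
      IsExtendedSubsystem Φ J₀ G₀ ((fun α : E => (2 / ‖α‖ ^ 2) • α) '' J) G
  /-- `τ` is the isometry which permutes `J` up to positive multiples, according to a symmetry of
  the Dynkin diagram. The new group consists of the elements of `G` that commute with `τ` on
  `span J`. The new simple roots are the projections of the elements of `J` to the subspace fixed
  by `τ` in `span J`, one being kept out of each set of positive multiples. -/
  | fold {J : Set E} {G : Subgroup (weyl Φ)} (h : IsExtendedSubsystem Φ J₀ G₀ J G)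
      (τ : E ≃ₗᵢ[ℝ] E) (hτ : ∀ r ∈ J, ∃ c : ℝ, 0 < c ∧ ∃ r' ∈ J, τ r = c • r')
      (V₁ : Submodule ℝ E) (hV₁ : ∀ v, v ∈ V₁ ↔ v ∈ Submodule.span ℝ J ∧ τ v = v)
      (J₁ : Set E) (hJ₁ : J₁ ⊆ (fun r => V₁.starProjection r) '' J)
      (hJ₁' : ∀ r ∈ J, ∃! s, s ∈ J₁ ∧ ∃ c : ℝ, 0 < c ∧ V₁.starProjection r = c • s)
      (G₁ : Subgroup (weyl Φ))
      (hG₁ : ∀ g, g ∈ G₁ ↔ g ∈ G ∧ ∀ v ∈ Submodule.span ℝ J,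
        (g : E ≃ₗᵢ[ℝ] E) (τ v) = τ ((g : E ≃ₗᵢ[ℝ] E) v)) :
      IsExtendedSubsystem Φ J₀ G₀ J₁ G₁

/-- Steinberg–Weyl subgroups of `W(Φ)`. -/
def IsSWSubgroup (Φ π : Set E) (H : Subgroup (weyl Φ)) : Prop :=
  ∃ J, IsExtendedSubsystem Φ π ⊤ J H

/-- `H'` is a useful dual of `H`. -/
def IsUsefulDual (Φ π : Set E) (H H' : Subgroup (weyl Φ)) : Prop :=
  IsSWSubgroup Φ π H ∧ IsSWSubgroup Φ π H' ∧ H ⊓ H' = ⊥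

end RootSystems

/-! ## Generalized Specht modules -/

section Specht

variable (K : Type*) [Field K] {G : Type*} [Group G]

/-- The permutation module `M^Δ` on the tabloids, i.e. the left cosets of `H = W(J)`. -/
abbrev tabloidRep (H : Subgroup G) : Representation K G (MonoidAlgebra K (G ⧸ H)) :=
  Representation.ofMulAction K G (G ⧸ H)

variable {K} in
/-- The tabloid `{w H}`, as a basis element of `M^Δ`. -/
abbrev tabloid {H : Subgroup G} (w : G) : MonoidAlgebra K (G ⧸ H) :=
  MonoidAlgebra.single (w : G ⧸ H) 1

/-- The action of `κ_{H'} = ∑ σ ∈ H', s(σ) σ` on `M^Δ` (used for finite `H'`). -/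
def kappa (s : G → ℤ) (H H' : Subgroup G) : Module.End K (MonoidAlgebra K (G ⧸ H)) :=
  ∑ᶠ σ : H', ((s σ : ℤ) : K) • tabloidRep K H (σ : G)

/-- The generalized polytabloid `e = κ_{H'} {H}`. -/
def polytabloid (s : G → ℤ) (H H' : Subgroup G) : MonoidAlgebra K (G ⧸ H) :=
  kappa K s H H' (tabloid 1)

/-- The generalized Specht module: the span of the polytabloids
`w e = κ_{w H' w⁻¹} {w H}`, `w ∈ G`. -/
def specht (s : G → ℤ) (H H' : Subgroup G) : Subrepresentation (tabloidRep K H) where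
  toSubmodule := Submodule.span K (Set.range fun w : G => tabloidRep K H w (polytabloid K s H H'))
  apply_mem_toSubmodule g v hv := by
    induction hv using Submodule.span_induction with
    | mem x hx =>
      obtain ⟨w, rfl⟩ := hx
      refine Submodule.subset_span ⟨g * w, ?_⟩
      simp [map_mul]
    | zero => simp
    | add x y _ _ hx hy => simpa using Submodule.add_mem _ hx hy
    | smul a x _ hx => simpa using Submodule.smul_mem _ a hx

variable {K}

/-- The module `σ₁ / σ₂` for submodules `σ₂ ⊆ σ₁` of a `KG`-module. -/
def subquotient {M : Type*} [AddCommGroup M] [Module K M] {ρ : Representation K G M}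
    (σ₁ σ₂ : Subrepresentation ρ) :
    Representation K G (σ₁.toSubmodule ⧸ σ₂.toSubmodule.submoduleOf σ₁.toSubmodule) :=
  σ₁.toRepresentation.quotient _ fun g _ hv => σ₂.apply_mem_toSubmodule g hv

end Specht

section Good

variable (K : Type*) [Field K] {E : Type*} [NormedAddCommGroup E] [InnerProductSpace ℝ E]

/-- A useful system is good if every tabloid `{d J}`, `d ∈ D_Ψ`, with `d Ψ ∩ Ψ' = ∅` appears with
nonzero coefficient in `e_{J,J'}`. -/
def IsGoodSystem (Φ π J J' : Set E) : Prop :=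
  IsUsefulSystem Φ π J J' ∧
    ∀ d ∈ distinguished Φ π J,
      ((d : E ≃ₗᵢ[ℝ] E) '' rootsOf Φ J) ∩ rootsOf Φ J' = ∅ →
      (polytabloid K (sign Φ π) (reflSubgroup Φ J) (reflSubgroup Φ J')).coeff (d : weyl Φ ⧸ _) ≠ 0

/-- A useful dual `H'` of `H` is good if every tabloid `{w H}` with `κ_{H'} {w H} ≠ 0` appears in
`e = κ_{H'} {H}`. -/
def IsGoodDual [FiniteDimensional ℝ E] (Φ π : Set E) (H H' : Subgroup (weyl Φ)) : Prop :=
  IsUsefulDual Φ π H H' ∧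
    ∀ w : weyl Φ, kappa K (sign Φ π) H H' (tabloid w) ≠ 0 →
      (polytabloid K (sign Φ π) H H').coeff (w : weyl Φ ⧸ H) ≠ 0

end Good

/-! ## The root system `D₄` -/

section D4

abbrev V4 : Type := EuclideanSpace ℝ (Fin 4)

/-- The standard basis of `ℝ⁴`; `ε 0, …, ε 3` are `ε₁, …, ε₄`. -/
def ε (i : Fin 4) : V4 := EuclideanSpace.single i 1

/-- The roots `± ε_i ± ε_j`, `i ≠ j`. -/
def Φ : Set V4 :=
  {v | ∃ i j, i ≠ j ∧ (v = ε i + ε j ∨ v = ε i - ε j ∨ v = -ε i + ε j ∨ v = -ε i - ε j)}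

/-- The simple roots `α₁ = ε₁ - ε₂`, `α₂ = ε₂ - ε₃`, `α₃ = ε₃ - ε₄`, `α₄ = ε₃ + ε₄`. -/
def α : Fin 4 → V4 := ![ε 0 - ε 1, ε 1 - ε 2, ε 2 - ε 3, ε 2 + ε 3]

def π : Set V4 := Set.range α

/-- The vector `a b c d = a α₁ + b α₂ + c α₃ + d α₄`. -/
def rt (a b c d : ℝ) : V4 := a • α 0 + b • α 1 + c • α 2 + d • α 3

theorem α_mem (i : Fin 4) : α i ∈ Φ := by
  fin_cases i
  · exact ⟨0, 1, by decide, .inr (.inl rfl)⟩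
  · exact ⟨1, 2, by decide, .inr (.inl rfl)⟩
  · exact ⟨2, 3, by decide, .inr (.inl rfl)⟩
  · exact ⟨2, 3, by decide, .inl rfl⟩

/-- The Weyl group of type `D₄`. -/
abbrev W : Type := weyl Φ

/-- The simple reflections `τ₁, …, τ₄`. -/
def τ (i : Fin 4) : W := ⟨refl (α i), Subgroup.subset_closure ⟨α i, α_mem i, rfl⟩⟩
def τ₁ : W := τ 0
def τ₂ : W := τ 1
def τ₃ : W := τ 2
def τ₄ : W := τ 3

/-- Representatives of the conjugacy classes `C₁, …, C₁₃`. -/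
def classRep : Fin 13 → W := ![
  1, τ₂, τ₁ * τ₂, τ₁ * τ₃ * τ₂, τ₁ * τ₂ * τ₁ * τ₃ * τ₂ * τ₁, τ₁ * τ₄ * τ₂,
  τ₁ * τ₂ * τ₁ * τ₄ * τ₂ * τ₁, τ₃ * τ₄ * τ₂, τ₂ * τ₃ * τ₂ * τ₄ * τ₂ * τ₃,
  τ₁ * τ₃ * τ₄ * τ₂, τ₁ * τ₂ * τ₁ * τ₃ * τ₂ * τ₁ * τ₄ * τ₂ * τ₁ * τ₃ * τ₂ * τ₄,
  τ₂ * τ₁ * τ₃ * τ₄ * τ₂, τ₂ * τ₁ * τ₄ * τ₂ * τ₁ * τ₃]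

/-- The character table: row `i`, column `j` is the value of `χ_{i+1}` on `C_{j+1}`. -/
def charTable : Matrix (Fin 13) (Fin 13) ℤ := !![
  1,  1,  1,  1,  1,  1,  1,  1,  1,  1,  1,  1,  1;
  1, -1,  1, -1,  1, -1,  1, -1,  1,  1,  1, -1,  1;
  2,  0, -1,  0,  2,  0,  2,  0,  2, -1,  2,  0,  2;
  3,  1,  0,  1,  3, -1, -1, -1, -1,  0,  3,  1, -1;
  3,  1,  0, -1, -1, -1, -1,  1,  3,  0,  3,  1, -1;
  3, -1,  0, -1,  3,  1, -1,  1, -1,  0,  3, -1, -1;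
  3, -1,  0,  1, -1,  1, -1, -1,  3,  0,  3, -1, -1;
  3, -1,  0,  1, -1, -1,  3,  1, -1,  0,  3, -1, -1;
  3,  1,  0, -1, -1,  1,  3, -1, -1,  0,  3,  1, -1;
  4, -2,  1,  0,  0,  0,  0,  0,  0, -1, -4,  2,  0;
  4,  2,  1,  0,  0,  0,  0,  0,  0, -1, -4, -2,  0;
  6,  0,  0,  0, -2,  0, -2,  0, -2,  0,  6,  0,  2;
  8,  0, -1,  0,  0,  0,  0,  0,  0,  1, -8,  0,  0]

/-- `ρ` is irreducible with character `χ_n`, `1 ≤ n ≤ 13`. -/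
def Affords {K : Type*} [Field K] {M : Type*} [AddCommGroup M] [Module K M]
    (ρ : Representation K W M) (n : ℕ) : Prop :=
  ρ.IsIrreducible ∧ ∃ i : Fin 13, (i : ℕ) + 1 = n ∧
    ∀ j, ρ.character (classRep j) = ((charTable i j : ℤ) : K)

/-- The reflection subgroup `W(J)` of `W(D₄)`. -/
abbrev WJ (J : Set V4) : Subgroup W := reflSubgroup Φ J

/-- The generalized Specht module for a pair of subgroups of `W(D₄)`. -/
abbrev S (K : Type*) [Field K] (H H' : Subgroup W) : Subrepresentation (tabloidRep K H) :=
  specht K (sign Φ π) H H'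

/-- Rows `J` of the eleven pairs `(J, J')` of simple systems: types
`A₃, A₃', A₃'', 4A₁, 3A₁, A₂, 2A₁, 2A₁', 2A₁'', D₄, ∅`. -/
def rowJ : Fin 11 → Set V4 := ![
  {rt 1 0 0 0, rt 0 1 0 0, rt 0 0 1 0},
  {rt 1 0 0 0, rt 0 1 0 0, rt 0 0 0 1},
  {rt 0 1 0 0, rt 0 0 1 0, rt 0 0 0 1},
  {rt 1 0 0 0, rt 1 2 1 1, rt 0 0 1 0, rt 0 0 0 1},
  {rt 1 0 0 0, rt 0 0 1 0, rt 0 0 0 1},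
  {rt 1 0 0 0, rt 0 1 0 0},
  {rt 1 0 0 0, rt 0 0 1 0},
  {rt 1 0 0 0, rt 0 0 0 1},
  {rt 0 0 1 0, rt 0 0 0 1},
  {rt 1 0 0 0, rt 0 1 0 0, rt 0 0 1 0, rt 0 0 0 1},
  ∅]

/-- Columns `J'` of the eleven pairs `(J, J')`: types
`2A₁, 2A₁', 2A₁'', 3A₁, A₂, 3A₁, A₃, A₃', A₃'', ∅, D₄`. -/
def colJ : Fin 11 → Set V4 := ![
  {rt 1 1 0 1, rt 0 1 1 1},
  {rt 1 1 1 0, rt 0 1 1 1},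
  {rt 1 1 1 0, rt 1 1 0 1},
  {rt 1 1 0 0, rt 0 1 1 0, rt 0 1 0 1},
  {rt 1 1 1 1, rt 0 1 0 0},
  {rt 1 1 1 0, rt 1 1 0 1, rt 0 1 1 1},
  {rt 0 0 0 1, rt 1 1 0 0, rt 0 1 1 0},
  {rt 0 0 1 0, rt 0 1 0 1, rt 1 1 0 0},
  {rt 1 0 0 0, rt 0 1 0 1, rt 0 1 1 0},
  ∅,
  {rt 1 0 0 0, rt 0 1 0 0, rt 0 0 1 0, rt 0 0 0 1}]

/-- The number `n` such that the `r`-th pair affords `χ_n`. -/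
def rowChar : Fin 11 → ℕ := ![4, 9, 5, 3, 13, 13, 6, 8, 7, 1, 2]

/-- Simple system of type `A₃`. -/
def JA3 : Set V4 := {rt 1 0 0 0, rt 0 1 0 0, rt 0 0 1 0}
/-- Simple system of type `2A₁`. -/
def J2A1 : Set V4 := {rt 1 1 0 1, rt 0 1 1 1}
/-- Simple system of type `A₁`, contained in `J2A1`. -/
def JA1 : Set V4 := {rt 1 1 0 1}
/-- Simple system of type `A₂`. -/
def JA2 : Set V4 := {rt 0 0 0 1, rt 0 1 1 0}
/-- Simple system of the extended subsystem `G₂`. -/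
def JG2 : Set V4 := {rt 0 1 0 0, (1 / 3 : ℝ) • (rt 1 0 0 0 + rt 0 0 1 0 + rt 0 0 0 1)}
/-- The Steinberg subgroup `W(G₂)`: the reflection of `span JG2` in the short simple root is
realised by `τ₁ τ₃ τ₄`. -/
def WG2 : Subgroup W := Subgroup.closure {τ₂, τ₁ * τ₃ * τ₄}
/-- Simple system of type `A₁`. -/
def JA1' : Set V4 := {rt 1 0 0 0}
/-- Simple system of type `A₃`. -/
def JA3' : Set V4 := {rt 0 1 0 0, rt 0 0 0 1, rt 0 0 1 0}
/-- Simple system of the extended subsystem `B₃`, obtained from the part `1000, -1211, 0100, 0001`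
of the extended Dynkin diagram of `D₄` by interchanging `1000` and `-1211`. -/
def JB3 : Set V4 := {rt 0 1 0 0, rt 0 0 0 1, (1 / 2 : ℝ) • (rt 1 0 0 0 - rt 1 2 1 1)}
/-- The Steinberg subgroup `W(B₃)`: the reflection of `span JB3` in the short simple root is
realised by the product of the reflections in the orthogonal roots `1000` and `1211`. -/
def WB3 : Subgroup W :=
  Subgroup.closure {w | w = τ₂ ∨ w = τ₄ ∨
    (w : V4 ≃ₗᵢ[ℝ] V4) = refl (rt 1 0 0 0) * refl (rt 1 2 1 1)}

end D4

end WeylSpecht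

end


/-!
Let `e = κ_{H'} {H}`. The operator `∑ e(gH) g` maps the permutation module into `K e` as soon as
every tabloid `{wH}` lies in the `H'`-orbit of `{H}` or is killed by `κ_{H'}`, because then some
`u ∈ H'` of sign `-1` fixes `{wH}`. It maps `e` to the multiple `∑ e(gH) e(g⁻¹H)` of `e`, and when
this factor is nonzero, `e` generates an irreducible module whose character at `g` is
`∑ x, e(x⁻¹g⁻¹xH)` divided by the factor. Conversely, an irreducible representation on which the
operator does not vanish is isomorphic to that module.

The two quotients are of the same kind: if `z` is the central element `-1` and
`e = κ {H} + z κ {H}`, then `1 - z` identifies the quotient of the module generated by `κ {H}` by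
the one generated by `e` with the module generated by `κ {H} - z κ {H}`, and `β(g) - β(z g)` again
behaves like a sign character, where `β` is the sign on `H'`, extended by zero.

By column orthogonality `∑ χᵢ(1) χᵢ` vanishes off the identity, so on every nonzero representation
at least one of the thirteen operators is nonzero. All the conditions on elements of `W(D₄)` are
finite statements about signed permutations.
-/

noncomputable section

namespace WeylSpecht

open scoped NNReal RealInnerProductSpace

/-! ### Cyclic subrepresentations -/

section Cyclic

variable {K G V : Type*} [Field K] [Monoid G] [AddCommGroup V] [Module K V]
  {ρ : Representation K G V}

/-- The subrepresentation generated by the vector `v`. -/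
def cyclic (ρ : Representation K G V) (v : V) : Subrepresentation ρ where
  toSubmodule := Submodule.span K (Set.range fun g => ρ g v)
  apply_mem_toSubmodule g x hx := by
    induction hx using Submodule.span_induction with
    | mem _ hx =>
      obtain ⟨h, rfl⟩ := hx
      exact Submodule.subset_span ⟨g * h, by simp⟩
    | zero => simp
    | add x y _ _ hx hy => simpa using Submodule.add_mem _ hx hy
    | smul a x _ hx => simpa using Submodule.smul_mem _ a hx

theorem apply_mem_cyclic (g : G) (v : V) : ρ g v ∈ (cyclic ρ v).toSubmodule :=
  Submodule.subset_span ⟨g, rfl⟩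

theorem self_mem_cyclic (v : V) : v ∈ (cyclic ρ v).toSubmodule := by
  simpa using apply_mem_cyclic (ρ := ρ) 1 v

theorem cyclic_le {v : V} {σ : Subrepresentation ρ} (hv : v ∈ σ.toSubmodule) :
    (cyclic ρ v).toSubmodule ≤ σ.toSubmodule :=
  Submodule.span_le.2 (by rintro _ ⟨g, rfl⟩; exact σ.apply_mem_toSubmodule g hv)

theorem cyclic_toRepresentation_self_eq_top (v : V) :
    cyclic (cyclic ρ v).toRepresentation ⟨v, self_mem_cyclic v⟩ = ⊤ := by
  let U := cyclic (cyclic ρ v).toRepresentation ⟨v, self_mem_cyclic v⟩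
  refine Subrepresentation.toSubmodule_injective (Submodule.eq_top_iff'.2 fun x => ?_)
  have hle : (cyclic ρ v).toSubmodule ≤ U.toSubmodule.map (cyclic ρ v).toSubmodule.subtype := by
    refine Submodule.span_le.2 ?_
    rintro _ ⟨g, rfl⟩
    exact ⟨_, apply_mem_cyclic g _, rfl⟩
  obtain ⟨y, hy, hyx⟩ := hle x.2
  rwa [← Subtype.ext hyx]

theorem nontrivial_of_isIrreducible (ρ : Representation K G V) [ρ.IsIrreducible] :
    Nontrivial V := by
  by_contra hV
  rw [not_nontrivial_iff_subsingleton] at hV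
  exact bot_ne_top (α := Subrepresentation ρ)
    (Subrepresentation.toSubmodule_injective (Subsingleton.elim _ _))

/-- A complement splits the generator `v`; one of the two components survives under `E`, hence
generates everything. -/
theorem isIrreducible_of_forall_mem_span_singleton [ρ.IsSemisimpleRepresentation] {v : V}
    (hv : cyclic ρ v = ⊤) (E : Module.End K V)
    (hE : ∀ (U : Subrepresentation ρ), ∀ u ∈ U.toSubmodule, E u ∈ U.toSubmodule)
    (hspan : ∀ u, E u ∈ K ∙ v) (hne : E v ≠ 0) : ρ.IsIrreducible := by
  have eq_top (U : Subrepresentation ρ) (u : V) (hu : u ∈ U.toSubmodule) (hEu : E u ≠ 0) :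
      U = ⊤ := by
    obtain ⟨c, hc⟩ := Submodule.mem_span_singleton.1 (hspan u)
    have hc0 : c ≠ 0 := by rintro rfl; exact hEu (by rw [← hc, zero_smul])
    have hvU : v ∈ U.toSubmodule := by
      rw [← U.toSubmodule.smul_mem_iff hc0, hc]
      exact hE U u hu
    exact top_le_iff.1 (hv ▸ cyclic_le hvU)
  have : Nontrivial (Subrepresentation ρ) := by
    refine ⟨⊥, ⊤, fun h => hne ?_⟩
    have hvbot : v ∈ (⊥ : Subrepresentation ρ).toSubmodule := h ▸ Submodule.mem_top
    rw [(Submodule.mem_bot K).1 hvbot, map_zero]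
  refine ⟨fun U => ?_⟩
  obtain ⟨U', hU'⟩ := exists_isCompl U
  obtain ⟨u, hu, u', hu', rfl⟩ : ∃ u ∈ U.toSubmodule, ∃ u' ∈ U'.toSubmodule, u + u' = v :=
    Submodule.mem_sup.1 <| by
      rw [← Subrepresentation.toSubmodule_sup, hU'.sup_eq_top]
      exact Submodule.mem_top
  by_cases hEu : E u = 0
  · have hU'top : U' = ⊤ := eq_top U' u' hu' (by simpa [hEu] using hne)
    exact .inl (by simpa [hU'top] using hU'.inf_eq_bot)
  · exact .inr (eq_top U u hu hEu)

end Cyclic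

theorem mul_trace_eq_sum_of_forall_sum_smul_eq {R M ι : Type*} [CommRing R] [AddCommGroup M]
    [Module R M] [Module.Free R M] [Module.Finite R M] [Fintype ι] (φ : M →ₗ[R] ι → R)
    (b : ι → M) (n : R) (h : ∀ x, ∑ i, φ x i • b i = n • x) (f : Module.End R M) :
    n * LinearMap.trace R M f = ∑ i, φ (f (b i)) i := by
  classical
  have hcomp : (f ∘ₗ Fintype.linearCombination R b) ∘ₗ φ = n • f :=
    LinearMap.ext fun x => by
      rw [LinearMap.comp_apply, LinearMap.comp_apply, Fintype.linearCombination_apply, h, map_smul,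
        LinearMap.smul_apply]
  rw [← smul_eq_mul, ← map_smul, ← hcomp, ← LinearMap.trace_comp_comm',
    LinearMap.trace_eq_matrix_trace R (Pi.basisFun R ι), Matrix.trace]
  simp

/-! ### Essentially idempotent elements of a permutation module -/

section PermutationModule

variable {K : Type*} [Field K] {G : Type*} [Group G] {H : Subgroup G}

theorem tabloidRep_tabloid (x w : G) :
    tabloidRep K H x (tabloid w) = tabloid (x * w) := by
  simp [tabloid]

theorem tabloidRep_coeff (x g : G) (m : MonoidAlgebra K (G ⧸ H)) :
    (tabloidRep K H x m).coeff (g : G ⧸ H) = m.coeff ((x⁻¹ * g : G) : G ⧸ H) :=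
  Representation.coeff_ofMulAction x m g

theorem coeff_ext {m m' : MonoidAlgebra K (G ⧸ H)}
    (h : ∀ g : G, m.coeff (g : G ⧸ H) = m'.coeff (g : G ⧸ H)) : m = m' := by
  ext q
  induction q using QuotientGroup.induction_on with
  | H g => exact h g

open Classical in
theorem tabloid_coeff (w g : G) :
    (tabloid w : MonoidAlgebra K (G ⧸ H)).coeff (g : G ⧸ H) = if w⁻¹ * g ∈ H then 1 else 0 := by
  simp [tabloid, Finsupp.single_apply, QuotientGroup.eq]

variable [Fintype G] {V : Type*} [AddCommGroup V] [Module K V] (ρ : Representation K G V)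

/-- The operator `∑ e(gH) g` on a representation, as a linear function of the vector `e` of the
permutation module, `e(gH)` being the coefficient of the tabloid `{gH}` in `e`. -/
def coeffOp : MonoidAlgebra K (G ⧸ H) →ₗ[K] Module.End K V where
  toFun e := ∑ g : G, e.coeff (g : G ⧸ H) • ρ g
  map_add' e e' := by simp [add_smul, Finset.sum_add_distrib]
  map_smul' c e := by simp [Finset.smul_sum, mul_smul]

theorem coeffOp_apply (e : MonoidAlgebra K (G ⧸ H)) (v : V) :
    coeffOp ρ e v = ∑ g : G, e.coeff (g : G ⧸ H) • ρ g v := by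
  simp [coeffOp, LinearMap.sum_apply]

theorem coeffOp_tabloidRep_apply (e : MonoidAlgebra K (G ⧸ H)) (x : G) (v : V) :
    coeffOp ρ (tabloidRep K H x e) v = ρ x (coeffOp ρ e v) := by
  simp only [coeffOp_apply, map_sum, map_smul]
  rw [← Equiv.sum_comp (Equiv.mulLeft x)]
  simp

variable {ρ}

theorem coeffOp_mem (e : MonoidAlgebra K (G ⧸ H)) (σ : Subrepresentation ρ) {v : V}
    (hv : v ∈ σ.toSubmodule) : coeffOp ρ e v ∈ σ.toSubmodule := by
  rw [coeffOp_apply]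
  exact Submodule.sum_mem _ fun g _ => Submodule.smul_mem _ _ (σ.apply_mem_toSubmodule g hv)

theorem coe_coeffOp_toRepresentation (e : MonoidAlgebra K (G ⧸ H)) (σ : Subrepresentation ρ)
    (v : σ.toSubmodule) : (coeffOp σ.toRepresentation e v : V) = coeffOp ρ e v := by
  rw [coeffOp_apply, coeffOp_apply, Submodule.coe_sum]
  rfl

/-- `e` behaves like a primitive idempotent of the group algebra, up to the nonzero factor `n`. -/
structure IsQuasiPrimitive (e : MonoidAlgebra K (G ⧸ H)) (n : K) : Prop where
  mem_span : ∀ m, coeffOp (tabloidRep K H) e m ∈ K ∙ e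
  apply_self : coeffOp (tabloidRep K H) e e = n • e
  factor_ne_zero : n ≠ 0
  ne_zero : e ≠ 0

namespace IsQuasiPrimitive

variable {e : MonoidAlgebra K (G ⧸ H)} {n : K}

theorem isIrreducible [NeZero (Nat.card G : K)] (h : IsQuasiPrimitive e n) :
    (cyclic (tabloidRep K H) e).toRepresentation.IsIrreducible := by
  let σ := cyclic (tabloidRep K H) e
  let e' : σ.toSubmodule := ⟨e, self_mem_cyclic e⟩
  refine isIrreducible_of_forall_mem_span_singleton (v := e')
    (cyclic_toRepresentation_self_eq_top e) (coeffOp σ.toRepresentation e)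
    (fun U _ hu => coeffOp_mem e U hu) (fun u => ?_) fun h0 => ?_
  · obtain ⟨c, hc⟩ := Submodule.mem_span_singleton.1 (h.mem_span u)
    exact Submodule.mem_span_singleton.2
      ⟨c, Subtype.ext (by rw [coe_coeffOp_toRepresentation, ← hc]; rfl)⟩
  · have : coeffOp (tabloidRep K H) e e = 0 := by
      rw [← coe_coeffOp_toRepresentation e σ e', h0, Submodule.coe_zero]
    rw [h.apply_self] at this
    exact (smul_ne_zero h.factor_ne_zero h.ne_zero) this

theorem coeffOp_apply_self_of_mem_cyclic (h : IsQuasiPrimitive e n) {m : MonoidAlgebra K (G ⧸ H)}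
    (hm : m ∈ (cyclic (tabloidRep K H) e).toSubmodule) :
    coeffOp (tabloidRep K H) m e = n • m := by
  induction hm using Submodule.span_induction with
  | mem _ hx =>
    obtain ⟨w, rfl⟩ := hx
    rw [coeffOp_tabloidRep_apply, h.apply_self, map_smul]
  | zero => simp
  | add x y _ _ hx hy => rw [map_add, LinearMap.add_apply, hx, hy, smul_add]
  | smul a x _ hx => rw [map_smul, LinearMap.smul_apply, hx, smul_comm]

theorem mul_character (h : IsQuasiPrimitive e n) (g : G) :
    n * (cyclic (tabloidRep K H) e).toRepresentation.character g =
      ∑ x : G, e.coeff ((x⁻¹ * g⁻¹ * x : G) : G ⧸ H) := by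
  let σ := cyclic (tabloidRep K H) e
  let coords : σ.toSubmodule →ₗ[K] G → K :=
    { toFun m x := (m : MonoidAlgebra K (G ⧸ H)).coeff (x : G ⧸ H)
      map_add' _ _ := by ext; simp
      map_smul' _ _ := by ext; simp }
  let conj (x : G) : σ.toSubmodule := ⟨tabloidRep K H x e, apply_mem_cyclic x e⟩
  have sum_smul_conj (m : σ.toSubmodule) : ∑ x, coords m x • conj x = n • m := by
    apply Subtype.ext
    rw [Submodule.coe_smul, ← h.coeffOp_apply_self_of_mem_cyclic m.2, coeffOp_apply,
      Submodule.coe_sum]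
    rfl
  refine (mul_trace_eq_sum_of_forall_sum_smul_eq coords conj n sum_smul_conj _).trans
    (Finset.sum_congr rfl fun x _ => ?_)
  change (tabloidRep K H g (tabloidRep K H x e)).coeff (x : G ⧸ H) = _
  rw [tabloidRep_coeff, tabloidRep_coeff, mul_assoc]

theorem nonempty_equiv [NeZero (Nat.card G : K)] (h : IsQuasiPrimitive e n)
    (ρ : Representation K G V) [ρ.IsIrreducible] (hρ : coeffOp ρ e ≠ 0) :
    Nonempty (ρ.Equiv (cyclic (tabloidRep K H) e).toRepresentation) := by
  have := h.isIrreducible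
  obtain ⟨v, hv⟩ : ∃ v, coeffOp ρ e v ≠ 0 := by
    by_contra! h0
    exact hρ (LinearMap.ext h0)
  let f : Representation.IntertwiningMap (cyclic (tabloidRep K H) e).toRepresentation ρ :=
    LinearMap.intertwiningMap_of_isIntertwiningMap _ _
      (((coeffOp ρ).flip v).domRestrict (cyclic (tabloidRep K H) e).toSubmodule)
      (fun g m => coeffOp_tabloidRep_apply ρ (m : MonoidAlgebra K (G ⧸ H)) g v)
  rcases Representation.IsIrreducible.bijective_or_eq_zero f with hf | hf
  · exact ⟨(f.ofBijective hf).symm⟩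
  · exact absurd (congrArg (fun F => F ⟨e, self_mem_cyclic e⟩) hf) hv

/-- `∑ g, χ(g⁻¹) g` is, up to the factor `n`, the sum of the conjugates of `∑ g, e(g) g`. -/
theorem sum_character_smul_eq_zero (h : IsQuasiPrimitive e n) {ρ : Representation K G V}
    (hρ : coeffOp ρ e = 0) (v : V) :
    ∑ g : G, (cyclic (tabloidRep K H) e).toRepresentation.character g⁻¹ • ρ g v = 0 := by
  have sum_conj : n • ∑ g : G,
      (cyclic (tabloidRep K H) e).toRepresentation.character g⁻¹ • ρ g v =
        ∑ x : G, ρ x (coeffOp ρ e (ρ x⁻¹ v)) := by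
    simp only [Finset.smul_sum, smul_smul, h.mul_character, inv_inv, Finset.sum_smul,
      coeffOp_apply, map_sum, map_smul]
    rw [Finset.sum_comm]
    refine Finset.sum_congr rfl fun x _ => ?_
    rw [← Equiv.sum_comp (MulAut.conj x).toEquiv]
    refine Finset.sum_congr rfl fun g _ => ?_
    have hg : (MulAut.conj x).toEquiv g = x * g * x⁻¹ := rfl
    rw [hg, ← Module.End.mul_apply, ← Module.End.mul_apply, ← map_mul, ← map_mul]
    congr 4
    group
  simp only [hρ, LinearMap.zero_apply, map_zero, Finset.sum_const_zero] at sum_conj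
  exact (smul_eq_zero.1 sum_conj).resolve_left h.factor_ne_zero

end IsQuasiPrimitive

theorem exists_coeffOp_ne_zero {ι : Type*} [Fintype ι] {H : ι → Subgroup G}
    {e : (i : ι) → MonoidAlgebra K (G ⧸ H i)} {n : ι → K} (he : ∀ i, IsQuasiPrimitive (e i) (n i))
    (c : ι → K)
    (hone : ∑ i, c i * (cyclic (tabloidRep K (H i)) (e i)).toRepresentation.character 1 ≠ 0)
    (hne : ∀ g ≠ 1,
      ∑ i, c i * (cyclic (tabloidRep K (H i)) (e i)).toRepresentation.character g = 0)
    [Nontrivial V] (ρ : Representation K G V) : ∃ i, coeffOp ρ (e i) ≠ 0 := by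
  by_contra! hzero
  obtain ⟨v, hv⟩ := exists_ne (0 : V)
  have sum_eq_zero : ∑ g : G, (∑ i, c i *
      (cyclic (tabloidRep K (H i)) (e i)).toRepresentation.character g⁻¹) • ρ g v = 0 := by
    simp only [Finset.sum_smul, mul_smul]
    rw [Finset.sum_comm]
    refine Finset.sum_eq_zero fun i _ => ?_
    rw [← Finset.smul_sum, (he i).sum_character_smul_eq_zero (hzero i), smul_zero]
  rw [Finset.sum_eq_single 1 (fun g _ hg => by rw [hne _ (inv_ne_one.2 hg), zero_smul])
    (fun h1 => absurd (Finset.mem_univ _) h1), inv_one, map_one,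
    Module.End.one_apply] at sum_eq_zero
  exact hv ((smul_eq_zero.1 sum_eq_zero).resolve_left hone)

end PermutationModule

/-! ### Signed sums over subgroups -/

section SignedSums

variable {G : Type*} [Group G]

/-- `β` restricts to a sign character of the subgroup which is its support. -/
structure IsSignFunction (β : G → ℤ) : Prop where
  map_one : β 1 = 1
  map_mul : ∀ u, β u ≠ 0 → ∀ g, β (g * u) = β g * β u

theorem IsSignFunction.mul_self {β : G → ℤ} (h : IsSignFunction β) {u : G} (hu : β u ≠ 0) :
    β u * β u = 1 := by
  have hinv : β u⁻¹ * β u = 1 := by rw [← h.map_mul u hu, inv_mul_cancel, h.map_one]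
  rcases Int.isUnit_iff.1 (IsUnit.of_mul_eq_one_right _ hinv) with hu | hu <;> rw [hu] <;> rfl

theorem IsSignFunction.mul_inv {β : G → ℤ} (h : IsSignFunction β) {u : G} (hu : β u ≠ 0) (g : G) :
    β (g * u⁻¹) = β u * β g := by
  have hmul := h.map_mul u hu (g * u⁻¹)
  rw [inv_mul_cancel_right] at hmul
  rw [hmul, mul_left_comm, h.mul_self hu, mul_one]

open Classical in
/-- The sign `s` on the subgroup `H'`, extended by zero. -/
def signOn (s : G → ℤ) (H' : Subgroup G) (g : G) : ℤ := if g ∈ H' then s g else 0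

section SignOn

variable {s : G → ℤ} {H' : Subgroup G} {g : G}

theorem signOn_of_mem (hg : g ∈ H') : signOn s H' g = s g := if_pos hg

theorem signOn_of_notMem (hg : g ∉ H') : signOn s H' g = 0 := if_neg hg

theorem mem_of_signOn_ne_zero (hg : signOn s H' g ≠ 0) : g ∈ H' := by
  by_contra hg'
  exact hg (signOn_of_notMem hg')

theorem isSignFunction_signOn (hmul : ∀ g h, s (g * h) = s g * s h) (hone : s 1 = 1)
    (H' : Subgroup G) : IsSignFunction (signOn s H') where
  map_one := by rw [signOn_of_mem H'.one_mem, hone]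
  map_mul u hu g := by
    have hu' := mem_of_signOn_ne_zero hu
    by_cases hg : g ∈ H' <;> simp [signOn, hu', H'.mul_mem_cancel_right hu', hmul, hg]

end SignOn

/-- The function obtained from `β` by multiplication with `1 - z`, for an involution `z`. -/
def twist (z : G) (β : G → ℤ) (g : G) : ℤ := β g - β (z * g)

theorem twist_signOn_of_mem {s : G → ℤ} {H' : Subgroup G} {z u : G} (hz : z ∉ H') (hu : u ∈ H') :
    twist z (signOn s H') u = s u := by
  rw [twist, signOn_of_mem hu, signOn_of_notMem (fun h => hz ((H'.mul_mem_cancel_right hu).1 h)),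
    sub_zero]

theorem twist_signOn_mul_of_mem {s : G → ℤ} {H' : Subgroup G} {z u : G} (hz2 : z * z = 1)
    (hz : z ∉ H') (hu : u ∈ H') : twist z (signOn s H') (z * u) = -s u := by
  rw [twist, ← mul_assoc, hz2, one_mul, signOn_of_mem hu,
    signOn_of_notMem (fun h => hz ((H'.mul_mem_cancel_right hu).1 h)), zero_sub]

theorem isSignFunction_twist_signOn {s : G → ℤ} (hmul : ∀ g h, s (g * h) = s g * s h)
    (hone : s 1 = 1) {H' : Subgroup G} {z : G} (hz : z ∈ Submonoid.center G) (hz2 : z * z = 1)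
    (hzH : z ∉ H') : IsSignFunction (twist z (signOn s H')) := by
  have hβ := isSignFunction_signOn hmul hone H'
  have hcomm := Submonoid.mem_center_iff.1 hz
  have hzmul {u} (hu : u ∈ H') : z * u ∉ H' := fun h => hzH ((H'.mul_mem_cancel_right hu).1 h)
  refine ⟨?_, fun u hu g => ?_⟩
  · rw [twist, hβ.map_one, mul_one, signOn_of_notMem hzH, sub_zero]
  · by_cases huH : u ∈ H'
    · have hu0 : signOn s H' u ≠ 0 := by
        simpa only [twist, signOn_of_notMem (hzmul huH), sub_zero] using hu
      rw [twist, twist, twist, signOn_of_notMem (hzmul huH), sub_zero, ← mul_assoc,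
        hβ.map_mul u hu0, hβ.map_mul u hu0, sub_mul]
    · have hzu0 : signOn s H' (z * u) ≠ 0 := by
        simpa only [twist, signOn_of_notMem huH, zero_sub, ne_eq, neg_eq_zero] using hu
      have hgu : g * u = (z * g) * (z * u) := by
        rw [← hcomm g, mul_assoc, ← mul_assoc z z, hz2, one_mul]
      have hzgu : z * (g * u) = g * (z * u) := by rw [← mul_assoc, ← hcomm, mul_assoc]
      rw [twist, hzgu, hgu, hβ.map_mul _ hzu0, hβ.map_mul _ hzu0, twist, twist,
        signOn_of_notMem huH]
      ring

variable {K : Type*} [Field K] [Fintype G] {H : Subgroup G}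

variable (K H) in
/-- The action of `∑ β(g) g` on the permutation module. -/
def signedSum (β : G → ℤ) : Module.End K (MonoidAlgebra K (G ⧸ H)) :=
  ∑ g : G, (β g : K) • tabloidRep K H g

theorem signedSum_apply (β : G → ℤ) (m : MonoidAlgebra K (G ⧸ H)) :
    signedSum K H β m = ∑ g : G, (β g : K) • tabloidRep K H g m := by
  simp [signedSum, LinearMap.sum_apply]

theorem kappa_eq_signedSum (s : G → ℤ) (H H' : Subgroup G) :
    kappa K s H H' = signedSum K H (signOn s H') := by
  classical
  rw [kappa, finsum_eq_sum_of_fintype, signedSum,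
    ← Finset.sum_subtype (p := (· ∈ H')) (Finset.univ.filter (· ∈ H')) (by simp)
      (fun σ : G => ((s σ : ℤ) : K) • tabloidRep K H σ), Finset.sum_filter]
  refine Finset.sum_congr rfl fun g _ => ?_
  unfold signOn
  split_ifs <;> simp

theorem polytabloid_eq_signedSum (s : G → ℤ) (H H' : Subgroup G) :
    polytabloid K s H H' = signedSum K H (signOn s H') (tabloid 1) := by
  rw [polytabloid, kappa_eq_signedSum]

theorem signedSum_twist {z : G} (hz2 : z * z = 1) (β : G → ℤ) (m : MonoidAlgebra K (G ⧸ H)) :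
    signedSum K H (twist z β) m =
      signedSum K H β m - tabloidRep K H z (signedSum K H β m) := by
  simp only [signedSum_apply, twist, Int.cast_sub, sub_smul, Finset.sum_sub_distrib, map_sum,
    map_smul]
  congr 1
  rw [← Equiv.sum_comp (Equiv.mulLeft z)]
  simp [← mul_assoc, hz2, ← Module.End.mul_apply, ← map_mul]

section TabloidCoeff

open Classical in
/-- The coefficient of `{gH}` in `∑ β(u) {uH}`. -/
def tabloidCoeff (H : Subgroup G) (β : G → ℤ) (g : G) : ℤ := ∑ u : G, if u⁻¹ * g ∈ H then β u else 0

theorem signedSum_coeff (β : G → ℤ) (g : G) :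
    (signedSum K H β (tabloid 1)).coeff (g : G ⧸ H) = (tabloidCoeff H β g : K) := by
  classical
  rw [signedSum_apply, tabloidCoeff, MonoidAlgebra.coeff_sum, Finsupp.finsetSum_apply]
  push_cast
  refine Finset.sum_congr rfl fun u _ => ?_
  rw [MonoidAlgebra.coeff_smul, Finsupp.smul_apply, tabloidRep_coeff, tabloid_coeff]
  simp

theorem tabloidCoeff_signOn_of_mem {s : G → ℤ} {H' : Subgroup G} (h : H ⊓ H' = ⊥) {u g : G}
    (hu : u ∈ H') (hg : u⁻¹ * g ∈ H) : tabloidCoeff H (signOn s H') g = s u := by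
  classical
  rw [tabloidCoeff, Finset.sum_eq_single u]
  · rw [if_pos hg, signOn_of_mem hu]
  · intro v _ hvu
    split_ifs with hv
    · refine signOn_of_notMem fun hvH' => hvu ?_
      have hmem : v⁻¹ * u ∈ H ⊓ H' := by
        refine ⟨?_, H'.mul_mem (H'.inv_mem hvH') hu⟩
        simpa [mul_assoc] using H.mul_mem hv (H.inv_mem hg)
      rw [h, Subgroup.mem_bot] at hmem
      exact inv_mul_eq_one.1 hmem
    · rfl
  · simp

theorem tabloidCoeff_signOn_of_notMem {s : G → ℤ} {H' : Subgroup G} {g : G}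
    (hg : ∀ u ∈ H', u⁻¹ * g ∉ H) : tabloidCoeff H (signOn s H') g = 0 := by
  refine Finset.sum_eq_zero fun u _ => ?_
  split_ifs with hu
  · exact signOn_of_notMem fun huH' => hg u huH' hu
  · rfl

theorem tabloidCoeff_twist {z : G} (β : G → ℤ) (g : G) :
    tabloidCoeff H (twist z β) g = tabloidCoeff H β g - tabloidCoeff H β (z * g) := by
  have hz : tabloidCoeff H β (z * g) = ∑ u : G, open Classical in
      if u⁻¹ * g ∈ H then β (z * u) else 0 := by
    rw [tabloidCoeff, ← Equiv.sum_comp (Equiv.mulLeft z)]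
    refine Finset.sum_congr rfl fun u _ => ?_
    rw [Equiv.coe_mulLeft, mul_inv_rev, mul_assoc, inv_mul_cancel_left]
  rw [hz, tabloidCoeff, tabloidCoeff, ← Finset.sum_sub_distrib]
  refine Finset.sum_congr rfl fun u _ => ?_
  split_ifs <;> simp [twist]

end TabloidCoeff

namespace IsSignFunction

variable {β : G → ℤ} {u w : G}

theorem signedSum_tabloidRep (h : IsSignFunction β) (hu : β u ≠ 0) (m : MonoidAlgebra K (G ⧸ H)) :
    signedSum K H β (tabloidRep K H u m) = (β u : K) • signedSum K H β m := by
  rw [signedSum_apply, signedSum_apply, Finset.smul_sum, ← Equiv.sum_comp (Equiv.mulRight u⁻¹)]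
  refine Finset.sum_congr rfl fun g _ => ?_
  rw [Equiv.coe_mulRight, h.mul_inv hu, Int.cast_mul, mul_smul, ← Module.End.mul_apply,
    ← _root_.map_mul, inv_mul_cancel_right]

theorem signedSum_tabloid (h : IsSignFunction β) (hu : β u ≠ 0) (hw : u⁻¹ * w ∈ H) :
    signedSum K H β (tabloid w) = (β u : K) • signedSum K H β (tabloid 1) := by
  have huw : (w : G ⧸ H) = u := (QuotientGroup.eq.2 hw).symm
  rw [← h.signedSum_tabloidRep hu, tabloidRep_tabloid, mul_one, tabloid, tabloid, huw]

theorem signedSum_tabloid_eq_zero [NeZero (2 : K)] (h : IsSignFunction β) (hu : β u = -1)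
    (hw : w⁻¹ * u * w ∈ H) : signedSum K H β (tabloid w) = 0 := by
  have huw : ((u * w : G) : G ⧸ H) = w := (QuotientGroup.eq.2 (by rwa [← mul_assoc])).symm
  have hneg := h.signedSum_tabloidRep (K := K) (by rw [hu]; decide) (tabloid (H := H) w)
  rw [tabloidRep_tabloid, tabloid, huw, hu, Int.cast_neg, Int.cast_one, neg_smul, one_smul,
    ← tabloid] at hneg
  rw [eq_neg_iff_add_eq_zero, ← two_smul K, smul_eq_zero] at hneg
  exact hneg.resolve_left two_ne_zero

end IsSignFunction

/-- Every tabloid is either in the `β`-orbit of `{H}` or killed by `∑ β(u) u`. -/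
def Covers (β : G → ℤ) (H : Subgroup G) : Prop :=
  ∀ w, (∃ u, β u ≠ 0 ∧ u⁻¹ * w ∈ H) ∨ ∃ u, β u = -1 ∧ w⁻¹ * u * w ∈ H

theorem IsSignFunction.signedSum_mem_span [NeZero (2 : K)] {β : G → ℤ} (h : IsSignFunction β)
    (hcov : Covers β H) (m : MonoidAlgebra K (G ⧸ H)) :
    signedSum K H β m ∈ K ∙ signedSum K H β (tabloid 1) := by
  induction m using MonoidAlgebra.induction_linear with
  | zero => simp
  | add x y hx hy => rw [map_add]; exact Submodule.add_mem _ hx hy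
  | single q a =>
    induction q using QuotientGroup.induction_on with
    | H w =>
      have hsmul : MonoidAlgebra.single (w : G ⧸ H) a = a • tabloid w := by simp [tabloid]
      rw [hsmul, map_smul]
      refine Submodule.smul_mem _ _ ?_
      rcases hcov w with ⟨u, hu, hw⟩ | ⟨u, hu, hw⟩
      · rw [h.signedSum_tabloid hu hw]
        exact Submodule.smul_mem _ _ (Submodule.mem_span_singleton_self _)
      · rw [h.signedSum_tabloid_eq_zero hu hw]
        exact Submodule.zero_mem _

theorem coeffOp_signedSum (β : G → ℤ) (m : MonoidAlgebra K (G ⧸ H)) :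
    coeffOp (tabloidRep K H) (signedSum K H β (tabloid 1)) m =
      signedSum K H β (coeffOp (tabloidRep K H) (tabloid (H := H) 1) m) := by
  simp only [signedSum_apply, map_sum, map_smul, LinearMap.sum_apply, LinearMap.smul_apply,
    coeffOp_tabloidRep_apply]

theorem coeffOp_self_eq_smul_of_mem_span {e : MonoidAlgebra K (G ⧸ H)}
    (he : e.coeff ((1 : G) : G ⧸ H) = 1) (hspan : coeffOp (tabloidRep K H) e e ∈ K ∙ e) :
    coeffOp (tabloidRep K H) e e =
      (∑ g : G, e.coeff (g : G ⧸ H) * e.coeff ((g⁻¹ : G) : G ⧸ H)) • e := by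
  obtain ⟨c, hc⟩ := Submodule.mem_span_singleton.1 hspan
  have hcoeff : (coeffOp (tabloidRep K H) e e).coeff ((1 : G) : G ⧸ H) =
      ∑ g : G, e.coeff (g : G ⧸ H) * e.coeff ((g⁻¹ : G) : G ⧸ H) := by
    rw [coeffOp_apply, MonoidAlgebra.coeff_sum, Finsupp.finsetSum_apply]
    simp only [MonoidAlgebra.coeff_smul, Finsupp.smul_apply, tabloidRep_coeff, mul_one, smul_eq_mul]
  rw [← hc, MonoidAlgebra.coeff_smul, Finsupp.smul_apply, he, smul_eq_mul, mul_one] at hcoeff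
  rw [← hc, hcoeff]

theorem IsSignFunction.isQuasiPrimitive [NeZero (2 : K)] {β : G → ℤ} (h : IsSignFunction β)
    (hcov : Covers β H) (hone : tabloidCoeff H β 1 = 1) {n : ℤ}
    (hn : ∑ g, tabloidCoeff H β g * tabloidCoeff H β g⁻¹ = n) (hn0 : (n : K) ≠ 0) :
    IsQuasiPrimitive (signedSum K H β (tabloid 1)) (n : K) := by
  have hcoeff : (signedSum K H β (tabloid 1)).coeff ((1 : G) : G ⧸ H) = 1 := by
    rw [signedSum_coeff, hone, Int.cast_one]
  have hspan (m) : coeffOp (tabloidRep K H) (signedSum K H β (tabloid 1)) m ∈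
      K ∙ signedSum K H β (tabloid 1) := by
    rw [coeffOp_signedSum]
    exact h.signedSum_mem_span hcov _
  refine ⟨hspan, ?_, hn0, fun h0 => ?_⟩
  · rw [coeffOp_self_eq_smul_of_mem_span hcoeff (hspan _), ← hn]
    simp only [signedSum_coeff, Int.cast_sum, Int.cast_mul]
  · rw [h0] at hcoeff
    exact zero_ne_one hcoeff

end SignedSums

/-! ### Quotients by a central involution -/

section CentralInvolution

variable {K G V V' : Type*} [Field K] [Group G] [AddCommGroup V] [Module K V]
  [AddCommGroup V'] [Module K V'] {ρ : Representation K G V} {ρ' : Representation K G V'}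

theorem isIrreducible_of_equiv (φ : ρ.Equiv ρ') (h : ρ'.IsIrreducible) : ρ.IsIrreducible := by
  rw [Representation.irreducible_iff_isSimpleModule_asModule] at h ⊢
  let f : ρ.asModule →ₗ[MonoidAlgebra K G] ρ'.asModule :=
    Representation.IntertwiningMap.equivLinearMapAsModule ρ ρ' φ.toIntertwiningMap
  have hf : Function.Bijective f := φ.toLinearEquiv.bijective
  exact IsSimpleModule.congr (LinearEquiv.ofBijective f hf)

theorem map_cyclic (f : ρ.IntertwiningMap ρ') (v : V) :
    (cyclic ρ v).toSubmodule.map f.toLinearMap = (cyclic ρ' (f v)).toSubmodule := by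
  have hcomp : f.toLinearMap ∘ (fun g => ρ g v) = fun g => ρ' g (f v) :=
    funext fun g => Representation.IntertwiningMap.isIntertwining _ _ f g v
  rw [cyclic, cyclic, Submodule.map_span, ← Set.range_comp, hcomp]

theorem nonempty_subquotient_equiv (f : ρ.IntertwiningMap ρ') {σ₁ σ₂ : Subrepresentation ρ}
    {σ' : Subrepresentation ρ'} (hmap : σ₁.toSubmodule.map f.toLinearMap = σ'.toSubmodule)
    (hker : ∀ x ∈ σ₁.toSubmodule, f x = 0 ↔ x ∈ σ₂.toSubmodule) :
    Nonempty ((subquotient σ₁ σ₂).Equiv σ'.toRepresentation) := by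
  let F : σ₁.toSubmodule →ₗ[K] σ'.toSubmodule :=
    f.toLinearMap.restrict fun x hx => hmap ▸ Submodule.mem_map_of_mem hx
  have hF : LinearMap.ker F = σ₂.toSubmodule.submoduleOf σ₁.toSubmodule := by
    ext x
    exact Subtype.ext_iff.trans (hker x x.2)
  have hsurj : Function.Surjective F := by
    rintro ⟨y, hy⟩
    obtain ⟨x, hx, rfl⟩ := Submodule.mem_map.1 (hmap ▸ hy)
    exact ⟨⟨x, hx⟩, rfl⟩
  refine ⟨.mk ((Submodule.quotEquivOfEq _ _ hF.symm).trans (F.quotKerEquivOfSurjective hsurj))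
    fun g => LinearMap.ext fun q => ?_⟩
  induction q using Submodule.Quotient.induction_on with
  | H x => exact Subtype.ext (Representation.IntertwiningMap.isIntertwining _ _ f g x)

variable {z : G} {v : V}

/-- The kernel of `1 - z` is the image of `1 + z`, because `2` is invertible. -/
theorem nonempty_subquotient_cyclic_equiv [NeZero (2 : K)] (hz : z ∈ Submonoid.center G)
    (hz2 : z * z = 1) : Nonempty ((subquotient (cyclic ρ v) (cyclic ρ (v + ρ z v))).Equiv
      (cyclic ρ (v - ρ z v)).toRepresentation) := by
  let Z : ρ.IntertwiningMap ρ := .centralMul ρ z hz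
  refine nonempty_subquotient_equiv (.id ρ - Z) (map_cyclic (.id ρ - Z) v) fun x hx => ?_
  change x - ρ z x = 0 ↔ x ∈ (cyclic ρ ((Representation.IntertwiningMap.id ρ + Z) v)).toSubmodule
  rw [sub_eq_zero, ← map_cyclic]
  constructor
  · intro hzx
    refine ⟨(2⁻¹ : K) • x, Submodule.smul_mem _ _ hx, ?_⟩
    change (2⁻¹ : K) • x + ρ z ((2⁻¹ : K) • x) = x
    rw [map_smul, ← hzx, ← two_smul K, smul_inv_smul₀ two_ne_zero]
  · rintro ⟨y, -, rfl⟩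
    change y + ρ z y = ρ z (y + ρ z y)
    rw [map_add, ← Module.End.mul_apply, ← map_mul, hz2, map_one, Module.End.one_apply, add_comm]

theorem cyclic_add_apply_le : cyclic ρ (v + ρ z v) ≤ cyclic ρ v :=
  cyclic_le (Submodule.add_mem _ (self_mem_cyclic v) (apply_mem_cyclic z v))

end CentralInvolution

/-! ### Reflections -/

section Reflections

variable {E : Type*} [NormedAddCommGroup E] [InnerProductSpace ℝ E]

theorem refl_apply (α v : E) : refl α v = v - (2 * ⟪α, v⟫ / ‖α‖ ^ 2) • α := by
  rw [refl, Submodule.reflection_orthogonal_apply, Submodule.reflection_singleton_apply, neg_sub,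
    mul_div_assoc, mul_smul, ofNat_smul_eq_nsmul ℝ]
  rfl

theorem refl_self (α : E) : refl α α = -α :=
  Submodule.reflection_orthogonalComplement_singleton_eq_neg α

theorem refl_mul_self (α : E) : refl α * refl α = 1 := Submodule.reflection_mul_reflection _

theorem refl_inv (α : E) : (refl α)⁻¹ = refl α := Submodule.reflection_inv

theorem refl_map (w : E ≃ₗᵢ[ℝ] E) (α : E) : refl (w α) = w * refl α * w⁻¹ := by
  ext v
  obtain ⟨u, rfl⟩ := w.surjective v
  have hu : w⁻¹ (w u) = u := w.symm_apply_apply u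
  simp only [LinearIsometryEquiv.coe_mul, Function.comp_apply, hu, refl_apply, w.inner_map_map,
    w.norm_map, map_sub, map_smul]

end Reflections

/-! ### Signed permutations as octal numerals

The isometry which maps `ε i` to `± ε (σ i)` is encoded by the number whose `i`-th octal digit is
`σ i` for the sign `+`, and `σ i + 4` for the sign `-`. The functions on codes are built from the
operations on `ℕ` which the kernel evaluates on binary numerals. -/

section Codes

/-- The `i`-th octal digit of `n`. -/
def octalDigit (n i : ℕ) : ℕ := Nat.land (Nat.shiftRight n (Nat.mul 3 i)) 7

/-- The number with the octal digits `a`, `b`, `c`, `d`, the least significant one first. -/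
def ofOctalDigits (a b c d : ℕ) : ℕ := a + 8 * b + 64 * c + 512 * d

/-- The action of a code on the numbers `x < 8`, where `x < 4` stands for `ε x` and `x + 4` for
`-ε x`. -/
def codeAct (n x : ℕ) : ℕ := Nat.xor (octalDigit n (Nat.land x 3)) (Nat.land x 4)

/-- The code of a product of signed permutations. -/
def codeMul (m n : ℕ) : ℕ :=
  ofOctalDigits (codeAct m (octalDigit n 0)) (codeAct m (octalDigit n 1))
    (codeAct m (octalDigit n 2)) (codeAct m (octalDigit n 3))

/-- The code of the inverse of a signed permutation: the octal digit `σ j + 4 s` at the place `j`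
contributes the digit `j + 4 s` at the place `σ j`. -/
def codeInv (n : ℕ) : ℕ :=
  let term := fun j => Nat.shiftLeft (Nat.xor j (Nat.land (octalDigit n j) 4))
    (Nat.mul 3 (Nat.land (octalDigit n j) 3))
  term 0 + term 1 + term 2 + term 3

/-- The code of the identity. -/
def codeOne : ℕ := ofOctalDigits 0 1 2 3

/-- The sign of the underlying permutation, as a product over the pairs of places. -/
def codeSign (n : ℕ) : ℤ :=
  let order := fun i j =>
    if Nat.blt (Nat.land (octalDigit n i) 3) (Nat.land (octalDigit n j) 3) then (1 : ℤ) else -1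
  order 0 1 * order 0 2 * order 0 3 * order 1 2 * order 1 3 * order 2 3

theorem octalDigit_lt (n i : ℕ) : octalDigit n i < 8 :=
  Nat.lt_succ_of_le (Nat.and_le_right (n := n >>> (3 * i)) (m := 7))

theorem land_three_lt (x : ℕ) : Nat.land x 3 < 4 :=
  Nat.lt_succ_of_le (Nat.and_le_right (n := x) (m := 3))

theorem codeAct_lt (n x : ℕ) : codeAct n x < 8 :=
  Nat.xor_lt_two_pow (n := 3) (octalDigit_lt _ _)
    ((Nat.and_le_right (n := x) (m := 4)).trans_lt (by norm_num))

theorem octalDigit_eq_div_mod (n i : ℕ) : octalDigit n i = n / 2 ^ (3 * i) % 8 := by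
  rw [← Nat.shiftRight_eq_div_pow]
  exact Nat.and_two_pow_sub_one_eq_mod (n >>> (3 * i)) 3

theorem octalDigit_codeMul (m n : ℕ) {i : ℕ} (hi : i < 4) :
    octalDigit (codeMul m n) i = codeAct m (octalDigit n i) := by
  have hlt (j) := codeAct_lt m (octalDigit n j)
  rw [octalDigit_eq_div_mod, codeMul, ofOctalDigits]
  have := hlt 0; have := hlt 1; have := hlt 2; have := hlt 3
  interval_cases i <;> norm_num <;> omega

theorem codeAct_codeMul (m n : ℕ) {x : ℕ} (hx : x < 8) :
    codeAct (codeMul m n) x = codeAct m (codeAct n x) := by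
  have split_digit : ∀ d < 8, ∀ x < 8, Nat.land (Nat.xor d (Nat.land x 4)) 3 = Nat.land d 3 ∧
      Nat.land (Nat.xor d (Nat.land x 4)) 4 = Nat.xor (Nat.land d 4) (Nat.land x 4) := by decide
  obtain ⟨hplace, hsign⟩ := split_digit (octalDigit n (Nat.land x 3)) (octalDigit_lt _ _) x hx
  rw [codeAct, octalDigit_codeMul m n (land_three_lt x), codeAct, codeAct, codeAct, hplace, hsign]
  exact Nat.xor_assoc _ _ _

theorem codeMul_codeOne_congr {m n : ℕ} (h : ∀ x < 8, codeAct m x = codeAct n x) :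
    codeMul m codeOne = codeMul n codeOne := by
  simp only [codeMul, h _ (octalDigit_lt _ _)]

theorem codeMul_assoc (l m n : ℕ) : codeMul (codeMul l m) n = codeMul l (codeMul m n) := by
  rw [codeMul]
  simp only [codeAct_codeMul _ _ (octalDigit_lt _ _)]
  rw [codeMul]
  simp only [octalDigit_codeMul, Nat.ofNat_pos, Nat.one_lt_ofNat, Nat.reduceLT]

end Codes

/-! ### The vectors encoded by digits and by pairs of digits -/

section SignedUnits

/-- The coordinates of `signedε x`. -/
def signedεCoord (x : ℕ) (i : Fin 4) : ℤ :=
  bif Nat.land x 3 == i.val then (bif Nat.land x 4 == 0 then 1 else -1) else 0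

/-- The vector `ε x` for `x < 4`, and `-ε (x - 4)` for `4 ≤ x < 8`. -/
def signedε (x : ℕ) : V4 := WithLp.toLp 2 fun i => (signedεCoord x i : ℝ)

theorem signedε_apply (x : ℕ) (i : Fin 4) : signedε x i = (signedεCoord x i : ℝ) := rfl

theorem signedε_val (i : Fin 4) : signedε i = ε i := by
  ext j
  rw [signedε_apply, ε]
  fin_cases i <;> fin_cases j <;> simp [signedεCoord]

theorem signedε_val_add_four (i : Fin 4) : signedε (i + 4) = -ε i := by
  have hcoord : ∀ i j : Fin 4, signedεCoord (i.val + 4) j = -signedεCoord i.val j := by decide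
  ext j
  rw [PiLp.neg_apply, ← signedε_val, signedε_apply, signedε_apply, hcoord, Int.cast_neg]

theorem signedε_injOn : Set.InjOn signedε {x | x < 8} := by
  have hcoord : ∀ x < 8, ∀ y < 8, (∀ i, signedεCoord x i = signedεCoord y i) → x = y := by
    decide +kernel
  intro x hx y hy hxy
  refine hcoord x hx y hy fun i => ?_
  simpa only [signedε_apply, Int.cast_inj] using congrArg (fun v : V4 => v i) hxy

theorem eq_sum_signedε (v : V4) : v = ∑ i : Fin 4, v i • signedε i := by
  ext j
  simp only [Fin.sum_univ_four, PiLp.add_apply, PiLp.smul_apply, signedε_apply]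
  fin_cases j <;> simp [signedεCoord]

/-- The sum of the vectors encoded by the two entries of `p`. -/
def pairVec (p : ℕ × ℕ) : V4 := signedε p.1 + signedε p.2

/-- The coordinates of `pairVec p`. -/
def pairCoord (p : ℕ × ℕ) (i : Fin 4) : ℤ := signedεCoord p.1 i + signedεCoord p.2 i

theorem pairVec_apply (p : ℕ × ℕ) (i : Fin 4) : pairVec p i = (pairCoord p i : ℝ) := by
  simp [pairVec, pairCoord, signedε_apply]

/-- The standard inner product of integral vectors. -/
def dot (a b : Fin 4 → ℤ) : ℤ := a 0 * b 0 + a 1 * b 1 + a 2 * b 2 + a 3 * b 3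

theorem inner_eq_dot {u v : V4} {a b : Fin 4 → ℤ} (hu : ∀ i, u i = a i) (hv : ∀ i, v i = b i) :
    ⟪u, v⟫ = (dot a b : ℝ) := by
  simp only [PiLp.inner_apply, Fin.sum_univ_four, hu, hv, dot, RCLike.inner_apply, conj_trivial]
  push_cast
  ring

theorem inner_pairVec (p q : ℕ × ℕ) :
    ⟪pairVec p, pairVec q⟫ = (dot (pairCoord p) (pairCoord q) : ℝ) :=
  inner_eq_dot (pairVec_apply p) (pairVec_apply q)

/-- The pairs encoding the roots of `D₄`, each root being listed once. -/
def rootPairs : List (ℕ × ℕ) :=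
  (List.range 8).flatMap fun a =>
    ((List.range 8).filter fun b => Nat.blt (Nat.land a 3) (Nat.land b 3)).map fun b => (a, b)

/-- The pairs encoding `α₁`, `α₂`, `α₃`, `α₄`. -/
def simplePairs : List (ℕ × ℕ) := [(0, 5), (1, 6), (2, 7), (2, 3)]

theorem simplePairs_subset : simplePairs ⊆ rootPairs := by decide

theorem lt_eight_of_mem_rootPairs : ∀ p ∈ rootPairs, p.1 < 8 ∧ p.2 < 8 := by decide

theorem α_eq_pairVec (i : Fin 4) : α i = pairVec simplePairs[i] := by
  have hneg (i : Fin 4) : -ε i = signedε (i + 4) := (signedε_val_add_four i).symm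
  fin_cases i
  · change ε 0 - ε 1 = signedε 0 + signedε 5
    rw [sub_eq_add_neg, hneg, ← signedε_val]; rfl
  · change ε 1 - ε 2 = signedε 1 + signedε 6
    rw [sub_eq_add_neg, hneg, ← signedε_val]; rfl
  · change ε 2 - ε 3 = signedε 2 + signedε 7
    rw [sub_eq_add_neg, hneg, ← signedε_val]; rfl
  · change ε 2 + ε 3 = signedε 2 + signedε 3
    rw [← signedε_val, ← signedε_val]; rfl

theorem normSq_pairVec {p : ℕ × ℕ} (hp : p ∈ rootPairs) : ‖pairVec p‖ ^ 2 = 2 := by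
  have hdot : ∀ p ∈ rootPairs, dot (pairCoord p) (pairCoord p) = 2 := by decide
  rw [← real_inner_self_eq_norm_sq, inner_pairVec, hdot p hp]
  norm_num

theorem mem_Φ_iff_exists_signedε {v : V4} : v ∈ Φ ↔ ∃ i j : Fin 4, i ≠ j ∧
    ∃ s ∈ [0, 4], ∃ t ∈ [0, 4], v = pairVec (i + s, j + t) := by
  simp only [Φ, pairVec, Set.mem_ofPred_eq, List.mem_cons, List.not_mem_nil, or_false,
    exists_eq_or_imp, exists_eq_left, add_zero, signedε_val, signedε_val_add_four, or_assoc,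
    sub_eq_add_neg]

theorem mem_Φ_iff {v : V4} : v ∈ Φ ↔ ∃ p ∈ rootPairs, v = pairVec p := by
  rw [mem_Φ_iff_exists_signedε]
  constructor
  · have mem_or_swap_mem : ∀ i j : Fin 4, i ≠ j → ∀ s ∈ [0, 4], ∀ t ∈ [0, 4],
        (i.val + s, j.val + t) ∈ rootPairs ∨ (j.val + t, i.val + s) ∈ rootPairs := by decide
    rintro ⟨i, j, hij, s, hs, t, ht, rfl⟩
    rcases mem_or_swap_mem i j hij s hs t ht with hp | hp
    · exact ⟨_, hp, rfl⟩
    · exact ⟨_, hp, add_comm _ _⟩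
  · have exists_places : ∀ p ∈ rootPairs, ∃ i j : Fin 4, i ≠ j ∧
        ∃ s ∈ [0, 4], ∃ t ∈ [0, 4], p = (i.val + s, j.val + t) := by decide
    rintro ⟨p, hp, rfl⟩
    obtain ⟨i, j, hij, s, hs, t, ht, rfl⟩ := exists_places p hp
    exact ⟨i, j, hij, s, hs, t, ht, rfl⟩

/-- The code of the reflection in the root encoded by `p`. -/
def reflCode (p : ℕ × ℕ) : ℕ :=
  let image := fun x => bif x == p.1 then Nat.xor p.2 4 else bif x == Nat.xor p.1 4 then p.2 else
    bif x == p.2 then Nat.xor p.1 4 else bif x == Nat.xor p.2 4 then p.1 else x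
  ofOctalDigits (image 0) (image 1) (image 2) (image 3)

/-- The isometry `w` is the signed permutation with code `n`. -/
def HasCode (w : V4 ≃ₗᵢ[ℝ] V4) (n : ℕ) : Prop := ∀ x < 8, w (signedε x) = signedε (codeAct n x)

theorem hasCode_one : HasCode 1 codeOne := by
  have codeAct_codeOne : ∀ x < 8, codeAct codeOne x = x := by decide
  intro x hx
  rw [codeAct_codeOne x hx]
  rfl

theorem HasCode.mul {v w : V4 ≃ₗᵢ[ℝ] V4} {m n : ℕ} (hv : HasCode v m) (hw : HasCode w n) :
    HasCode (v * w) (codeMul m n) := by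
  intro x hx
  rw [LinearIsometryEquiv.coe_mul, Function.comp_apply, hw x hx, hv _ (codeAct_lt _ _),
    codeAct_codeMul m n hx]

theorem HasCode.unique {v w : V4 ≃ₗᵢ[ℝ] V4} {n : ℕ} (hv : HasCode v n) (hw : HasCode w n) :
    v = w := by
  ext1 x
  rw [eq_sum_signedε x, map_sum, map_sum]
  refine Finset.sum_congr rfl fun i _ => ?_
  rw [map_smul, map_smul, hv i (by omega), hw i (by omega)]

theorem hasCode_refl {p : ℕ × ℕ} (hp : p ∈ rootPairs) :
    HasCode (refl (pairVec p)) (reflCode p) := by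
  have coord_codeAct_reflCode : ∀ p ∈ rootPairs, ∀ x < 8, ∀ i : Fin 4,
      signedεCoord (codeAct (reflCode p) x) i =
        signedεCoord x i - dot (pairCoord p) (signedεCoord x) * pairCoord p i := by
    decide +kernel
  intro x hx
  rw [refl_apply, normSq_pairVec hp, inner_eq_dot (pairVec_apply p) (signedε_apply x)]
  ext i
  rw [PiLp.sub_apply, PiLp.smul_apply, smul_eq_mul, pairVec_apply, signedε_apply, signedε_apply,
    coord_codeAct_reflCode p hp x hx]
  push_cast
  ring

end SignedUnits

/-! ### Enumerating groups of signed permutations -/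

section Enumeration

/-- Depth-first search for the products of elements of `gens`, with a bound on the number of steps:
`seen` is the bit mask of the codes visited so far, and `acc` is their list. -/
def codeClosureAux (gens : List ℕ) : ℕ → List ℕ → ℕ → List ℕ → List ℕ
  | 0, _, _, acc => acc
  | _ + 1, [], _, acc => acc
  | fuel + 1, x :: todo, seen, acc =>
    bif seen.testBit x then codeClosureAux gens fuel todo seen acc
    else codeClosureAux gens fuel (gens.map (codeMul · x) ++ todo)
      (Nat.lor seen (Nat.shiftLeft 1 x)) (x :: acc)

/-- The codes of the group generated by `gens`. A group of order at most `192` with at most four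
generators needs at most `1 + 192 + 4 * 192` steps in the worst case; `800` suffice for all the
groups considered here. -/
def codeClosure (gens : List ℕ) : List ℕ := codeClosureAux gens 800 [codeOne] 0 []

theorem forall_mem_codeClosureAux {gens : List ℕ} {P : ℕ → Prop}
    (hmul : ∀ g ∈ gens, ∀ x, P x → P (codeMul g x)) (fuel : ℕ) (todo : List ℕ) (seen : ℕ)
    (acc : List ℕ) (htodo : ∀ x ∈ todo, P x) (hacc : ∀ x ∈ acc, P x) :
    ∀ x ∈ codeClosureAux gens fuel todo seen acc, P x := by
  induction fuel generalizing todo seen acc with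
  | zero => exact hacc
  | succ fuel ih =>
    cases todo with
    | nil => exact hacc
    | cons x todo =>
      obtain ⟨hx, htodo⟩ := List.forall_mem_cons.1 htodo
      rw [codeClosureAux]
      cases seen.testBit x with
      | true => exact ih _ _ _ htodo hacc
      | false =>
        refine ih _ _ _ (List.forall_mem_append.2 ⟨?_, htodo⟩) (List.forall_mem_cons.2 ⟨hx, hacc⟩)
        exact List.forall_mem_map.2 fun g hg => hmul g hg x hx

theorem forall_mem_codeClosure {gens : List ℕ} {P : ℕ → Prop} (hone : P codeOne)
    (hmul : ∀ g ∈ gens, ∀ x, P x → P (codeMul g x)) : ∀ x ∈ codeClosure gens, P x :=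
  forall_mem_codeClosureAux hmul _ _ _ _ (by simpa using hone) (by simp)

/-- The bit mask of a list of codes, which gives fast membership tests. -/
def bitmask (l : List ℕ) : ℕ := l.foldr (fun x m => Nat.lor m (Nat.shiftLeft 1 x)) 0

theorem testBit_bitmask (l : List ℕ) (x : ℕ) : (bitmask l).testBit x = true ↔ x ∈ l := by
  induction l with
  | nil => simp [bitmask]
  | cons y l ih =>
    have hcons : bitmask (y :: l) = bitmask l ||| 1 <<< y := rfl
    rw [hcons, Nat.testBit_or, Bool.or_eq_true, ih, List.mem_cons, Nat.one_shiftLeft,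
      Nat.testBit_two_pow, decide_eq_true_eq, or_comm, eq_comm]

/-- The codes of the elements of the Weyl group of type `D₄`. -/
def weylCodes : List ℕ := codeClosure (simplePairs.map reflCode)

theorem nodup_weylCodes : weylCodes.Nodup := by decide +kernel

theorem codeOne_mem_weylCodes : codeOne ∈ weylCodes := by decide +kernel

theorem codeMul_codeOne : ∀ n ∈ weylCodes, codeMul n codeOne = n := by decide +kernel

theorem codeInv_codeMul_self : ∀ n ∈ weylCodes, codeMul (codeInv n) n = codeOne := by
  decide +kernel

theorem codeInv_mem_weylCodes {n : ℕ} (hn : n ∈ weylCodes) : codeInv n ∈ weylCodes := by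
  have testBit_codeInv : ∀ n ∈ weylCodes, (bitmask weylCodes).testBit (codeInv n) = true := by
    decide +kernel
  exact (testBit_bitmask _ _).1 (testBit_codeInv n hn)

theorem codeMul_reflCode_mem_weylCodes {n : ℕ} (hn : n ∈ weylCodes) {p : ℕ × ℕ}
    (hp : p ∈ rootPairs) : codeMul (reflCode p) n ∈ weylCodes := by
  have testBit_codeMul : ∀ n ∈ weylCodes, ∀ p ∈ rootPairs,
      (bitmask weylCodes).testBit (codeMul (reflCode p) n) = true := by
    decide +kernel
  exact (testBit_bitmask _ _).1 (testBit_codeMul n hn p hp)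

theorem codeSign_codeMul_reflCode :
    ∀ n ∈ weylCodes, ∀ p ∈ simplePairs, codeSign (codeMul (reflCode p) n) = -codeSign n := by
  decide +kernel

end Enumeration

/-! ### The elements of the Weyl group -/

section WeylGroup

/-- The reflection in the root encoded by `p`, as an element of `W`. -/
def pairRefl (p : ℕ × ℕ) (hp : p ∈ rootPairs) : W :=
  ⟨refl (pairVec p), Subgroup.subset_closure ⟨pairVec p, mem_Φ_iff.2 ⟨p, hp, rfl⟩, rfl⟩⟩

theorem exists_hasCode (w : W) : ∃ n ∈ weylCodes, HasCode w n := by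
  obtain ⟨w, hw⟩ := w
  have refl_mul {r : V4} (hr : r ∈ Φ) {v : V4 ≃ₗᵢ[ℝ] V4} :
      (∃ n ∈ weylCodes, HasCode v n) → ∃ n ∈ weylCodes, HasCode (refl r * v) n := by
    rintro ⟨n, hn, hv⟩
    obtain ⟨p, hp, rfl⟩ := mem_Φ_iff.1 hr
    exact ⟨_, codeMul_reflCode_mem_weylCodes hn hp, (hasCode_refl hp).mul hv⟩
  induction hw using Subgroup.closure_induction_left with
  | one => exact ⟨codeOne, codeOne_mem_weylCodes, hasCode_one⟩
  | mul_left x hx y _ ih =>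
    obtain ⟨r, hr, rfl⟩ := hx
    exact refl_mul hr ih
  | inv_mul_cancel x hx y _ ih =>
    obtain ⟨r, hr, rfl⟩ := hx
    obtain ⟨n, hn, hw⟩ := refl_mul hr ih
    exact ⟨n, hn, by simpa only [refl_inv] using hw⟩

/-- The code of an element of the Weyl group. -/
def code (w : W) : ℕ := (exists_hasCode w).choose

theorem code_mem_weylCodes (w : W) : code w ∈ weylCodes := (exists_hasCode w).choose_spec.1

theorem hasCode_code (w : W) : HasCode w (code w) := (exists_hasCode w).choose_spec.2

theorem code_injective : Function.Injective code := fun v w h =>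
  Subtype.ext ((hasCode_code v).unique (h ▸ hasCode_code w))

theorem code_eq_of_hasCode {w : W} {n : ℕ} (hn : codeMul n codeOne = n) (hw : HasCode w n) :
    code w = n := by
  rw [← hn, ← codeMul_codeOne _ (code_mem_weylCodes w)]
  refine codeMul_codeOne_congr fun x hx => ?_
  exact signedε_injOn (codeAct_lt _ _) (codeAct_lt _ _)
    ((hasCode_code w x hx).symm.trans (hw x hx))

theorem code_one : code 1 = codeOne := code_eq_of_hasCode (by decide) hasCode_one

theorem code_mul (v w : W) : code (v * w) = codeMul (code v) (code w) :=
  code_eq_of_hasCode (by rw [codeMul_assoc, codeMul_codeOne _ (code_mem_weylCodes w)])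
    ((hasCode_code v).mul (hasCode_code w))

theorem code_pairRefl {p : ℕ × ℕ} (hp : p ∈ rootPairs) : code (pairRefl p hp) = reflCode p := by
  have codeMul_reflCode_codeOne : ∀ p ∈ rootPairs,
      codeMul (reflCode p) codeOne = reflCode p := by
    decide +kernel
  exact code_eq_of_hasCode (codeMul_reflCode_codeOne p hp) (hasCode_refl hp)

theorem simplePairs_getElem_mem (i : Fin 4) : simplePairs[i] ∈ rootPairs :=
  simplePairs_subset (List.getElem_mem _)

theorem τ_eq_pairRefl (i : Fin 4) : τ i = pairRefl simplePairs[i] (simplePairs_getElem_mem i) :=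
  Subtype.ext (congrArg refl (α_eq_pairVec i))

theorem code_τ (i : Fin 4) : code (τ i) = reflCode simplePairs[i] := by
  rw [τ_eq_pairRefl, code_pairRefl]

theorem exists_prod_τ_hasCode : ∀ n ∈ weylCodes, ∃ l : List (Fin 4), HasCode (l.map τ).prod n := by
  refine forall_mem_codeClosure ⟨[], hasCode_one⟩ fun g hg x ⟨l, hl⟩ => ?_
  obtain ⟨p, hp, rfl⟩ := List.mem_map.1 hg
  obtain ⟨i, hi, rfl⟩ := List.getElem_of_mem hp
  refine ⟨⟨i, hi⟩ :: l, ?_⟩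
  rw [List.map_cons, List.prod_cons, τ_eq_pairRefl]
  exact (hasCode_refl (simplePairs_subset hp)).mul hl

theorem exists_prod_τ_eq (w : W) : ∃ l : List (Fin 4), (l.map τ).prod = w := by
  obtain ⟨l, hl⟩ := exists_prod_τ_hasCode _ (code_mem_weylCodes w)
  exact ⟨l, Subtype.ext (hl.unique (hasCode_code w))⟩

theorem exists_code_eq {n : ℕ} (hn : n ∈ weylCodes) : ∃ w, code w = n := by
  obtain ⟨l, hl⟩ := exists_prod_τ_hasCode n hn
  exact ⟨_, code_eq_of_hasCode (codeMul_codeOne n hn) hl⟩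

theorem code_inv (w : W) : code w⁻¹ = codeInv (code w) := by
  obtain ⟨v, hv⟩ := exists_code_eq (codeInv_mem_weylCodes (code_mem_weylCodes w))
  have hvw : v * w = 1 := code_injective <| by
    rw [code_mul, hv, codeInv_codeMul_self _ (code_mem_weylCodes w), code_one]
  rw [← hv, eq_inv_of_mul_eq_one_left hvw]

instance : Finite W :=
  Finite.of_injective (fun w => (⟨code w, List.mem_toFinset.2 (code_mem_weylCodes w)⟩ :
    weylCodes.toFinset)) fun _ _ h => code_injective (congrArg Subtype.val h)

instance : Fintype W := Fintype.ofFinite W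

theorem sum_code {M : Type*} [AddCommMonoid M] (f : ℕ → M) :
    ∑ w : W, f (code w) = (weylCodes.map f).sum := by
  rw [← List.sum_toFinset f nodup_weylCodes]
  refine Finset.sum_bij (fun w _ => code w)
    (fun w _ => List.mem_toFinset.2 (code_mem_weylCodes w))
    (fun v _ w _ h => code_injective h) (fun n hn => ?_) fun _ _ => rfl
  obtain ⟨w, hw⟩ := exists_code_eq (List.mem_toFinset.1 hn)
  exact ⟨w, Finset.mem_univ _, hw⟩

end WeylGroup

/-! ### The sign character -/

section Sign

theorem exists_map_τ_eq {l : List W} (hl : ∀ x ∈ l, ∃ a ∈ π, (x : V4 ≃ₗᵢ[ℝ] V4) = refl a) :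
    ∃ k : List (Fin 4), k.map τ = l := by
  suffices l ∈ Set.range (List.map τ) from this
  rw [Set.range_list_map]
  intro x hx
  obtain ⟨_, ⟨i, rfl⟩, hxi⟩ := hl x hx
  exact ⟨i, Subtype.ext hxi.symm⟩

theorem codeSign_code_prod_τ (l : List (Fin 4)) :
    codeSign (code (l.map τ).prod) = (-1) ^ l.length := by
  induction l with
  | nil => rw [List.map_nil, List.prod_nil, code_one]; decide
  | cons i l ih =>
    have hsign := codeSign_codeMul_reflCode _ (code_mem_weylCodes (l.map τ).prod) simplePairs[i]
      (List.getElem_mem _)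
    rw [List.map_cons, List.prod_cons, code_mul, code_τ, hsign, ih, List.length_cons, pow_succ,
      mul_neg_one]

theorem sign_eq_codeSign (w : W) : sign Φ π w = codeSign (code w) := by
  have hne : {n | ∃ l : List (weyl Φ), (∀ x ∈ l, ∃ a ∈ π, (x : V4 ≃ₗᵢ[ℝ] V4) = refl a) ∧
      l.prod = w ∧ l.length = n}.Nonempty := by
    obtain ⟨l, hl⟩ := exists_prod_τ_eq w
    refine ⟨_, l.map τ, List.forall_mem_map.2 fun i _ => ?_, hl, rfl⟩
    exact ⟨α i, Set.mem_range_self i, rfl⟩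
  obtain ⟨l, hl, hprod, hlength⟩ := Nat.sInf_mem hne
  obtain ⟨k, rfl⟩ := exists_map_τ_eq hl
  rw [sign, length, ← hlength, ← hprod, codeSign_code_prod_τ, List.length_map]

theorem sign_one : sign Φ π (1 : W) = 1 := by
  rw [sign_eq_codeSign, code_one]
  decide

theorem sign_mul (v w : W) : sign Φ π (v * w) = sign Φ π v * sign Φ π w := by
  obtain ⟨k, rfl⟩ := exists_prod_τ_eq v
  obtain ⟨l, rfl⟩ := exists_prod_τ_eq w
  rw [← List.prod_append, ← List.map_append, sign_eq_codeSign, sign_eq_codeSign, sign_eq_codeSign,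
    codeSign_code_prod_τ, codeSign_code_prod_τ, codeSign_code_prod_τ, List.length_append, pow_add]

theorem sign_ne_zero (w : W) : sign Φ π w ≠ 0 := pow_ne_zero _ (by decide)

end Sign

/-! ### Subgroups given by lists of codes -/

section Presents

/-- `h` lists the codes of the elements of `H`. -/
structure Presents (H : Subgroup W) (h : List ℕ) : Prop where
  mem_iff : ∀ w, w ∈ H ↔ code w ∈ h
  subset : h ⊆ weylCodes

/-- The list `codeClosure gens` contains `1` and is stable under left multiplication by the
generators and their inverses. -/
def isClosureStable (gens : List ℕ) : Bool :=
  let h := codeClosure gens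
  let m := bitmask h
  m.testBit codeOne && gens.all fun g => h.all fun x =>
    m.testBit (codeMul g x) && m.testBit (codeMul (codeInv g) x)

theorem presents_closure {T : Set W} {gens : List ℕ} (hT : ∀ g, g ∈ gens ↔ ∃ t ∈ T, code t = g)
    (hstable : isClosureStable gens = true) :
    Presents (Subgroup.closure T) (codeClosure gens) := by
  simp only [isClosureStable, Bool.and_eq_true, List.all_eq_true, testBit_bitmask] at hstable
  obtain ⟨hone, hmul⟩ := hstable
  have hcode : ∀ n ∈ codeClosure gens, ∃ w ∈ Subgroup.closure T, code w = n := by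
    refine forall_mem_codeClosure ⟨1, Subgroup.one_mem _, code_one⟩ ?_
    rintro g hg x ⟨w, hw, rfl⟩
    obtain ⟨t, ht, rfl⟩ := (hT g).1 hg
    exact ⟨t * w, Subgroup.mul_mem _ (Subgroup.subset_closure ht) hw, code_mul t w⟩
  refine ⟨fun w => ⟨fun hw => ?_, fun hw => ?_⟩, fun n hn => ?_⟩
  · induction hw using Subgroup.closure_induction_left with
    | one => rwa [code_one]
    | mul_left t ht y _ ih =>
      rw [code_mul]
      exact (hmul _ ((hT _).2 ⟨t, ht, rfl⟩) _ ih).1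
    | inv_mul_cancel t ht y _ ih =>
      rw [code_mul, code_inv]
      exact (hmul _ ((hT _).2 ⟨t, ht, rfl⟩) _ ih).2
  · obtain ⟨v, hv, hvw⟩ := hcode _ hw
    rwa [← code_injective hvw]
  · obtain ⟨v, -, rfl⟩ := hcode n hn
    exact code_mem_weylCodes v

/-- The set of vectors encoded by a list of pairs. -/
def pairVecs (L : List (ℕ × ℕ)) : Set V4 := {v | ∃ p ∈ L, v = pairVec p}

/-- The codes of the group generated by the reflections in the roots encoded by `L`. -/
def pairGroup (L : List (ℕ × ℕ)) : List ℕ := codeClosure (L.map reflCode)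

theorem presents_WJ {L : List (ℕ × ℕ)} (hL : L ⊆ rootPairs)
    (hstable : isClosureStable (L.map reflCode) = true) :
    Presents (WJ (pairVecs L)) (pairGroup L) := by
  refine presents_closure (fun g => ?_) hstable
  rw [List.mem_map]
  constructor
  · rintro ⟨p, hp, rfl⟩
    exact ⟨pairRefl p (hL hp), ⟨pairVec p, ⟨p, hp, rfl⟩, rfl⟩, code_pairRefl _⟩
  · rintro ⟨w, ⟨_, ⟨p, hp, rfl⟩, hw⟩, rfl⟩
    refine ⟨p, hp, ?_⟩
    rw [← code_pairRefl (hL hp)]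
    exact congrArg code (Subtype.ext hw.symm)

end Presents

/-! ### Conjugacy classes -/

section ConjugacyClasses

/-- Words in the simple reflections for the class representatives. -/
def classWord : Fin 13 → List (Fin 4) := ![
  [], [1], [0, 1], [0, 2, 1], [0, 1, 0, 2, 1, 0], [0, 3, 1], [0, 1, 0, 3, 1, 0], [2, 3, 1],
  [1, 2, 1, 3, 1, 2], [0, 2, 3, 1], [0, 1, 0, 2, 1, 0, 3, 1, 0, 2, 1, 3], [1, 0, 2, 3, 1],
  [1, 0, 3, 1, 0, 2]]

/-- The code of the product of a word in the simple reflections. -/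
def wordCode (l : List (Fin 4)) : ℕ :=
  l.foldr (fun i x => codeMul (reflCode simplePairs[i]) x) codeOne

/-- The code of the `j`-th class representative. -/
def classCode (j : Fin 13) : ℕ := wordCode (classWord j)

theorem code_prod_τ (l : List (Fin 4)) : code (l.map τ).prod = wordCode l := by
  induction l with
  | nil => exact code_one
  | cons i l ih =>
    rw [List.map_cons, List.prod_cons, code_mul, ih, code_τ]
    rfl

theorem code_classRep (j : Fin 13) : code (classRep j) = classCode j := by
  have hword : classRep j = ((classWord j).map τ).prod := by
    fin_cases j <;> simp [classRep, classWord, τ₁, τ₂, τ₃, τ₄, mul_assoc]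
  rw [hword, code_prod_τ, classCode]

/-- The bit mask of the conjugacy class of the `j`-th class representative. -/
def classMask (j : Fin 13) : ℕ :=
  bitmask (weylCodes.map fun y => codeMul (codeMul y (classCode j)) (codeInv y))

theorem isConj_classRep_iff (j : Fin 13) (g : W) :
    IsConj (classRep j) g ↔ (classMask j).testBit (code g) = true := by
  rw [classMask, testBit_bitmask, List.mem_map, isConj_iff]
  constructor
  · rintro ⟨c, rfl⟩
    exact ⟨code c, code_mem_weylCodes c, by rw [code_mul, code_mul, code_inv, code_classRep]⟩
  · rintro ⟨y, hy, hconj⟩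
    obtain ⟨c, rfl⟩ := exists_code_eq hy
    exact ⟨c, code_injective (by rw [code_mul, code_mul, code_inv, code_classRep, hconj])⟩

theorem existsUnique_isConj (g : W) : ∃! j : Fin 13, IsConj (classRep j) g := by
  have hmask : ∀ x ∈ weylCodes, ∃ j : Fin 13, (classMask j).testBit x = true ∧
      ∀ k, (classMask k).testBit x = true → k = j := by
    decide +kernel
  obtain ⟨j, hj, hunique⟩ := hmask _ (code_mem_weylCodes g)
  exact ⟨j, (isConj_classRep_iff j g).2 hj, fun k hk => hunique k ((isConj_classRep_iff k g).1 hk)⟩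

end ConjugacyClasses

/-! ### Coefficients of polytabloids -/

section Coefficients

variable {H H' : Subgroup W} {h h' : List ℕ}

/-- The bit mask of the products `u v` with `u ∈ h'` of sign `s` and `v ∈ h`. -/
def signedProductMask (s : ℤ) (h h' : List ℕ) : ℕ :=
  bitmask ((h'.filter fun u => codeSign u == s).flatMap fun u => h.map (codeMul u))

/-- The coefficient of the tabloid `{x H}` in the polytabloid of `H` and `H'`, if `h` and `h'` list
the codes of `H` and `H'`, whose intersection is trivial. -/
def polytabloidCoeff (h h' : List ℕ) (x : ℕ) : ℤ :=
  bif (signedProductMask 1 h h').testBit x then 1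
  else bif (signedProductMask (-1) h h').testBit x then -1 else 0

theorem testBit_signedProductMask (hH : Presents H h) (hH' : Presents H' h') (s : ℤ) (w : W) :
    (signedProductMask s h h').testBit (code w) = true ↔
      ∃ u ∈ H', sign Φ π u = s ∧ u⁻¹ * w ∈ H := by
  rw [signedProductMask, testBit_bitmask]
  simp only [List.mem_flatMap, List.mem_filter, List.mem_map, beq_iff_eq]
  constructor
  · rintro ⟨a, ⟨ha, hs⟩, b, hb, hab⟩
    obtain ⟨u, rfl⟩ := exists_code_eq (hH'.subset ha)
    obtain ⟨v, rfl⟩ := exists_code_eq (hH.subset hb)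
    rw [← code_mul] at hab
    obtain rfl := code_injective hab
    refine ⟨u, (hH'.mem_iff u).2 ha, by rw [sign_eq_codeSign, hs], ?_⟩
    rwa [inv_mul_cancel_left, hH.mem_iff]
  · rintro ⟨u, hu, hs, hw⟩
    refine ⟨code u, ⟨(hH'.mem_iff u).1 hu, by rw [← sign_eq_codeSign, hs]⟩, _,
      (hH.mem_iff _).1 hw, ?_⟩
    rw [← code_mul, mul_inv_cancel_left]

theorem polytabloidCoeff_eq_sign_or (hH : Presents H h) (hH' : Presents H' h') (w : W) :
    (∃ u ∈ H', u⁻¹ * w ∈ H ∧ polytabloidCoeff h h' (code w) = sign Φ π u) ∨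
      (∀ u ∈ H', u⁻¹ * w ∉ H) ∧ polytabloidCoeff h h' (code w) = 0 := by
  rw [polytabloidCoeff]
  cases hpos : (signedProductMask 1 h h').testBit (code w) with
  | true =>
    obtain ⟨u, hu, hs, hw⟩ := (testBit_signedProductMask hH hH' _ _).1 hpos
    exact .inl ⟨u, hu, hw, hs.symm⟩
  | false =>
    cases hneg : (signedProductMask (-1) h h').testBit (code w) with
    | true =>
      obtain ⟨u, hu, hs, hw⟩ := (testBit_signedProductMask hH hH' _ _).1 hneg
      exact .inl ⟨u, hu, hw, hs.symm⟩
    | false =>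
      refine .inr ⟨fun u hu hw => ?_, rfl⟩
      rcases neg_one_pow_eq_or ℤ (length Φ π u) with hs | hs
      · exact Bool.false_ne_true (hpos ▸ (testBit_signedProductMask hH hH' _ _).2 ⟨u, hu, hs, hw⟩)
      · exact Bool.false_ne_true (hneg ▸ (testBit_signedProductMask hH hH' _ _).2 ⟨u, hu, hs, hw⟩)

theorem exists_mem_of_polytabloidCoeff_ne_zero (hH : Presents H h) (hH' : Presents H' h') {w : W}
    (hw : polytabloidCoeff h h' (code w) ≠ 0) : ∃ u ∈ H', u⁻¹ * w ∈ H := by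
  rcases polytabloidCoeff_eq_sign_or hH hH' w with ⟨u, hu, huw, -⟩ | ⟨-, hzero⟩
  · exact ⟨u, hu, huw⟩
  · exact absurd hzero hw

theorem tabloidCoeff_eq_polytabloidCoeff (hH : Presents H h) (hH' : Presents H' h')
    (hbot : H ⊓ H' = ⊥) (w : W) :
    tabloidCoeff H (signOn (sign Φ π) H') w = polytabloidCoeff h h' (code w) := by
  rcases polytabloidCoeff_eq_sign_or hH hH' w with ⟨u, hu, hw, hcoeff⟩ | ⟨hw, hcoeff⟩
  · rw [tabloidCoeff_signOn_of_mem hbot hu hw, hcoeff]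
  · rw [tabloidCoeff_signOn_of_notMem hw, hcoeff]

theorem polytabloid_coeff {K : Type*} [Field K] (hH : Presents H h) (hH' : Presents H' h')
    (hbot : H ⊓ H' = ⊥) (w : W) :
    (polytabloid K (sign Φ π) H H').coeff (w : W ⧸ H) = (polytabloidCoeff h h' (code w) : K) := by
  rw [polytabloid_eq_signedSum, signedSum_coeff, tabloidCoeff_eq_polytabloidCoeff hH hH' hbot]

/-- The lists `h` and `h'` have no common element apart from the code of `1`. -/
def areDisjoint (h h' : List ℕ) : Bool := h.all fun x => x == codeOne || !(bitmask h').testBit x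

theorem inf_eq_bot_of_areDisjoint (hH : Presents H h) (hH' : Presents H' h')
    (hdisj : areDisjoint h h' = true) : H ⊓ H' = ⊥ := by
  refine eq_bot_iff.2 fun w hw => ?_
  have hone := List.all_eq_true.1 hdisj _ ((hH.mem_iff w).1 hw.1)
  rw [(testBit_bitmask h' _).2 ((hH'.mem_iff w).1 hw.2), Bool.not_true, Bool.or_false,
    beq_iff_eq] at hone
  exact code_injective (hone.trans code_one.symm)

theorem isSignFunction_sign (U : Subgroup W) : IsSignFunction (signOn (sign Φ π) U) :=
  isSignFunction_signOn sign_mul sign_one U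

/-- Every tabloid has a nonzero coefficient or is fixed by an odd element of the group listed by
`h'`. -/
def areCovering (h h' : List ℕ) : Bool :=
  let m := bitmask h
  weylCodes.all fun x => polytabloidCoeff h h' x != 0 ||
    h'.any fun t => codeSign t == -1 && m.testBit (codeMul (codeMul (codeInv x) t) x)

theorem polytabloidCoeff_ne_zero_or (hH : Presents H h) (hH' : Presents H' h')
    (hcov : areCovering h h' = true) (w : W) : polytabloidCoeff h h' (code w) ≠ 0 ∨
      ∃ u, signOn (sign Φ π) H' u = -1 ∧ w⁻¹ * u * w ∈ H := by
  have hw := List.all_eq_true.1 hcov _ (code_mem_weylCodes w)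
  simp only [Bool.or_eq_true, List.any_eq_true, Bool.and_eq_true, bne_iff_ne, beq_iff_eq,
    testBit_bitmask] at hw
  refine hw.imp_right ?_
  rintro ⟨t, ht, hs, hconj⟩
  obtain ⟨u, rfl⟩ := exists_code_eq (hH'.subset ht)
  refine ⟨u, by rw [signOn_of_mem ((hH'.mem_iff u).2 ht), sign_eq_codeSign, hs], ?_⟩
  rwa [hH.mem_iff, code_mul, code_mul, code_inv]

theorem covers_signOn (hH : Presents H h) (hH' : Presents H' h')
    (hcov : areCovering h h' = true) : Covers (signOn (sign Φ π) H') H := by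
  refine fun w => (polytabloidCoeff_ne_zero_or hH hH' hcov w).imp_left fun hne => ?_
  obtain ⟨u, hu, hw⟩ := exists_mem_of_polytabloidCoeff_ne_zero hH hH' hne
  exact ⟨u, by rw [signOn_of_mem hu]; exact sign_ne_zero u, hw⟩

theorem polytabloid_coeff_ne_zero {K : Type*} [Field K] [CharZero K] (hH : Presents H h)
    (hH' : Presents H' h') (hbot : H ⊓ H' = ⊥) (hcov : areCovering h h' = true) {w : W}
    (hw : kappa K (sign Φ π) H H' (tabloid w) ≠ 0) :
    (polytabloid K (sign Φ π) H H').coeff (w : W ⧸ H) ≠ 0 := by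
  rw [polytabloid_coeff hH hH' hbot, Int.cast_ne_zero]
  refine (polytabloidCoeff_ne_zero_or hH hH' hcov w).resolve_right ?_
  rintro ⟨u, hu, hconj⟩
  rw [kappa_eq_signedSum] at hw
  exact hw ((isSignFunction_sign H').signedSum_tabloid_eq_zero hu hconj)

end Coefficients

/-! ### Characters -/

section Characters

variable {K : Type*} [Field K]

/-- If the tabloid coefficients of a generator are given by `E`, then they give rise to the
eigenvalue `n` and to the `i`-th row of the character table. -/
def coeffsAfford (E : ℕ → ℤ) (n : ℤ) (i : Fin 13) : Bool :=
  n != 0 && E codeOne == 1 && (weylCodes.map fun x => E x * E (codeInv x)).sum == n &&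
    (List.finRange 13).all fun j =>
      let c := codeInv (classCode j)
      (weylCodes.map fun x => E (codeMul (codeMul (codeInv x) c) x)).sum == n * charTable i j

/-- `e` is quasi-primitive and generates a module with the `i`-th irreducible character. -/
def GeneratesCharacter {H : Subgroup W} (e : MonoidAlgebra K (W ⧸ H)) (i : Fin 13) : Prop :=
  ∃ n, IsQuasiPrimitive e n ∧ ∀ j,
    (cyclic (tabloidRep K H) e).toRepresentation.character (classRep j) = (charTable i j : K)

theorem generatesCharacter_signedSum [CharZero K] {H : Subgroup W} {β : W → ℤ}
    (hβ : IsSignFunction β) (hcov : Covers β H) {E : ℕ → ℤ}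
    (hE : ∀ w, tabloidCoeff H β w = E (code w)) {n : ℤ} {i : Fin 13}
    (hafford : coeffsAfford E n i = true) :
    GeneratesCharacter (signedSum K H β (tabloid 1)) i := by
  simp only [coeffsAfford, Bool.and_eq_true, bne_iff_ne, beq_iff_eq, List.all_eq_true,
    List.mem_finRange, forall_const] at hafford
  obtain ⟨⟨⟨hn0, hone⟩, hn⟩, hrow⟩ := hafford
  have hsum : ∑ g, tabloidCoeff H β g * tabloidCoeff H β g⁻¹ = n := by
    rw [← hn, ← sum_code fun x => E x * E (codeInv x)]
    exact Finset.sum_congr rfl fun g _ => by rw [hE, hE, code_inv]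
  have hprim : IsQuasiPrimitive (signedSum K H β (tabloid 1)) (n : K) :=
    hβ.isQuasiPrimitive hcov (by rw [hE, code_one, hone]) hsum (Int.cast_ne_zero.2 hn0)
  refine ⟨n, hprim, fun j => mul_left_cancel₀ (Int.cast_ne_zero.2 hn0) ?_⟩
  rw [hprim.mul_character (classRep j), ← Int.cast_mul, ← hrow j,
    ← sum_code fun x => E (codeMul (codeMul (codeInv x) (codeInv (classCode j))) x), Int.cast_sum]
  refine Finset.sum_congr rfl fun x _ => ?_
  rw [signedSum_coeff, hE, code_mul, code_mul, code_inv, code_inv, code_classRep]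

theorem GeneratesCharacter.affords [CharZero K] {H : Subgroup W} {e : MonoidAlgebra K (W ⧸ H)}
    {i : Fin 13} (h : GeneratesCharacter e i) :
    Affords (cyclic (tabloidRep K H) e).toRepresentation (i + 1) :=
  let ⟨_, hprim, hrow⟩ := h
  ⟨hprim.isIrreducible, i, rfl, hrow⟩

theorem GeneratesCharacter.character_eq {H : Subgroup W} {e : MonoidAlgebra K (W ⧸ H)}
    {i j : Fin 13} (h : GeneratesCharacter e i) {g : W} (hg : IsConj (classRep j) g) :
    (cyclic (tabloidRep K H) e).toRepresentation.character g = (charTable i j : K) := by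
  obtain ⟨_, -, hrow⟩ := h
  obtain ⟨c, rfl⟩ := isConj_iff.1 hg
  rw [Representation.char_conj, hrow]

theorem affords_of_equiv {M N : Type*} [AddCommGroup M] [Module K M] [AddCommGroup N] [Module K N]
    {ρ : Representation K W M} {σ : Representation K W N} (φ : ρ.Equiv σ) {n : ℕ}
    (h : Affords σ n) : Affords ρ n := by
  obtain ⟨hirr, i, hi, hrow⟩ := h
  exact ⟨isIrreducible_of_equiv φ hirr, i, hi, fun j => by rw [Representation.char_iso φ, hrow]⟩

theorem sum_charTable_zero_mul (j : Fin 13) :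
    ∑ i, charTable i 0 * charTable i j = if j = 0 then 192 else 0 := by
  revert j
  decide +kernel

/-- By column orthogonality, the characters weighted by their degrees add up to a multiple of the
character of the regular representation, which vanishes on no nonzero module. -/
theorem exists_coeffOp_ne_zero_of_generatesCharacter [CharZero K] {H : Fin 13 → Subgroup W}
    {e : (i : Fin 13) → MonoidAlgebra K (W ⧸ H i)} (he : ∀ i, GeneratesCharacter (e i) i)
    {M : Type*} [AddCommGroup M] [Module K M] [Nontrivial M] (ρ : Representation K W M) :
    ∃ i, coeffOp ρ (e i) ≠ 0 := by
  choose n hprim using fun i => (he i).imp fun _ h => h.1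
  have hsum {j : Fin 13} {g : W} (hj : IsConj (classRep j) g) :
      ∑ i, (charTable i 0 : K) *
        (cyclic (tabloidRep K (H i)) (e i)).toRepresentation.character g =
          ((if j = 0 then 192 else 0 : ℤ) : K) := by
    rw [← sum_charTable_zero_mul, Int.cast_sum]
    exact Finset.sum_congr rfl fun i _ => by rw [(he i).character_eq hj, Int.cast_mul]
  refine exists_coeffOp_ne_zero hprim (fun i => (charTable i 0 : K)) ?_ (fun g hg => ?_) ρ
  · rw [hsum (j := 0) (IsConj.refl 1), if_pos rfl]
    norm_num
  · obtain ⟨j, hj, -⟩ := existsUnique_isConj g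
    have hj0 : j ≠ 0 := by
      rintro rfl
      exact hg (isConj_one_right.1 hj)
    rw [hsum hj, if_neg hj0, Int.cast_zero]

theorem Affords.unique [CharZero K] {M : Type*} [AddCommGroup M] [Module K M]
    {ρ : Representation K W M} {m n : ℕ} (hm : Affords ρ m) (hn : Affords ρ n) : m = n := by
  obtain ⟨-, i, rfl, hi⟩ := hm
  obtain ⟨-, k, rfl, hk⟩ := hn
  have charTable_injective : Function.Injective fun i => List.ofFn (charTable i) := by
    decide +kernel
  have hrow : charTable i = charTable k :=
    funext fun j => by exact_mod_cast (hi j).symm.trans (hk j)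
  rw [charTable_injective (congrArg List.ofFn hrow)]

end Characters

/-! ### Simple systems in the `D₄` lattice -/

section Obtuse

variable {E : Type*} [NormedAddCommGroup E] [InnerProductSpace ℝ E]

theorem smul_mem_span_nnreal {S : Set E} {v : E} {c : ℝ} (hc : 0 ≤ c)
    (hv : v ∈ Submodule.span ℝ≥0 S) : c • v ∈ Submodule.span ℝ≥0 S :=
  Submodule.smul_mem _ (⟨c, hc⟩ : ℝ≥0) hv

theorem linearIndependent_of_inner_nonpos {J : Set E}
    (hJ : ∀ a ∈ J, ∀ b ∈ J, a ≠ b → ⟪a, b⟫ ≤ 0) (f : Module.Dual ℝ E) (hf : ∀ a ∈ J, 0 < f a) :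
    LinearIndependent ℝ (Subtype.val : J → E) :=
  LinearMap.BilinForm.linearIndependent_of_pairwise_le_zero (innerₗ E)
    (fun _ hx => real_inner_self_pos.2 hx) f _ (fun a => hf _ a.2)
    fun a b hab => hJ _ a.2 _ b.2 fun h => hab (Subtype.ext h)

theorem inner_sum_smul_sum_smul_nonpos {ι : Type*} (s : Finset ι) {x : ι → E}
    (hx : Pairwise fun i j => ⟪x i, x j⟫ ≤ 0) {a b : ι → ℝ} (ha : ∀ i, 0 ≤ a i)
    (hb : ∀ i, 0 ≤ b i) (hab : ∀ i, a i * b i = 0) :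
    ⟪∑ i ∈ s, a i • x i, ∑ i ∈ s, b i • x i⟫ ≤ 0 := by
  simp only [sum_inner, inner_sum, real_inner_smul_left, real_inner_smul_right]
  refine Finset.sum_nonpos fun i _ => Finset.sum_nonpos fun j _ => ?_
  rw [mul_left_comm, ← mul_assoc]
  rcases eq_or_ne j i with rfl | hji
  · rw [hab, zero_mul]
  · exact mul_nonpos_of_nonneg_of_nonpos (mul_nonneg (ha j) (hb i)) (hx hji)

end Obtuse

section Lattice

/-- The `D₄` lattice of integral vectors with even coordinate sum. -/
def lattice : Submodule ℤ V4 where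
  carrier := {v | ∃ n : Fin 4 → ℤ, (∀ i, v i = n i) ∧ Even (n 0 + n 1 + n 2 + n 3)}
  zero_mem' := ⟨0, by simp, by simp⟩
  add_mem' := by
    rintro u v ⟨m, hm, hmeven⟩ ⟨n, hn, hneven⟩
    refine ⟨m + n, fun i => by simp [hm, hn], ?_⟩
    have hsum : (m + n) 0 + (m + n) 1 + (m + n) 2 + (m + n) 3 =
        (m 0 + m 1 + m 2 + m 3) + (n 0 + n 1 + n 2 + n 3) := by
      simp only [Pi.add_apply]
      ring
    exact hsum ▸ hmeven.add hneven
  smul_mem' := by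
    rintro c u ⟨m, hm, hmeven⟩
    refine ⟨c • m, fun i => by simp [hm], ?_⟩
    have hsum : (c • m) 0 + (c • m) 1 + (c • m) 2 + (c • m) 3 = c * (m 0 + m 1 + m 2 + m 3) := by
      simp only [Pi.smul_apply, smul_eq_mul]
      ring
    exact hsum ▸ hmeven.mul_left c

theorem two_le_inner_self_of_mem_lattice {u : V4} (hu : u ∈ lattice) (hne : u ≠ 0) :
    2 ≤ ⟪u, u⟫ := by
  obtain ⟨m, hm, hmeven⟩ := hu
  have hpos : 0 < ⟪u, u⟫ := real_inner_self_pos.2 hne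
  rw [inner_eq_dot hm hm] at hpos ⊢
  have hsq (a : ℤ) : a * a % 2 = a % 2 := by
    rcases Int.emod_two_eq_zero_or_one a with h | h <;> simp [Int.mul_emod, h]
  have heven : Even (dot m m) := by
    rw [Int.even_iff, dot] at *
    have hsq₀ := hsq (m 0)
    have hsq₁ := hsq (m 1)
    have hsq₂ := hsq (m 2)
    have hsq₃ := hsq (m 3)
    omega
  obtain ⟨k, hk⟩ := heven
  have hpos : 0 < dot m m := by exact_mod_cast hpos
  have htwo : (2 : ℤ) ≤ dot m m := by omega
  exact_mod_cast htwo

theorem eq_zero_or_eq_zero_of_inner_nonpos {p q : V4} (hp : p ∈ lattice) (hq : q ∈ lattice)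
    (hpq : ⟪p, q⟫ ≤ 0) (hsub : ⟪p - q, p - q⟫ = 2) : p = 0 ∨ q = 0 := by
  by_contra! hne
  have hp2 := two_le_inner_self_of_mem_lattice hp hne.1
  have hq2 := two_le_inner_self_of_mem_lattice hq hne.2
  rw [inner_sub_sub_self, real_inner_comm] at hsub
  linarith [real_inner_comm p q]

theorem Φ_subset_lattice : Φ ⊆ lattice := by
  intro v hv
  obtain ⟨p, hp, rfl⟩ := mem_Φ_iff.1 hv
  have heven : ∀ p ∈ rootPairs,
      Even (pairCoord p 0 + pairCoord p 1 + pairCoord p 2 + pairCoord p 3) := by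
    decide
  exact ⟨pairCoord p, pairVec_apply p, heven p hp⟩

theorem inner_self_of_mem_Φ {v : V4} (hv : v ∈ Φ) : ⟪v, v⟫ = 2 := by
  obtain ⟨p, hp, rfl⟩ := mem_Φ_iff.1 hv
  rw [real_inner_self_eq_norm_sq, normSq_pairVec hp]

theorem refl_apply_of_mem_Φ {v : V4} (hv : v ∈ Φ) (u : V4) : refl v u = u - ⟪v, u⟫ • v := by
  rw [refl_apply, ← real_inner_self_eq_norm_sq, inner_self_of_mem_Φ hv,
    mul_div_cancel_left₀ _ two_ne_zero]

/-- The action of a code on pairs of codes of vectors `± ε i`. -/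
def actPair (n : ℕ) (p : ℕ × ℕ) : ℕ × ℕ := (codeAct n p.1, codeAct n p.2)

theorem actPair_lt (n : ℕ) (p : ℕ × ℕ) : (actPair n p).1 < 8 ∧ (actPair n p).2 < 8 :=
  ⟨codeAct_lt _ _, codeAct_lt _ _⟩

theorem apply_pairVec (w : W) {p : ℕ × ℕ} (hp : p.1 < 8 ∧ p.2 < 8) :
    (w : V4 ≃ₗᵢ[ℝ] V4) (pairVec p) = pairVec (actPair (code w) p) := by
  rw [pairVec, map_add, hasCode_code w _ hp.1, hasCode_code w _ hp.2, pairVec, actPair]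

theorem apply_mem_Φ (w : W) {v : V4} (hv : v ∈ Φ) : (w : V4 ≃ₗᵢ[ℝ] V4) v ∈ Φ := by
  obtain ⟨p, hp, rfl⟩ := mem_Φ_iff.1 hv
  have hnorm := inner_self_of_mem_Φ hv
  rw [← (w : V4 ≃ₗᵢ[ℝ] V4).inner_map_map, apply_pairVec w (lt_eight_of_mem_rootPairs p hp),
    inner_pairVec] at hnorm
  rw [apply_pairVec w (lt_eight_of_mem_rootPairs p hp)]
  have mem_rootPairs_or_swap_mem : ∀ a < 8, ∀ b < 8, dot (pairCoord (a, b)) (pairCoord (a, b)) ≠ 2 ∨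
      (a, b) ∈ rootPairs ∨ (b, a) ∈ rootPairs := by
    decide +kernel
  obtain ⟨ha, hb⟩ := actPair_lt (code w) p
  rcases (mem_rootPairs_or_swap_mem _ ha _ hb).resolve_left (not_not.2 (by exact_mod_cast hnorm))
    with hroot | hroot
  · exact mem_Φ_iff.2 ⟨_, hroot, rfl⟩
  · exact mem_Φ_iff.2 ⟨_, hroot, add_comm _ _⟩

variable {J : Set V4}

theorem rootsOf_subset (hJ : J ⊆ Φ) : rootsOf Φ J ⊆ Φ := by
  rintro _ ⟨w, -, j, hj, rfl⟩
  exact apply_mem_Φ w (hJ hj)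

theorem subset_rootsOf : J ⊆ rootsOf Φ J := fun j hj => ⟨1, Subgroup.one_mem _, j, hj, rfl⟩

theorem exists_mem_WJ_eq_refl (hJ : J ⊆ Φ) {r : V4} (hr : r ∈ rootsOf Φ J) :
    ∃ g ∈ WJ J, (g : V4 ≃ₗᵢ[ℝ] V4) = refl r := by
  obtain ⟨w, hw, j, hj, rfl⟩ := hr
  let g : W := ⟨refl j, Subgroup.subset_closure ⟨j, hJ hj, rfl⟩⟩
  have hg : g ∈ WJ J := Subgroup.subset_closure ⟨j, hj, rfl⟩
  exact ⟨w * g * w⁻¹, mul_mem (mul_mem hw hg) (inv_mem hw), (refl_map _ _).symm⟩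

theorem isSubsystem_rootsOf (hJ : J ⊆ Φ) : IsSubsystem Φ (rootsOf Φ J) := by
  have hrefl : ∀ a ∈ rootsOf Φ J, ∀ b ∈ rootsOf Φ J, refl a b ∈ rootsOf Φ J := by
    rintro a ha _ ⟨w, hw, j, hj, rfl⟩
    obtain ⟨g, hg, hga⟩ := exists_mem_WJ_eq_refl hJ ha
    exact ⟨g * w, Subgroup.mul_mem _ hg hw, j, hj, by rw [← hga]; rfl⟩
  refine ⟨rootsOf_subset hJ, hrefl, fun a ha b hb hab => ?_⟩
  have hinner : ⟪a, b⟫ = -1 := by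
    have hnorm := inner_self_of_mem_Φ hab
    rw [inner_add_add_self, inner_self_of_mem_Φ (rootsOf_subset hJ ha),
      inner_self_of_mem_Φ (rootsOf_subset hJ hb), real_inner_comm] at hnorm
    linarith [real_inner_comm a b]
  have hadd : refl a b = a + b := by
    rw [refl_apply_of_mem_Φ (rootsOf_subset hJ ha), hinner, neg_one_smul, sub_neg_eq_add,
      add_comm]
  exact hadd ▸ hrefl a ha b hb

theorem refl_mem_span_int (hJ : J ⊆ Φ) {a : V4} (ha : a ∈ J) {v : V4}
    (hv : v ∈ Submodule.span ℤ J) : refl a v ∈ Submodule.span ℤ J := by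
  have hspan : Submodule.span ℤ J ≤ lattice := Submodule.span_le.2 (hJ.trans Φ_subset_lattice)
  obtain ⟨m, hm, -⟩ := hspan hv
  obtain ⟨n, hn, -⟩ := Φ_subset_lattice (hJ ha)
  rw [refl_apply_of_mem_Φ (hJ ha), inner_eq_dot hn hm, Int.cast_smul_eq_zsmul]
  exact Submodule.sub_mem _ hv (Submodule.smul_mem _ _ (Submodule.subset_span ha))

theorem rootsOf_subset_span_int (hJ : J ⊆ Φ) : rootsOf Φ J ⊆ Submodule.span ℤ J := by
  rintro _ ⟨w, hw, j, hj, rfl⟩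
  induction hw using Subgroup.closure_induction_left with
  | one => exact Submodule.subset_span hj
  | mul_left g hg w _ ih =>
    obtain ⟨a, ha, hga⟩ := hg
    rw [Subgroup.coe_mul, hga]
    exact refl_mem_span_int hJ ha ih
  | inv_mul_cancel g hg w _ ih =>
    obtain ⟨a, ha, hga⟩ := hg
    rw [Subgroup.coe_mul, Subgroup.coe_inv, hga, refl_inv]
    exact refl_mem_span_int hJ ha ih

/-- The positive and the negative part of an integral combination of `J` have a nonpositive inner
product, and nonzero lattice vectors have norm at least `2`, so one of the parts vanishes. -/
theorem mem_span_nnreal_or_neg_mem (hJ : J ⊆ Φ)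
    (hobtuse : ∀ a ∈ J, ∀ b ∈ J, a ≠ b → ⟪a, b⟫ ≤ 0) {v : V4} (hv : v ∈ Submodule.span ℤ J)
    (hnorm : ⟪v, v⟫ = 2) : v ∈ Submodule.span ℝ≥0 J ∨ -v ∈ Submodule.span ℝ≥0 J := by
  rw [← Subtype.range_coe (s := J), Finsupp.mem_span_range_iff_exists_finsupp] at hv
  obtain ⟨c, rfl⟩ := hv
  let comb (d : J → ℤ) : V4 := ∑ j ∈ c.support, (d j : ℝ) • (j : V4)
  have comb_mem_lattice (d : J → ℤ) : comb d ∈ lattice := Submodule.sum_mem _ fun j _ => by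
    rw [Int.cast_smul_eq_zsmul]
    exact Submodule.smul_mem _ _ (Φ_subset_lattice (hJ j.2))
  have comb_mem_span {d : J → ℤ} (hd : 0 ≤ d) : comb d ∈ Submodule.span ℝ≥0 J :=
    Submodule.sum_mem _ fun j _ =>
      smul_mem_span_nnreal (Int.cast_nonneg (hd j)) (Submodule.subset_span j.2)
  have hsub : (c.sum fun j a => a • (j : V4)) = comb c⁺ - comb c⁻ := by
    rw [← Finset.sum_sub_distrib]
    refine Finset.sum_congr rfl fun j _ => ?_
    rw [← sub_smul, ← Int.cast_sub, ← Pi.sub_apply, posPart_sub_negPart, Int.cast_smul_eq_zsmul]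
  have hinner : ⟪comb c⁺, comb c⁻⟫ ≤ 0 :=
    inner_sum_smul_sum_smul_nonpos _
      (fun i j hij => hobtuse _ i.2 _ j.2 fun h => hij (Subtype.ext h))
      (fun j => Int.cast_nonneg (posPart_nonneg (c : J → ℤ) j))
      (fun j => Int.cast_nonneg (negPart_nonneg (c : J → ℤ) j)) fun j => by
        rw [Pi.posPart_apply, Pi.negPart_apply]
        rcases le_total (c j) 0 with h | h <;> simp [h]
  rw [hsub] at hnorm ⊢
  rcases eq_zero_or_eq_zero_of_inner_nonpos (comb_mem_lattice _) (comb_mem_lattice _) hinner hnorm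
    with hzero | hzero
  · exact .inr (by rw [hzero, zero_sub, neg_neg]; exact comb_mem_span (negPart_nonneg _))
  · exact .inl (by rw [hzero, sub_zero]; exact comb_mem_span (posPart_nonneg _))

theorem isSimpleSystem_rootsOf (hJ : J ⊆ Φ) (hobtuse : ∀ a ∈ J, ∀ b ∈ J, a ≠ b → ⟪a, b⟫ ≤ 0)
    (f : Module.Dual ℝ V4) (hf : ∀ a ∈ J, 0 < f a) : IsSimpleSystem (rootsOf Φ J) J :=
  ⟨subset_rootsOf, linearIndependent_of_inner_nonpos hobtuse f hf, fun _ hv =>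
    mem_span_nnreal_or_neg_mem hJ hobtuse (rootsOf_subset_span_int hJ hv)
      (inner_self_of_mem_Φ (rootsOf_subset hJ hv))⟩

theorem rootsOf_subset_diff {J' : Set V4} (hJ : J ⊆ Φ) (hJ' : J' ⊆ Φ)
    (hbot : WJ J ⊓ WJ J' = ⊥) : rootsOf Φ J' ⊆ Φ \ rootsOf Φ J := by
  refine fun r hrJ' => ⟨rootsOf_subset hJ' hrJ', fun hrJ => ?_⟩
  obtain ⟨g, hg, hgr⟩ := exists_mem_WJ_eq_refl hJ hrJ
  obtain ⟨g', hg', hgr'⟩ := exists_mem_WJ_eq_refl hJ' hrJ'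
  have hgg' : g = g' := Subtype.ext (hgr.trans hgr'.symm)
  have hone : g = 1 := (Subgroup.mem_bot).1 (hbot ▸ ⟨hg, hgg' ▸ hg'⟩)
  have hrefl : refl r r = r := by rw [← hgr, hone]; rfl
  have hnorm := inner_self_of_mem_Φ (rootsOf_subset hJ hrJ)
  have hneg : ⟪-r, r⟫ = 2 := by rw [← refl_self, hrefl, hnorm]
  rw [inner_neg_left, hnorm] at hneg
  norm_num at hneg

theorem WJ_orth_rootsOf_eq_bot (h : ∀ r ∈ Φ, ∃ j ∈ J, ⟪r, j⟫ ≠ 0) :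
    WJ (orth Φ (rootsOf Φ J)) = ⊥ := by
  have hempty : orth Φ (rootsOf Φ J) = ∅ := Set.eq_empty_of_forall_notMem fun r ⟨hr, horth⟩ =>
    let ⟨j, hj, hne⟩ := h r hr
    hne (horth j (subset_rootsOf hj))
  rw [hempty]
  simp [reflSubgroup]

end Lattice

section SimpleCoordinates

/-- The coefficients of the vector with coordinates `c` at the simple roots, multiplied by `2`. -/
def twiceSimpleCoord (c : Fin 4 → ℤ) : List ℤ :=
  [2 * c 0, 2 * (c 0 + c 1), c 0 + c 1 + c 2 - c 3, c 0 + c 1 + c 2 + c 3]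

/-- The vector with coordinates `c` is a nonnegative combination of the simple roots. -/
def isNonneg (c : Fin 4 → ℤ) : Bool := (twiceSimpleCoord c).all fun a => decide (0 ≤ a)

theorem rt_apply (a b c d : ℝ) :
    rt a b c d = WithLp.toLp 2 ![a, b - a, c + d - b, d - c] := by
  ext i
  fin_cases i <;> simp [rt, α, ε] <;> ring

theorem eq_rt (v : V4) :
    v = rt (v 0) (v 0 + v 1) ((v 0 + v 1 + v 2 - v 3) / 2) ((v 0 + v 1 + v 2 + v 3) / 2) := by
  rw [rt_apply]
  ext i
  fin_cases i <;> simp <;> ring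

theorem span_π : Submodule.span ℝ π = ⊤ := by
  have hα (i) : α i ∈ Submodule.span ℝ π := Submodule.subset_span ⟨i, rfl⟩
  refine Submodule.eq_top_iff'.2 fun v => ?_
  rw [eq_rt v, rt]
  exact add_mem (add_mem (add_mem (Submodule.smul_mem _ _ (hα 0)) (Submodule.smul_mem _ _ (hα 1)))
    (Submodule.smul_mem _ _ (hα 2))) (Submodule.smul_mem _ _ (hα 3))

theorem mem_span_nnreal_π {v : V4} {c : Fin 4 → ℤ} (hv : ∀ i, v i = c i)
    (hc : isNonneg c = true) : v ∈ Submodule.span ℝ≥0 π := by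
  have hα (i) : α i ∈ Submodule.span ℝ≥0 π := Submodule.subset_span ⟨i, rfl⟩
  simp only [isNonneg, twiceSimpleCoord, List.all_cons, List.all_nil, Bool.and_true,
    Bool.and_eq_true, decide_eq_true_eq] at hc
  obtain ⟨hc0, hc1, hc2, hc3⟩ := hc
  rify at hc0 hc1 hc2 hc3
  rw [eq_rt v, rt]
  simp only [hv]
  refine add_mem (add_mem (add_mem (smul_mem_span_nnreal ?_ (hα 0))
    (smul_mem_span_nnreal ?_ (hα 1))) (smul_mem_span_nnreal ?_ (hα 2)))
    (smul_mem_span_nnreal ?_ (hα 3)) <;> linarith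

/-- The height function, which takes the value `1` on the simple roots. -/
def height : Module.Dual ℝ V4 := innerₗ V4 (WithLp.toLp 2 ![3, 2, 1, 0])

theorem height_apply (v : V4) : height v = 3 * v 0 + 2 * v 1 + v 2 := by
  simp [height, PiLp.inner_apply, Fin.sum_univ_four]
  ring

end SimpleCoordinates

section Systems

theorem pairVec_eq_of_pairCoord_eq {p q : ℕ × ℕ} (h : pairCoord p = pairCoord q) :
    pairVec p = pairVec q := by
  ext i
  rw [pairVec_apply, pairVec_apply, h]

theorem pairCoord_eq_of_pairVec_eq {p q : ℕ × ℕ} (h : pairVec p = pairVec q) :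
    pairCoord p = pairCoord q := by
  ext i
  have hi := congrArg (fun v : V4 => v i) h
  simpa only [pairVec_apply, Int.cast_inj] using hi

/-- `L` lists positive roots with pairwise nonpositive inner products, hence a simple system, and
the bounded search for the elements of its reflection group is exhaustive. -/
structure IsSimpleList (L : List (ℕ × ℕ)) : Prop where
  stable : isClosureStable (L.map reflCode) = true
  subset : L ⊆ rootPairs
  nonneg : ∀ p ∈ L, isNonneg (pairCoord p) = true
  dot_nonpos : ∀ p ∈ L, ∀ q ∈ L, p ≠ q → dot (pairCoord p) (pairCoord q) ≤ 0

instance (L : List (ℕ × ℕ)) : Decidable (IsSimpleList L) :=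
  decidable_of_iff
    (isClosureStable (L.map reflCode) = true ∧ L ⊆ rootPairs ∧
      (∀ p ∈ L, isNonneg (pairCoord p) = true) ∧
      ∀ p ∈ L, ∀ q ∈ L, p ≠ q → dot (pairCoord p) (pairCoord q) ≤ 0)
    ⟨fun ⟨hs, hL, hn, hd⟩ => ⟨hs, hL, hn, hd⟩, fun ⟨hs, hL, hn, hd⟩ => ⟨hs, hL, hn, hd⟩⟩

theorem pairVecs_subset_Φ {L : List (ℕ × ℕ)} (hL : L ⊆ rootPairs) : pairVecs L ⊆ Φ := by
  rintro _ ⟨p, hp, rfl⟩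
  exact mem_Φ_iff.2 ⟨p, hL hp, rfl⟩

theorem height_pairVec_pos {p : ℕ × ℕ} (hp : p ∈ rootPairs) (hpos : isNonneg (pairCoord p) = true) :
    0 < height (pairVec p) := by
  have hheight : ∀ p ∈ rootPairs, isNonneg (pairCoord p) = true →
      0 < 3 * pairCoord p 0 + 2 * pairCoord p 1 + pairCoord p 2 := by
    decide +kernel
  rw [height_apply, pairVec_apply, pairVec_apply, pairVec_apply]
  exact_mod_cast hheight p hp hpos

namespace IsSimpleList

variable {L : List (ℕ × ℕ)}

theorem presents (hL : IsSimpleList L) : Presents (WJ (pairVecs L)) (pairGroup L) :=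
  presents_WJ hL.subset hL.stable

theorem pairVecs_subset_positive (hL : IsSimpleList L) : pairVecs L ⊆ positive Φ π := by
  rintro _ ⟨p, hp, rfl⟩
  exact ⟨pairVecs_subset_Φ hL.subset ⟨p, hp, rfl⟩,
    mem_span_nnreal_π (pairVec_apply p) (hL.nonneg p hp)⟩

theorem isSimpleSystem (hL : IsSimpleList L) :
    IsSimpleSystem (rootsOf Φ (pairVecs L)) (pairVecs L) := by
  refine isSimpleSystem_rootsOf (pairVecs_subset_Φ hL.subset) ?_ height ?_
  · rintro _ ⟨p, hp, rfl⟩ _ ⟨q, hq, rfl⟩ hne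
    rw [inner_pairVec]
    exact_mod_cast hL.dot_nonpos p hp q hq fun h => hne (congrArg pairVec h)
  · rintro _ ⟨p, hp, rfl⟩
    exact height_pairVec_pos (hL.subset hp) (hL.nonneg p hp)

end IsSimpleList

/-- No root is orthogonal to all the roots in `L`. -/
abbrev HasTrivialOrth (L : List (ℕ × ℕ)) : Prop :=
  ∀ r ∈ rootPairs, ∃ p ∈ L, dot (pairCoord r) (pairCoord p) ≠ 0

theorem HasTrivialOrth.WJ_orth_eq_bot {L : List (ℕ × ℕ)} (hL : HasTrivialOrth L) :
    WJ (orth Φ (rootsOf Φ (pairVecs L))) = ⊥ := by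
  refine WJ_orth_rootsOf_eq_bot fun r hr => ?_
  obtain ⟨q, hq, rfl⟩ := mem_Φ_iff.1 hr
  obtain ⟨p, hp, hne⟩ := hL q hq
  refine ⟨pairVec p, ⟨p, hp, rfl⟩, ?_⟩
  rw [inner_pairVec]
  exact_mod_cast hne

theorem isUsefulSystem_pairVecs {L L' : List (ℕ × ℕ)} (hL : IsSimpleList L)
    (hL' : IsSimpleList L') (hdisj : areDisjoint (pairGroup L) (pairGroup L') = true)
    (horth : HasTrivialOrth L ∨ HasTrivialOrth L') :
    IsUsefulSystem Φ π (pairVecs L) (pairVecs L') where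
  subsystem_left := isSubsystem_rootsOf (pairVecs_subset_Φ hL.subset)
  simple_left := hL.isSimpleSystem
  positive_left := hL.pairVecs_subset_positive
  subsystem_right := isSubsystem_rootsOf (pairVecs_subset_Φ hL'.subset)
  simple_right := hL'.isSimpleSystem
  positive_right := hL'.pairVecs_subset_positive
  disjoint := rootsOf_subset_diff (pairVecs_subset_Φ hL.subset) (pairVecs_subset_Φ hL'.subset)
    (inf_eq_bot_of_areDisjoint hL.presents hL'.presents hdisj)
  inf_eq_bot := inf_eq_bot_of_areDisjoint hL.presents hL'.presents hdisj
  orth_inf_eq_bot := by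
    rcases horth with h | h
    · exact eq_bot_mono inf_le_left h.WJ_orth_eq_bot
    · exact eq_bot_mono inf_le_right h.WJ_orth_eq_bot

/-- The roots of the subsystem with simple system `L`. -/
def pairOrbit (L : List (ℕ × ℕ)) : List (ℕ × ℕ) := (pairGroup L).flatMap fun n => L.map (actPair n)

theorem lt_eight_of_mem_pairOrbit {L : List (ℕ × ℕ)} {r : ℕ × ℕ} (hr : r ∈ pairOrbit L) :
    r.1 < 8 ∧ r.2 < 8 := by
  simp only [pairOrbit, List.mem_flatMap, List.mem_map] at hr
  obtain ⟨n, -, p, -, rfl⟩ := hr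
  exact actPair_lt n p

theorem IsSimpleList.pairVec_mem_rootsOf {L : List (ℕ × ℕ)} (hL : IsSimpleList L) {r : ℕ × ℕ}
    (hr : r ∈ pairOrbit L) : pairVec r ∈ rootsOf Φ (pairVecs L) := by
  simp only [pairOrbit, List.mem_flatMap, List.mem_map] at hr
  obtain ⟨n, hn, p, hp, rfl⟩ := hr
  obtain ⟨u, rfl⟩ := exists_code_eq (hL.presents.subset hn)
  rw [← apply_pairVec u (lt_eight_of_mem_rootPairs p (hL.subset hp))]
  exact ⟨u, (hL.presents.mem_iff u).2 hn, pairVec p, ⟨p, hp, rfl⟩, rfl⟩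

/-- Every tabloid whose coefficient in the polytabloid vanishes is given by an element that maps
some root of the first subsystem into the second one. -/
def IsGoodPair (L L' : List (ℕ × ℕ)) : Prop :=
  ∀ x ∈ weylCodes, polytabloidCoeff (pairGroup L) (pairGroup L') x ≠ 0 ∨
    ∃ r ∈ pairOrbit L, ∃ r' ∈ pairOrbit L', pairCoord (actPair x r) = pairCoord r'

instance (L L' : List (ℕ × ℕ)) : Decidable (IsGoodPair L L') :=
  inferInstanceAs (Decidable (∀ x ∈ weylCodes, _ ∨ ∃ r ∈ pairOrbit L, ∃ r' ∈ pairOrbit L', _))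

theorem isGoodSystem_pairVecs {K : Type*} [Field K] [CharZero K] {L L' : List (ℕ × ℕ)}
    (hL : IsSimpleList L) (hL' : IsSimpleList L')
    (huseful : IsUsefulSystem Φ π (pairVecs L) (pairVecs L')) (hgood : IsGoodPair L L') :
    IsGoodSystem K Φ π (pairVecs L) (pairVecs L') := by
  refine ⟨huseful, fun d _ hd => ?_⟩
  rcases hgood _ (code_mem_weylCodes d) with hne | ⟨r, hr, r', hr', hrr'⟩
  · rw [polytabloid_coeff hL.presents hL'.presents huseful.inf_eq_bot]
    exact_mod_cast hne
  · refine absurd hd (Set.nonempty_iff_ne_empty.1 ⟨pairVec r', ⟨pairVec r, ?_, ?_⟩, ?_⟩)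
    · exact hL.pairVec_mem_rootsOf hr
    · rw [apply_pairVec d (lt_eight_of_mem_pairOrbit hr), pairVec_eq_of_pairCoord_eq hrr']
    · exact hL'.pairVec_mem_rootsOf hr'

end Systems

section ExtendedDiagram

/-- The nodes of the extended Dynkin diagram: the negative of the highest root and the simple
roots. -/
def extendedPairs : List (ℕ × ℕ) := (4, 5) :: simplePairs

/-- `L` is the image under some element of the Weyl group of a proper subset of the nodes of the
extended Dynkin diagram. -/
def IsExtendedList (L : List (ℕ × ℕ)) : Prop :=
  ∃ x ∈ weylCodes,
    (∀ p ∈ L, ∃ q ∈ extendedPairs, pairCoord (actPair x q) = pairCoord p) ∧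
      ∃ q ∈ extendedPairs, ∀ p ∈ L, pairCoord (actPair x q) ≠ pairCoord p

instance (L : List (ℕ × ℕ)) : Decidable (IsExtendedList L) :=
  inferInstanceAs (Decidable (∃ x ∈ weylCodes, _ ∧ ∃ q ∈ extendedPairs, ∀ p ∈ L, _))

theorem pairVecs_simplePairs : pairVecs simplePairs = π := by
  ext v
  constructor
  · rintro ⟨p, hp, rfl⟩
    obtain ⟨i, hi, rfl⟩ := List.getElem_of_mem hp
    exact ⟨⟨i, hi⟩, α_eq_pairVec ⟨i, hi⟩⟩
  · rintro ⟨i, rfl⟩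
    exact ⟨_, List.getElem_mem _, α_eq_pairVec i⟩

theorem pairVecs_nil : pairVecs [] = ∅ := by simp [pairVecs]

theorem pairVecs_cons (p : ℕ × ℕ) (L : List (ℕ × ℕ)) :
    pairVecs (p :: L) = insert (pairVec p) (pairVecs L) := by
  ext
  simp [pairVecs]

theorem pairVec_four_five : pairVec (4, 5) = -pairVec (0, 1) := by
  ext i
  rw [PiLp.neg_apply, pairVec_apply, pairVec_apply, ← Int.cast_neg]
  congr 1
  revert i
  decide

theorem pairVecs_extendedPairs : pairVecs extendedPairs = insert (-pairVec (0, 1)) π := by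
  rw [extendedPairs, pairVecs_cons, pairVec_four_five, pairVecs_simplePairs]

theorem exists_apply_eq_highest :
    ∃ w : W, (w : V4 ≃ₗᵢ[ℝ] V4) (pairVec (0, 5)) = pairVec (0, 1) := by
  have hexists : ∃ x ∈ weylCodes, pairCoord (actPair x (0, 5)) = pairCoord (0, 1) := by
    decide +kernel
  obtain ⟨x, hx, hcoord⟩ := hexists
  obtain ⟨w, rfl⟩ := exists_code_eq hx
  exact ⟨w, (apply_pairVec w (by decide)).trans (pairVec_eq_of_pairCoord_eq hcoord)⟩

theorem highest_sub_mem_span {v : V4} (hv : v ∈ Φ) :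
    pairVec (0, 1) - v ∈ Submodule.span ℝ≥0 π := by
  obtain ⟨p, hp, rfl⟩ := mem_Φ_iff.1 hv
  have hnonneg : ∀ p ∈ rootPairs, isNonneg (pairCoord (0, 1) - pairCoord p) = true := by
    decide +kernel
  refine mem_span_nnreal_π (fun i => ?_) (hnonneg p hp)
  rw [PiLp.sub_apply, pairVec_apply, pairVec_apply, Pi.sub_apply, Int.cast_sub]

theorem closure_eq_WJ (J : Set V4) :
    Subgroup.closure {g : W | g ∈ (⊤ : Subgroup W) ∧ ∃ a ∈ J, ∀ v ∈ Submodule.span ℝ π,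
      (g : V4 ≃ₗᵢ[ℝ] V4) v = refl a v} = WJ J := by
  simp only [WJ, reflSubgroup, Subgroup.mem_top, true_and, span_π, Submodule.mem_top,
    forall_const, LinearIsometryEquiv.ext_iff]

theorem isExtendedSubsystem_of_ssubset {J : Set V4} (hJ : J ⊂ pairVecs extendedPairs) :
    IsExtendedSubsystem Φ π ⊤ J (WJ J) := by
  obtain ⟨w, hw⟩ := exists_apply_eq_highest
  rw [pairVecs_extendedPairs] at hJ
  rw [← closure_eq_WJ]
  refine IsExtendedSubsystem.base.delete π subset_rfl (by simp) (pairVec (0, 1))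
    ⟨w, Subgroup.mem_top _, pairVec (0, 5), ?_, hw.symm⟩ ?_ ?_ J hJ.1 hJ.2
  · rw [← pairVecs_simplePairs]
    exact ⟨_, by decide, rfl⟩
  · rw [span_π]
    exact Submodule.mem_top
  · rintro g - j ⟨i, rfl⟩ -
    exact highest_sub_mem_span (apply_mem_Φ g (α_mem i))

theorem map_conj_WJ (w : W) (J : Set V4) :
    (WJ J).map (MulAut.conj w).toMonoidHom = WJ ((w : V4 ≃ₗᵢ[ℝ] V4) '' J) := by
  rw [WJ, reflSubgroup, MonoidHom.map_closure, WJ, reflSubgroup]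
  congr 1
  ext g
  constructor
  · rintro ⟨u, ⟨a, ha, hu⟩, rfl⟩
    exact ⟨_, ⟨a, ha, rfl⟩, by rw [refl_map, ← hu]; rfl⟩
  · rintro ⟨_, ⟨a, ha, rfl⟩, hg⟩
    refine ⟨w⁻¹ * g * w, ⟨a, ha, ?_⟩, ?_⟩
    · rw [Subgroup.coe_mul, Subgroup.coe_mul, hg, refl_map, Subgroup.coe_inv]
      group
    · change w * (w⁻¹ * g * w) * w⁻¹ = g
      group

theorem IsExtendedList.isExtendedSubsystem {L : List (ℕ × ℕ)} (hL : IsExtendedList L) :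
    IsExtendedSubsystem Φ π ⊤ (pairVecs L) (WJ (pairVecs L)) := by
  obtain ⟨x, hx, hmem, q, hq, hne⟩ := hL
  obtain ⟨w, rfl⟩ := exists_code_eq hx
  have hlt : ∀ q ∈ extendedPairs, q.1 < 8 ∧ q.2 < 8 := by decide
  let J : Set V4 := {v | v ∈ pairVecs extendedPairs ∧ (w : V4 ≃ₗᵢ[ℝ] V4) v ∈ pairVecs L}
  have hJL : (w : V4 ≃ₗᵢ[ℝ] V4) '' J = pairVecs L := by
    refine Set.Subset.antisymm (Set.image_subset_iff.2 fun v hv => hv.2) ?_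
    rintro _ ⟨p, hp, rfl⟩
    obtain ⟨q, hq, hqp⟩ := hmem p hp
    have hw : (w : V4 ≃ₗᵢ[ℝ] V4) (pairVec q) = pairVec p := by
      rw [apply_pairVec w (hlt q hq), pairVec_eq_of_pairCoord_eq hqp]
    exact ⟨pairVec q, ⟨⟨q, hq, rfl⟩, p, hp, hw⟩, hw⟩
  have hJ : J ⊂ pairVecs extendedPairs := by
    refine ⟨fun v hv => hv.1, fun hsub => ?_⟩
    obtain ⟨-, p, hp, hqp⟩ := hsub ⟨q, hq, rfl⟩
    rw [apply_pairVec w (hlt q hq)] at hqp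
    exact hne p hp (pairCoord_eq_of_pairVec_eq hqp)
  have hconj := (isExtendedSubsystem_of_ssubset hJ).conj w (Subgroup.mem_top _)
  rwa [map_conj_WJ, hJL] at hconj

end ExtendedDiagram

/-! ### The eleven pairs of simple systems -/

section Tables

/-- The simple systems `rowJ`, as lists of roots. -/
def rowL : Fin 11 → List (ℕ × ℕ) := ![
  [(0, 5), (1, 6), (2, 7)], [(0, 5), (1, 6), (2, 3)], [(1, 6), (2, 7), (2, 3)],
  [(0, 5), (0, 1), (2, 7), (2, 3)], [(0, 5), (2, 7), (2, 3)], [(0, 5), (1, 6)],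
  [(0, 5), (2, 7)], [(0, 5), (2, 3)], [(2, 7), (2, 3)],
  [(0, 5), (1, 6), (2, 7), (2, 3)], []]

/-- The simple systems `colJ`, as lists of roots. -/
def colL : Fin 11 → List (ℕ × ℕ) := ![
  [(0, 3), (1, 2)], [(0, 7), (1, 2)], [(0, 7), (0, 3)], [(0, 6), (1, 7), (1, 3)],
  [(0, 2), (1, 6)], [(0, 7), (0, 3), (1, 2)], [(2, 3), (0, 6), (1, 7)],
  [(2, 7), (1, 3), (0, 6)], [(0, 5), (1, 3), (1, 7)], [],
  [(0, 5), (1, 6), (2, 7), (2, 3)]]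

/-- The quotients `|W| / χ(1)`, where `χ` is the character of the `r`-th pair. -/
def rowIndex : Fin 11 → ℤ := ![64, 64, 64, 96, 24, 24, 64, 64, 64, 192, 192]

/-- The row of the character table, counted from `0`, which belongs to the `r`-th pair. -/
def rowNumber : Fin 11 → Fin 13 := ![3, 8, 4, 2, 12, 12, 5, 7, 6, 0, 1]

theorem rowNumber_add_one (r : Fin 11) : (rowNumber r : ℕ) + 1 = rowChar r := by
  fin_cases r <;> rfl

theorem rt_eq_pairVec (a b c d : ℤ) {p : ℕ × ℕ}
    (h : ∀ i, pairCoord p i = ![a, b - a, c + d - b, d - c] i) : rt a b c d = pairVec p := by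
  rw [rt_apply]
  ext i
  rw [pairVec_apply, h]
  fin_cases i <;> simp

theorem rt_0001 : rt 0 0 0 1 = pairVec (2, 3) := mod_cast rt_eq_pairVec 0 0 0 1 (by decide)

theorem rt_0010 : rt 0 0 1 0 = pairVec (2, 7) := mod_cast rt_eq_pairVec 0 0 1 0 (by decide)

theorem rt_0100 : rt 0 1 0 0 = pairVec (1, 6) := mod_cast rt_eq_pairVec 0 1 0 0 (by decide)

theorem rt_0101 : rt 0 1 0 1 = pairVec (1, 3) := mod_cast rt_eq_pairVec 0 1 0 1 (by decide)

theorem rt_0110 : rt 0 1 1 0 = pairVec (1, 7) := mod_cast rt_eq_pairVec 0 1 1 0 (by decide)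

theorem rt_0111 : rt 0 1 1 1 = pairVec (1, 2) := mod_cast rt_eq_pairVec 0 1 1 1 (by decide)

theorem rt_1000 : rt 1 0 0 0 = pairVec (0, 5) := mod_cast rt_eq_pairVec 1 0 0 0 (by decide)

theorem rt_1100 : rt 1 1 0 0 = pairVec (0, 6) := mod_cast rt_eq_pairVec 1 1 0 0 (by decide)

theorem rt_1101 : rt 1 1 0 1 = pairVec (0, 3) := mod_cast rt_eq_pairVec 1 1 0 1 (by decide)

theorem rt_1110 : rt 1 1 1 0 = pairVec (0, 7) := mod_cast rt_eq_pairVec 1 1 1 0 (by decide)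

theorem rt_1111 : rt 1 1 1 1 = pairVec (0, 2) := mod_cast rt_eq_pairVec 1 1 1 1 (by decide)

theorem rt_1211 : rt 1 2 1 1 = pairVec (0, 1) := mod_cast rt_eq_pairVec 1 2 1 1 (by decide)

theorem rowJ_eq (r : Fin 11) : rowJ r = pairVecs (rowL r) := by
  fin_cases r <;>
    simp [rowJ, rowL, pairVecs_cons, pairVecs_nil, rt_0001, rt_0010, rt_0100, rt_1000, rt_1211]

theorem colJ_eq (r : Fin 11) : colJ r = pairVecs (colL r) := by
  fin_cases r <;>
    simp [colJ, colL, pairVecs_cons, pairVecs_nil, rt_0001, rt_0010, rt_0100, rt_0101, rt_0110,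
      rt_0111, rt_1000, rt_1100, rt_1101, rt_1110, rt_1111]

theorem isSimpleList_rowL (r : Fin 11) : IsSimpleList (rowL r) := by
  revert r
  decide +kernel

theorem isSimpleList_colL (r : Fin 11) : IsSimpleList (colL r) := by
  revert r
  decide +kernel

theorem isExtendedList_rowL (r : Fin 11) : IsExtendedList (rowL r) := by
  revert r
  decide +kernel

theorem isExtendedList_colL (r : Fin 11) : IsExtendedList (colL r) := by
  revert r
  decide +kernel

theorem areDisjoint_rowL_colL (r : Fin 11) :
    areDisjoint (pairGroup (rowL r)) (pairGroup (colL r)) = true := by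
  revert r
  decide +kernel

theorem hasTrivialOrth_rowL_or_colL (r : Fin 11) :
    HasTrivialOrth (rowL r) ∨ HasTrivialOrth (colL r) := by
  revert r
  decide +kernel

theorem isGoodPair_rowL_colL (r : Fin 11) : IsGoodPair (rowL r) (colL r) := by
  revert r
  decide +kernel

theorem areCovering_rowL_colL (r : Fin 11) :
    areCovering (pairGroup (rowL r)) (pairGroup (colL r)) = true := by
  revert r
  decide +kernel

theorem coeffsAfford_rowL_colL (r : Fin 11) :
    coeffsAfford (polytabloidCoeff (pairGroup (rowL r)) (pairGroup (colL r))) (rowIndex r)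
      (rowNumber r) = true := by
  revert r
  decide +kernel

theorem presents_rowJ (r : Fin 11) : Presents (WJ (rowJ r)) (pairGroup (rowL r)) :=
  rowJ_eq r ▸ (isSimpleList_rowL r).presents

theorem presents_colJ (r : Fin 11) : Presents (WJ (colJ r)) (pairGroup (colL r)) :=
  colJ_eq r ▸ (isSimpleList_colL r).presents

theorem isExtendedSubsystem_rowJ (r : Fin 11) :
    IsExtendedSubsystem Φ π ⊤ (rowJ r) (WJ (rowJ r)) :=
  rowJ_eq r ▸ (isExtendedList_rowL r).isExtendedSubsystem

theorem isExtendedSubsystem_colJ (r : Fin 11) :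
    IsExtendedSubsystem Φ π ⊤ (colJ r) (WJ (colJ r)) :=
  colJ_eq r ▸ (isExtendedList_colL r).isExtendedSubsystem

end Tables

section Pairs

variable (K : Type*) [Field K] [CharZero K]

theorem isGoodSystem_rowJ_colJ (r : Fin 11) : IsGoodSystem K Φ π (rowJ r) (colJ r) := by
  rw [rowJ_eq, colJ_eq]
  have huseful := isUsefulSystem_pairVecs (isSimpleList_rowL r) (isSimpleList_colL r)
    (areDisjoint_rowL_colL r) (hasTrivialOrth_rowL_or_colL r)
  exact isGoodSystem_pairVecs (isSimpleList_rowL r) (isSimpleList_colL r) huseful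
    (isGoodPair_rowL_colL r)

theorem isGoodDual_of_areCovering {H H' : Subgroup W} {h h' : List ℕ} (hH : Presents H h)
    (hH' : Presents H' h') (hsw : IsSWSubgroup Φ π H) (hsw' : IsSWSubgroup Φ π H')
    (hdisj : areDisjoint h h' = true) (hcov : areCovering h h' = true) :
    IsGoodDual K Φ π H H' :=
  have hbot := inf_eq_bot_of_areDisjoint hH hH' hdisj
  ⟨⟨hsw, hsw', hbot⟩, fun _ => polytabloid_coeff_ne_zero hH hH' hbot hcov⟩

theorem isGoodDual_rowJ_colJ (r : Fin 11) : IsGoodDual K Φ π (WJ (rowJ r)) (WJ (colJ r)) :=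
  isGoodDual_of_areCovering K (presents_rowJ r) (presents_colJ r) ⟨_, isExtendedSubsystem_rowJ r⟩
    ⟨_, isExtendedSubsystem_colJ r⟩ (areDisjoint_rowL_colL r) (areCovering_rowL_colL r)

theorem generatesCharacter_polytabloid {H H' : Subgroup W} {h h' : List ℕ} (hH : Presents H h)
    (hH' : Presents H' h') (hdisj : areDisjoint h h' = true) (hcov : areCovering h h' = true)
    {n : ℤ} {i : Fin 13} (hafford : coeffsAfford (polytabloidCoeff h h') n i = true) :
    GeneratesCharacter (polytabloid K (sign Φ π) H H') i := by
  have hbot := inf_eq_bot_of_areDisjoint hH hH' hdisj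
  rw [polytabloid_eq_signedSum]
  exact generatesCharacter_signedSum (isSignFunction_sign H') (covers_signOn hH hH' hcov)
    (tabloidCoeff_eq_polytabloidCoeff hH hH' hbot) hafford

theorem generatesCharacter_rowJ_colJ (r : Fin 11) :
    GeneratesCharacter (polytabloid K (sign Φ π) (WJ (rowJ r)) (WJ (colJ r))) (rowNumber r) :=
  generatesCharacter_polytabloid K (presents_rowJ r) (presents_colJ r) (areDisjoint_rowL_colL r)
    (areCovering_rowL_colL r) (coeffsAfford_rowL_colL r)

theorem affords_rowJ_colJ (r : Fin 11) :
    Affords (S K (WJ (rowJ r)) (WJ (colJ r))).toRepresentation (rowChar r) :=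
  rowNumber_add_one r ▸ (generatesCharacter_rowJ_colJ K r).affords

end Pairs

/-! ### Quotients of Specht modules -/

section NegOne

variable {K : Type*} [Field K] {H H' : Subgroup W} {h h' : List ℕ}

/-- The element `-1` of the Weyl group. -/
def negOne : W := classRep 10

/-- The code of `-1`. -/
def codeNegOne : ℕ := ofOctalDigits 4 5 6 7

theorem code_negOne : code negOne = codeNegOne := by
  rw [negOne, code_classRep]
  decide +kernel

theorem negOne_mem_center : negOne ∈ Submonoid.center W := by
  have hcomm : ∀ x ∈ weylCodes, codeMul x codeNegOne = codeMul codeNegOne x := by decide +kernel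
  refine Submonoid.mem_center_iff.2 fun g => code_injective ?_
  rw [code_mul, code_mul, code_negOne, hcomm _ (code_mem_weylCodes g)]

theorem negOne_mul_self : negOne * negOne = 1 := by
  apply code_injective
  rw [code_mul, code_negOne, code_one]
  decide +kernel

/-- The coefficients of `e - (-1) e`, where `e` is the polytabloid of the groups listed by `h` and
`h'`. -/
def twistCoeff (h h' : List ℕ) (x : ℕ) : ℤ :=
  polytabloidCoeff h h' x - polytabloidCoeff h h' (codeMul codeNegOne x)

/-- The group listed by `h'` does not contain `-1`, and every tabloid has a nonzero coefficient in
the polytabloid or its image under `-1`, or is fixed by `u` or `-u` for some odd, respectively even,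
element `u` of this group. -/
def areTwistCovering (h h' : List ℕ) : Bool :=
  let m := bitmask h
  !(bitmask h').testBit codeNegOne && weylCodes.all fun x =>
    polytabloidCoeff h h' x != 0 || polytabloidCoeff h h' (codeMul codeNegOne x) != 0 ||
    h'.any fun t => (codeSign t == -1 && m.testBit (codeMul (codeMul (codeInv x) t) x)) ||
      (codeSign t == 1 && m.testBit (codeMul (codeMul (codeInv x) (codeMul codeNegOne t)) x))

theorem negOne_notMem (hH' : Presents H' h') (hcov : areTwistCovering h h' = true) :
    negOne ∉ H' := by
  have hneg := (Bool.and_eq_true_iff.1 hcov).1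
  rwa [Bool.not_eq_true', ← Bool.not_eq_true, testBit_bitmask, ← code_negOne,
    ← hH'.mem_iff] at hneg

theorem covers_twist_signOn (hH : Presents H h) (hH' : Presents H' h')
    (hcov : areTwistCovering h h' = true) : Covers (twist negOne (signOn (sign Φ π) H')) H := by
  intro w
  have hneg := negOne_notMem hH' hcov
  have hw := List.all_eq_true.1 (Bool.and_eq_true_iff.1 hcov).2 _ (code_mem_weylCodes w)
  simp only [Bool.or_eq_true, List.any_eq_true, Bool.and_eq_true, bne_iff_ne, beq_iff_eq,
    testBit_bitmask] at hw
  rcases hw with (hne | hne) | ⟨t, ht, hfixed⟩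
  · obtain ⟨u, hu, huw⟩ := exists_mem_of_polytabloidCoeff_ne_zero hH hH' hne
    exact .inl ⟨u, by rw [twist_signOn_of_mem hneg hu]; exact sign_ne_zero u, huw⟩
  · rw [← code_negOne, ← code_mul] at hne
    obtain ⟨u, hu, huw⟩ := exists_mem_of_polytabloidCoeff_ne_zero hH hH' hne
    refine .inl ⟨negOne * u, ?_, ?_⟩
    · rw [twist_signOn_mul_of_mem negOne_mul_self hneg hu]
      exact neg_ne_zero.2 (sign_ne_zero u)
    · rwa [mul_inv_rev, inv_eq_of_mul_eq_one_left negOne_mul_self, mul_assoc]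
  · obtain ⟨u, rfl⟩ := exists_code_eq (hH'.subset ht)
    have hu := (hH'.mem_iff u).2 ht
    simp only [← code_negOne, ← code_inv, ← code_mul, ← hH.mem_iff, ← sign_eq_codeSign] at hfixed
    rcases hfixed with ⟨hs, hconj⟩ | ⟨hs, hconj⟩
    · exact .inr ⟨u, by rw [twist_signOn_of_mem hneg hu, hs], hconj⟩
    · refine .inr ⟨negOne * u, ?_, hconj⟩
      rw [twist_signOn_mul_of_mem negOne_mul_self hneg hu, hs]

theorem generatesCharacter_sub_negOne [CharZero K] (hH : Presents H h) (hH' : Presents H' h')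
    (hdisj : areDisjoint h h' = true) (hcov : areTwistCovering h h' = true) {n : ℤ} {i : Fin 13}
    (hafford : coeffsAfford (twistCoeff h h') n i = true) :
    GeneratesCharacter (polytabloid K (sign Φ π) H H' -
      tabloidRep K H negOne (polytabloid K (sign Φ π) H H')) i := by
  have hbot := inf_eq_bot_of_areDisjoint hH hH' hdisj
  have hsign := isSignFunction_twist_signOn sign_mul sign_one negOne_mem_center negOne_mul_self
    (negOne_notMem hH' hcov)
  rw [polytabloid_eq_signedSum, ← signedSum_twist negOne_mul_self]
  refine generatesCharacter_signedSum hsign (covers_twist_signOn hH hH' hcov) (fun w => ?_) hafford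
  rw [tabloidCoeff_twist, tabloidCoeff_eq_polytabloidCoeff hH hH' hbot,
    tabloidCoeff_eq_polytabloidCoeff hH hH' hbot, code_mul, code_negOne, twistCoeff]

/-- The polytabloid of the groups listed by `h` and `h₂` is the sum of the polytabloid of the groups
listed by `h` and `h₁` and its image under `-1`. -/
def polytabloidSplits (h h₁ h₂ : List ℕ) : Bool :=
  weylCodes.all fun x => polytabloidCoeff h h₂ x ==
    polytabloidCoeff h h₁ x + polytabloidCoeff h h₁ (codeMul codeNegOne x)

theorem polytabloid_eq_add {H₁ H₂ : Subgroup W} {h₁ h₂ : List ℕ} (hH : Presents H h)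
    (hH₁ : Presents H₁ h₁) (hH₂ : Presents H₂ h₂) (hdisj₁ : areDisjoint h h₁ = true)
    (hdisj₂ : areDisjoint h h₂ = true) (hsplit : polytabloidSplits h h₁ h₂ = true) :
    polytabloid K (sign Φ π) H H₂ = polytabloid K (sign Φ π) H H₁ +
      tabloidRep K H negOne (polytabloid K (sign Φ π) H H₁) := by
  refine coeff_ext fun w => ?_
  have hw := beq_iff_eq.1 (List.all_eq_true.1 hsplit _ (code_mem_weylCodes w))
  have hbot₁ := inf_eq_bot_of_areDisjoint hH hH₁ hdisj₁
  have hbot₂ := inf_eq_bot_of_areDisjoint hH hH₂ hdisj₂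
  rw [polytabloid_coeff hH hH₂ hbot₂, hw, MonoidAlgebra.coeff_add, Finsupp.add_apply,
    tabloidRep_coeff, polytabloid_coeff hH hH₁ hbot₁, polytabloid_coeff hH hH₁ hbot₁, code_mul,
    inv_eq_of_mul_eq_one_left negOne_mul_self, code_negOne, Int.cast_add]

end NegOne

section SmallSystems

/-- The simple system `JA1`, as a list of roots. -/
def listA1 : List (ℕ × ℕ) := [(0, 3)]

/-- The simple system `JA2`, as a list of roots. -/
def listA2 : List (ℕ × ℕ) := [(2, 3), (1, 7)]

/-- The simple system `JA1'`, as a list of roots. -/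
def listA1' : List (ℕ × ℕ) := [(0, 5)]

/-- The simple system `JA3'`, as a list of roots. -/
def listA3' : List (ℕ × ℕ) := [(1, 6), (2, 3), (2, 7)]

theorem JA1_eq : JA1 = pairVecs listA1 := by
  simp [JA1, listA1, pairVecs_cons, pairVecs_nil, rt_1101]

theorem JA2_eq : JA2 = pairVecs listA2 := by
  simp [JA2, listA2, pairVecs_cons, pairVecs_nil, rt_0001, rt_0110]

theorem JA1'_eq : JA1' = pairVecs listA1' := by
  simp [JA1', listA1', pairVecs_cons, pairVecs_nil, rt_1000]

theorem JA3'_eq : JA3' = pairVecs listA3' := by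
  simp [JA3', listA3', pairVecs_cons, pairVecs_nil, rt_0100, rt_0001, rt_0010]

theorem presents_JA1 : Presents (WJ JA1) (pairGroup listA1) :=
  JA1_eq ▸ IsSimpleList.presents (by decide +kernel)

theorem presents_JA2 : Presents (WJ JA2) (pairGroup listA2) :=
  JA2_eq ▸ IsSimpleList.presents (by decide +kernel)

theorem presents_JA1' : Presents (WJ JA1') (pairGroup listA1') :=
  JA1'_eq ▸ IsSimpleList.presents (by decide +kernel)

theorem presents_JA3' : Presents (WJ JA3') (pairGroup listA3') :=
  JA3'_eq ▸ IsSimpleList.presents (by decide +kernel)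

theorem isExtendedSubsystem_JA1 : IsExtendedSubsystem Φ π ⊤ JA1 (WJ JA1) :=
  JA1_eq ▸ IsExtendedList.isExtendedSubsystem (by decide +kernel)

theorem isExtendedSubsystem_JA2 : IsExtendedSubsystem Φ π ⊤ JA2 (WJ JA2) :=
  JA2_eq ▸ IsExtendedList.isExtendedSubsystem (by decide +kernel)

theorem isExtendedSubsystem_JA1' : IsExtendedSubsystem Φ π ⊤ JA1' (WJ JA1') :=
  JA1'_eq ▸ IsExtendedList.isExtendedSubsystem (by decide +kernel)

theorem isExtendedSubsystem_JA3' : IsExtendedSubsystem Φ π ⊤ JA3' (WJ JA3') :=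
  JA3'_eq ▸ IsExtendedList.isExtendedSubsystem (by decide +kernel)

/-- The codes of the elements of `W(G₂)`. -/
def groupG2 : List ℕ := codeClosure [wordCode [1], wordCode [0, 2, 3]]

/-- The codes of the elements of `W(B₃)`. -/
def groupB3 : List ℕ :=
  codeClosure [wordCode [1], wordCode [3], codeMul (reflCode (0, 5)) (reflCode (0, 1))]

theorem code_τ₂ : code τ₂ = wordCode [1] := by
  rw [← code_prod_τ]
  simp [τ₂]

theorem code_τ₄ : code τ₄ = wordCode [3] := by
  rw [← code_prod_τ]
  simp [τ₄]

theorem code_τ₁_mul_τ₃_mul_τ₄ : code (τ₁ * τ₃ * τ₄) = wordCode [0, 2, 3] := by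
  rw [← code_prod_τ]
  simp [τ₁, τ₃, τ₄, mul_assoc]

theorem presents_WG2 : Presents WG2 groupG2 := by
  refine presents_closure (fun g => ?_) (by decide +kernel)
  simp only [Set.mem_insert_iff, Set.mem_singleton_iff, exists_eq_or_imp, exists_eq_left, code_τ₂,
    code_τ₁_mul_τ₃_mul_τ₄, List.mem_cons, List.not_mem_nil, or_false, eq_comm]

theorem presents_WB3 : Presents WB3 groupB3 := by
  have hmem : ((0, 5) : ℕ × ℕ) ∈ rootPairs ∧ ((0, 1) : ℕ × ℕ) ∈ rootPairs := by decide
  let r : W := pairRefl _ hmem.1 * pairRefl _ hmem.2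
  have hr (w : W) : (w : V4 ≃ₗᵢ[ℝ] V4) = refl (rt 1 0 0 0) * refl (rt 1 2 1 1) ↔ w = r := by
    rw [rt_1000, rt_1211, Subtype.ext_iff]
    rfl
  have hcode : code r = codeMul (reflCode (0, 5)) (reflCode (0, 1)) := by
    rw [code_mul, code_pairRefl, code_pairRefl]
  refine presents_closure (fun g => ?_) (by decide +kernel)
  simp only [hr, Set.mem_ofPred_eq, exists_eq_or_imp, exists_eq_left, code_τ₂, code_τ₄, hcode,
    List.mem_cons, List.not_mem_nil, or_false, eq_comm]

theorem areDisjoint_G2_A2 : areDisjoint groupG2 (pairGroup listA2) = true := by decide +kernel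

theorem areCovering_G2_A2 : areCovering groupG2 (pairGroup listA2) = true := by decide +kernel

theorem coeffsAfford_G2_A2 :
    coeffsAfford (polytabloidCoeff groupG2 (pairGroup listA2)) 32 11 = true := by
  decide +kernel

theorem areDisjoint_A3_A1 : areDisjoint (pairGroup (rowL 0)) (pairGroup listA1) = true := by
  decide +kernel

theorem areTwistCovering_A3_A1 :
    areTwistCovering (pairGroup (rowL 0)) (pairGroup listA1) = true := by
  decide +kernel

theorem coeffsAfford_A3_A1 :
    coeffsAfford (twistCoeff (pairGroup (rowL 0)) (pairGroup listA1)) 48 10 = true := by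
  decide +kernel

theorem polytabloidSplits_A3 :
    polytabloidSplits (pairGroup (rowL 0)) (pairGroup listA1) (pairGroup (colL 0)) = true := by
  decide +kernel

theorem areDisjoint_A1_A3 : areDisjoint (pairGroup listA1') (pairGroup listA3') = true := by
  decide +kernel

theorem areTwistCovering_A1_A3 :
    areTwistCovering (pairGroup listA1') (pairGroup listA3') = true := by
  decide +kernel

theorem coeffsAfford_A1_A3 :
    coeffsAfford (twistCoeff (pairGroup listA1') (pairGroup listA3')) 48 9 = true := by
  decide +kernel

theorem areDisjoint_A1_B3 : areDisjoint (pairGroup listA1') groupB3 = true := by decide +kernel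

theorem areCovering_A1_B3 : areCovering (pairGroup listA1') groupB3 = true := by decide +kernel

theorem polytabloidSplits_A1 :
    polytabloidSplits (pairGroup listA1') (pairGroup listA3') groupB3 = true := by
  decide +kernel

end SmallSystems

section Modules

theorem isUsefulDual_A3_A1 : IsUsefulDual Φ π (WJ JA3) (WJ JA1) :=
  ⟨⟨_, isExtendedSubsystem_rowJ 0⟩, ⟨_, isExtendedSubsystem_JA1⟩,
    inf_eq_bot_of_areDisjoint (presents_rowJ 0) presents_JA1 areDisjoint_A3_A1⟩

theorem isUsefulDual_A1_A3 : IsUsefulDual Φ π (WJ JA1') (WJ JA3') :=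
  ⟨⟨_, isExtendedSubsystem_JA1'⟩, ⟨_, isExtendedSubsystem_JA3'⟩,
    inf_eq_bot_of_areDisjoint presents_JA1' presents_JA3' areDisjoint_A1_A3⟩

variable (K : Type*) [Field K]

theorem polytabloid_A3_2A1 : polytabloid K (sign Φ π) (WJ JA3) (WJ J2A1) =
    polytabloid K (sign Φ π) (WJ JA3) (WJ JA1) +
      tabloidRep K _ negOne (polytabloid K (sign Φ π) (WJ JA3) (WJ JA1)) :=
  polytabloid_eq_add (presents_rowJ 0) presents_JA1 (presents_colJ 0) areDisjoint_A3_A1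
    (areDisjoint_rowL_colL 0) polytabloidSplits_A3

theorem polytabloid_A1_B3 : polytabloid K (sign Φ π) (WJ JA1') WB3 =
    polytabloid K (sign Φ π) (WJ JA1') (WJ JA3') +
      tabloidRep K _ negOne (polytabloid K (sign Φ π) (WJ JA1') (WJ JA3')) :=
  polytabloid_eq_add presents_JA1' presents_JA3' presents_WB3 areDisjoint_A1_A3 areDisjoint_A1_B3
    polytabloidSplits_A1

theorem S_A3_2A1_le : S K (WJ JA3) (WJ J2A1) ≤ S K (WJ JA3) (WJ JA1) := by
  change cyclic _ (polytabloid K _ _ _) ≤ _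
  rw [polytabloid_A3_2A1]
  exact cyclic_add_apply_le

theorem S_A1_B3_le : S K (WJ JA1') WB3 ≤ S K (WJ JA1') (WJ JA3') := by
  change cyclic _ (polytabloid K _ _ _) ≤ _
  rw [polytabloid_A1_B3]
  exact cyclic_add_apply_le

variable [CharZero K]

theorem isGoodDual_G2_A2 (hsw : IsSWSubgroup Φ π WG2) : IsGoodDual K Φ π WG2 (WJ JA2) :=
  isGoodDual_of_areCovering K presents_WG2 presents_JA2 hsw ⟨_, isExtendedSubsystem_JA2⟩
    areDisjoint_G2_A2 areCovering_G2_A2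

theorem isGoodDual_A1_B3 (hsw : IsSWSubgroup Φ π WB3) : IsGoodDual K Φ π (WJ JA1') WB3 :=
  isGoodDual_of_areCovering K presents_JA1' presents_WB3 ⟨_, isExtendedSubsystem_JA1'⟩ hsw
    areDisjoint_A1_B3 areCovering_A1_B3

theorem generatesCharacter_G2_A2 :
    GeneratesCharacter (polytabloid K (sign Φ π) WG2 (WJ JA2)) 11 :=
  generatesCharacter_polytabloid K presents_WG2 presents_JA2 areDisjoint_G2_A2 areCovering_G2_A2
    coeffsAfford_G2_A2

theorem affords_G2_A2 : Affords (S K WG2 (WJ JA2)).toRepresentation 12 :=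
  (generatesCharacter_G2_A2 K).affords

theorem generatesCharacter_A3_A1 :
    GeneratesCharacter (polytabloid K (sign Φ π) (WJ JA3) (WJ JA1) -
      tabloidRep K _ negOne (polytabloid K (sign Φ π) (WJ JA3) (WJ JA1))) 10 :=
  generatesCharacter_sub_negOne (presents_rowJ 0) presents_JA1 areDisjoint_A3_A1
    areTwistCovering_A3_A1 coeffsAfford_A3_A1

theorem generatesCharacter_A1_A3 :
    GeneratesCharacter (polytabloid K (sign Φ π) (WJ JA1') (WJ JA3') -
      tabloidRep K _ negOne (polytabloid K (sign Φ π) (WJ JA1') (WJ JA3'))) 9 :=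
  generatesCharacter_sub_negOne presents_JA1' presents_JA3' areDisjoint_A1_A3
    areTwistCovering_A1_A3 coeffsAfford_A1_A3

theorem nonempty_subquotient_A3_equiv :
    Nonempty ((subquotient (S K (WJ JA3) (WJ JA1)) (S K (WJ JA3) (WJ J2A1))).Equiv
      (cyclic (tabloidRep K _) (polytabloid K (sign Φ π) (WJ JA3) (WJ JA1) - tabloidRep K _ negOne
        (polytabloid K (sign Φ π) (WJ JA3) (WJ JA1)))).toRepresentation) := by
  change Nonempty ((subquotient _ (cyclic _ (polytabloid K _ _ _))).Equiv _)
  rw [polytabloid_A3_2A1]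
  exact nonempty_subquotient_cyclic_equiv negOne_mem_center negOne_mul_self

theorem nonempty_subquotient_A1_equiv :
    Nonempty ((subquotient (S K (WJ JA1') (WJ JA3')) (S K (WJ JA1') WB3)).Equiv
      (cyclic (tabloidRep K _) (polytabloid K (sign Φ π) (WJ JA1') (WJ JA3') - tabloidRep K _ negOne
        (polytabloid K (sign Φ π) (WJ JA1') (WJ JA3')))).toRepresentation) := by
  change Nonempty ((subquotient _ (cyclic _ (polytabloid K _ _ _))).Equiv _)
  rw [polytabloid_A1_B3]
  exact nonempty_subquotient_cyclic_equiv negOne_mem_center negOne_mul_self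

theorem affords_subquotient_A3 :
    Affords (subquotient (S K (WJ JA3) (WJ JA1)) (S K (WJ JA3) (WJ J2A1))) 11 :=
  let ⟨φ⟩ := nonempty_subquotient_A3_equiv K
  affords_of_equiv φ (generatesCharacter_A3_A1 K).affords

theorem affords_subquotient_A1 :
    Affords (subquotient (S K (WJ JA1') (WJ JA3')) (S K (WJ JA1') WB3)) 10 :=
  let ⟨φ⟩ := nonempty_subquotient_A1_equiv K
  affords_of_equiv φ (generatesCharacter_A1_A3 K).affords

end Modules

section Exhaustion

variable {K : Type*} [Field K] {M : Type*} [AddCommGroup M] [Module K M]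

/-- `ρ` is isomorphic to one of the eleven generalized Specht modules of the pairs `rowJ`, `colJ`,
to the one for `W(G₂)`, or to one of the two quotients. -/
def IsListed (ρ : Representation K W M) : Prop :=
  (∃ r : Fin 11, Nonempty (ρ.Equiv (S K (WJ (rowJ r)) (WJ (colJ r))).toRepresentation)) ∨
    Nonempty (ρ.Equiv (S K WG2 (WJ JA2)).toRepresentation) ∨
    Nonempty (ρ.Equiv (subquotient (S K (WJ JA3) (WJ JA1)) (S K (WJ JA3) (WJ J2A1)))) ∨
    Nonempty (ρ.Equiv (subquotient (S K (WJ JA1') (WJ JA3')) (S K (WJ JA1') WB3)))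

variable [CharZero K] (ρ : Representation K W M)

theorem exists_generatesCharacter_and_isListed (i : Fin 13) :
    ∃ (H : Subgroup W) (e : MonoidAlgebra K (W ⧸ H)), GeneratesCharacter e i ∧
      (Nonempty (ρ.Equiv (cyclic (tabloidRep K H) e).toRepresentation) → IsListed ρ) := by
  have hi : (∃ r, rowNumber r = i) ∨ i = 11 ∨ i = 10 ∨ i = 9 := by
    revert i
    decide
  rcases hi with ⟨r, rfl⟩ | rfl | rfl | rfl
  · exact ⟨_, _, generatesCharacter_rowJ_colJ K r, fun h => .inl ⟨r, h⟩⟩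
  · exact ⟨_, _, generatesCharacter_G2_A2 K, fun h => .inr (.inl h)⟩
  · obtain ⟨ψ⟩ := nonempty_subquotient_A3_equiv K
    exact ⟨_, _, generatesCharacter_A3_A1 K, fun ⟨φ⟩ => .inr (.inr (.inl ⟨φ.trans ψ.symm⟩))⟩
  · obtain ⟨ψ⟩ := nonempty_subquotient_A1_equiv K
    exact ⟨_, _, generatesCharacter_A1_A3 K, fun ⟨φ⟩ => .inr (.inr (.inr ⟨φ.trans ψ.symm⟩))⟩

theorem existsUnique_affords_and_isListed [ρ.IsIrreducible] :
    (∃! n : ℕ, Affords ρ n) ∧ IsListed ρ := by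
  choose H e he hlist using exists_generatesCharacter_and_isListed ρ
  have := nontrivial_of_isIrreducible ρ
  obtain ⟨i, hi⟩ := exists_coeffOp_ne_zero_of_generatesCharacter he ρ
  obtain ⟨n, hprim, -⟩ := he i
  obtain ⟨φ⟩ := hprim.nonempty_equiv ρ hi
  have haffords := affords_of_equiv φ (he i).affords
  exact ⟨⟨_, haffords, fun n hn => hn.unique haffords⟩, hlist i ⟨φ⟩⟩

end Exhaustion

/-! ### The polytabloid of `A₃` and `2A₁` -/

section Basis

/-- Words in the simple reflections for the representatives of the cosets of `W(A₃)`. -/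
def tabloidWord : Fin 8 → List (Fin 4) := ![[], [3], [1, 3], [0, 1, 3], [2, 1, 3], [0, 2, 1, 3],
  [1, 0, 2, 1, 3], [3, 1, 0, 2, 1, 3]]

/-- The representatives of the cosets of `W(A₃)`. -/
def tabloidRepresentative : Fin 8 → W := ![1, τ₄, τ₂ * τ₄, τ₁ * τ₂ * τ₄, τ₃ * τ₂ * τ₄,
  τ₁ * τ₃ * τ₂ * τ₄, τ₂ * τ₁ * τ₃ * τ₂ * τ₄, τ₄ * τ₂ * τ₁ * τ₃ * τ₂ * τ₄]

theorem code_tabloidRepresentative (i : Fin 8) :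
    code (tabloidRepresentative i) = wordCode (tabloidWord i) := by
  have hword : tabloidRepresentative i = ((tabloidWord i).map τ).prod := by
    fin_cases i <;> simp [tabloidRepresentative, tabloidWord, τ₁, τ₂, τ₃, τ₄, mul_assoc]
  rw [hword, code_prod_τ]

/-- The element with code `x` lies in the `i`-th coset of `W(A₃)`. -/
def isInCoset (i : Fin 8) (x : ℕ) : Bool :=
  (bitmask (pairGroup (rowL 0))).testBit (codeMul (codeInv (wordCode (tabloidWord i))) x)

theorem isInCoset_iff (i : Fin 8) (w : W) :
    isInCoset i (code w) = true ↔ (tabloidRepresentative i)⁻¹ * w ∈ WJ JA3 := by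
  rw [isInCoset, testBit_bitmask, ← code_tabloidRepresentative, ← code_inv, ← code_mul]
  exact ((presents_rowJ 0).mem_iff _).symm

theorem exists_isInCoset_and_forall :
    ∀ x ∈ weylCodes, ∃ i, isInCoset i x = true ∧ ∀ j, isInCoset j x = true → j = i := by
  decide +kernel

theorem existsUnique_mk_tabloidRepresentative_eq (w : W) :
    ∃! i, (tabloidRepresentative i : W ⧸ WJ JA3) = w := by
  obtain ⟨i, hi, huniq⟩ := exists_isInCoset_and_forall _ (code_mem_weylCodes w)
  exact ⟨i, QuotientGroup.eq.2 ((isInCoset_iff i w).1 hi),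
    fun j hj => huniq j ((isInCoset_iff j w).2 (QuotientGroup.eq.1 hj))⟩

theorem bijective_mk_tabloidRepresentative :
    Function.Bijective fun i => (tabloidRepresentative i : W ⧸ WJ JA3) :=
  (Function.bijective_iff_existsUnique _).2 fun q => by
    induction q using QuotientGroup.induction_on with
    | H w => exact existsUnique_mk_tabloidRepresentative_eq w

variable (K : Type*) [Field K]

/-- The `i`-th tabloid of `W(A₃)`. -/
def tabloidA3 (i : Fin 8) : MonoidAlgebra K (W ⧸ WJ JA3) := tabloid (tabloidRepresentative i)

/-- The polytabloid of the pair `A₃`, `2A₁`. -/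
abbrev polytabloidA3 : MonoidAlgebra K (W ⧸ WJ JA3) := polytabloid K (sign Φ π) (WJ JA3) (WJ J2A1)

theorem tabloidA3_coeff (i : Fin 8) (g : W) :
    (tabloidA3 K i).coeff (g : W ⧸ WJ JA3) = if isInCoset i (code g) = true then 1 else 0 := by
  classical
  rw [tabloidA3, tabloid_coeff]
  exact if_congr (isInCoset_iff i g).symm rfl rfl

theorem tabloidA3_coeff_tabloidRepresentative (i j : Fin 8) :
    (tabloidA3 K i).coeff (tabloidRepresentative j : W ⧸ WJ JA3) = if i = j then 1 else 0 := by
  classical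
  rw [tabloidA3, tabloid_coeff]
  exact if_congr (QuotientGroup.eq.symm.trans bijective_mk_tabloidRepresentative.1.eq_iff) rfl rfl

/-- The image of the polytabloid of `A₃`, `2A₁` under the element with code `c` is
`t_i - t_3 - t_4 + t_j`. -/
def HasExpansion (c : ℕ) (i j : Fin 8) : Prop :=
  ∀ x ∈ weylCodes,
    polytabloidCoeff (pairGroup (rowL 0)) (pairGroup (colL 0)) (codeMul (codeInv c) x) =
      (if isInCoset i x = true then 1 else 0) - (if isInCoset 3 x = true then 1 else 0) -
        (if isInCoset 4 x = true then 1 else 0) + if isInCoset j x = true then 1 else 0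

instance (c : ℕ) (i j : Fin 8) : Decidable (HasExpansion c i j) :=
  inferInstanceAs (Decidable (∀ x ∈ weylCodes, _))

theorem polytabloidA3_coeff (w : W) : (polytabloidA3 K).coeff (w : W ⧸ WJ JA3) =
    (polytabloidCoeff (pairGroup (rowL 0)) (pairGroup (colL 0)) (code w) : K) :=
  polytabloid_coeff (presents_rowJ 0) (presents_colJ 0)
    (inf_eq_bot_of_areDisjoint (presents_rowJ 0) (presents_colJ 0) (areDisjoint_rowL_colL 0)) w

theorem tabloidRep_polytabloidA3 {w : W} {i j : Fin 8} (hw : HasExpansion (code w) i j) :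
    tabloidRep K _ w (polytabloidA3 K) =
      tabloidA3 K i - tabloidA3 K 3 - tabloidA3 K 4 + tabloidA3 K j := by
  refine coeff_ext fun g => ?_
  rw [tabloidRep_coeff, polytabloidA3_coeff, code_mul, code_inv, hw _ (code_mem_weylCodes g)]
  simp only [MonoidAlgebra.coeff_add, MonoidAlgebra.coeff_sub, Finsupp.add_apply,
    Finsupp.sub_apply, tabloidA3_coeff]
  push_cast
  rfl

theorem polytabloidA3_eq :
    polytabloidA3 K = tabloidA3 K 0 - tabloidA3 K 3 - tabloidA3 K 4 + tabloidA3 K 7 := by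
  have hone : HasExpansion (code 1) 0 7 := code_one ▸ by decide +kernel
  simpa using tabloidRep_polytabloidA3 K hone

theorem tabloidRep_τ₄_polytabloidA3 : tabloidRep K _ τ₄ (polytabloidA3 K) =
    tabloidA3 K 1 - tabloidA3 K 3 - tabloidA3 K 4 + tabloidA3 K 6 :=
  tabloidRep_polytabloidA3 K (code_τ₄ ▸ by decide +kernel)

theorem tabloidRep_τ₂_mul_τ₄_polytabloidA3 : tabloidRep K _ (τ₂ * τ₄) (polytabloidA3 K) =
    tabloidA3 K 2 - tabloidA3 K 3 - tabloidA3 K 4 + tabloidA3 K 5 :=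
  tabloidRep_polytabloidA3 K (code_tabloidRepresentative 2 ▸ by decide +kernel)

theorem tabloidRep_τ₂_polytabloidA3 :
    tabloidRep K _ τ₂ (polytabloidA3 K) = polytabloidA3 K :=
  (tabloidRep_polytabloidA3 K (code_τ₂ ▸ by decide +kernel)).trans (polytabloidA3_eq K).symm

theorem tabloidRep_τ₂_tabloidRep_τ₄ (m : MonoidAlgebra K (W ⧸ WJ JA3)) :
    tabloidRep K _ τ₂ (tabloidRep K _ τ₄ m) = tabloidRep K _ (τ₂ * τ₄) m := by
  rw [map_mul, Module.End.mul_apply]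

theorem tabloidRep_τ₂_tabloidRep_τ₂_mul_τ₄ (m : MonoidAlgebra K (W ⧸ WJ JA3)) :
    tabloidRep K _ τ₂ (tabloidRep K _ (τ₂ * τ₄) m) = tabloidRep K _ τ₄ m := by
  have τ₂_mul_self : τ₂ * τ₂ = 1 := Subtype.ext (refl_mul_self _)
  rw [← Module.End.mul_apply, ← map_mul, ← mul_assoc, τ₂_mul_self, one_mul]

theorem linearIndependent_polytabloidA3 : LinearIndependent K ![polytabloidA3 K,
    tabloidRep K _ τ₄ (polytabloidA3 K), tabloidRep K _ (τ₂ * τ₄) (polytabloidA3 K)] := by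
  rw [tabloidRep_τ₂_mul_τ₄_polytabloidA3, tabloidRep_τ₄_polytabloidA3, polytabloidA3_eq,
    Fintype.linearIndependent_iff]
  intro c hc
  have hcoeff (j : Fin 8) := congrArg
    (fun m : MonoidAlgebra K (W ⧸ WJ JA3) => m.coeff (tabloidRepresentative j : W ⧸ WJ JA3)) hc
  simp only [Fin.sum_univ_three, Matrix.cons_val, MonoidAlgebra.coeff_add, MonoidAlgebra.coeff_sub,
    MonoidAlgebra.coeff_smul, MonoidAlgebra.coeff_zero, Finsupp.add_apply, Finsupp.sub_apply,
    Finsupp.smul_apply, Finsupp.coe_zero, Pi.zero_apply, smul_eq_mul,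
    tabloidA3_coeff_tabloidRepresentative] at hcoeff
  intro i
  fin_cases i
  · simpa using hcoeff 0
  · simpa using hcoeff 1
  · simpa using hcoeff 2

variable [CharZero K]

theorem finrank_S_A3_2A1 : Module.finrank K (S K (WJ JA3) (WJ J2A1)).toSubmodule = 3 := by
  have hchar := (generatesCharacter_rowJ_colJ K 0).character_eq (j := 0) (IsConj.refl 1)
  rw [Representation.char_one] at hchar
  exact_mod_cast hchar.trans (by simp [charTable, rowNumber] : _ = ((3 : ℕ) : K))

theorem S_A3_2A1_eq_span : (S K (WJ JA3) (WJ J2A1)).toSubmodule = Submodule.span K {polytabloidA3 K,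
    tabloidRep K _ τ₄ (polytabloidA3 K), tabloidRep K _ (τ₂ * τ₄) (polytabloidA3 K)} := by
  have hcard := finrank_span_eq_card (linearIndependent_polytabloidA3 K)
  rw [Matrix.range_cons, Matrix.range_cons_cons_empty, Set.singleton_union,
    Fintype.card_fin] at hcard
  refine (Submodule.eq_of_le_of_finrank_eq (Submodule.span_le.2 ?_) ?_).symm
  · rintro _ (rfl | rfl | rfl)
    · exact self_mem_cyclic _
    · exact apply_mem_cyclic _ _
    · exact apply_mem_cyclic _ _
  · rw [finrank_S_A3_2A1, hcard]

end Basis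

/-! ### Folding -/

section Folding

variable {E : Type*} [NormedAddCommGroup E] [InnerProductSpace ℝ E] {T : E ≃ₗᵢ[ℝ] E}

theorem existsUnique_mem_and_eq_pos_smul {J : Set E}
    (hobtuse : ∀ a ∈ J, ∀ b ∈ J, a ≠ b → ⟪a, b⟫ ≤ 0) (hne : ∀ a ∈ J, a ≠ 0) {v : E} (hv : v ∈ J) :
    ∃! s, s ∈ J ∧ ∃ c : ℝ, 0 < c ∧ v = c • s := by
  refine ⟨v, ⟨hv, 1, one_pos, (one_smul ℝ v).symm⟩, ?_⟩
  rintro s ⟨hs, c, hc, rfl⟩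
  by_contra hsv
  have hinner := hobtuse s hs _ hv hsv
  rw [real_inner_smul_right] at hinner
  exact hinner.not_gt (mul_pos hc (real_inner_self_pos.2 (hne s hs)))

/-- `s` is the orthogonal projection of `r` to the space of vectors fixed by `T`. -/
def IsFixedProjection (T : E ≃ₗᵢ[ℝ] E) (r s : E) : Prop := T s = s ∧ ∀ v, T v = v → ⟪r - s, v⟫ = 0

theorem isFixedProjection_self {r : E} (hr : T r = r) : IsFixedProjection T r r :=
  ⟨hr, fun v _ => by rw [sub_self, inner_zero_left]⟩

theorem isFixedProjection_orbit_average {r : E} {n : ℕ} (hn : n ≠ 0) (hr : (T ^ n) r = r) :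
    IsFixedProjection T r ((n : ℝ)⁻¹ • ∑ k ∈ Finset.range n, (T ^ k) r) := by
  constructor
  · have hshift : ∑ k ∈ Finset.range n, T ((T ^ k) r) = ∑ k ∈ Finset.range n, (T ^ k) r := by
      have hsucc := Finset.sum_range_succ' (fun k => (T ^ k) r) n
      rw [Finset.sum_range_succ, hr, pow_zero, LinearIsometryEquiv.coe_one, id] at hsucc
      simpa only [pow_succ', LinearIsometryEquiv.coe_mul, Function.comp_apply] using
        (add_right_cancel hsucc).symm
    rw [map_smul, map_sum, hshift]
  · intro v hv
    have hpow (k : ℕ) : (T ^ k) v = v := by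
      induction k with
      | zero => rfl
      | succ k ih => rw [pow_succ, LinearIsometryEquiv.coe_mul, Function.comp_apply, hv, ih]
    have hinner (k : ℕ) : ⟪(T ^ k) r, v⟫ = ⟪r, v⟫ := by
      conv_lhs => rw [← hpow k]
      exact (T ^ k).inner_map_map r v
    simp only [inner_sub_left, real_inner_smul_left, sum_inner, hinner, Finset.sum_const,
      Finset.card_range, nsmul_eq_mul]
    rw [inv_mul_cancel_left₀ (Nat.cast_ne_zero.2 hn), sub_self]

theorem isExtendedSubsystem_fold [FiniteDimensional ℝ E] {Φ J₀ J J₁ : Set E}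
    {G₀ G G₁ : Subgroup (weyl Φ)} (h : IsExtendedSubsystem Φ J₀ G₀ J G)
    (hspan : Submodule.span ℝ J = ⊤) (T : E ≃ₗᵢ[ℝ] E) (hT : ∀ r ∈ J, T r ∈ J)
    (hobtuse : ∀ a ∈ J₁, ∀ b ∈ J₁, a ≠ b → ⟪a, b⟫ ≤ 0) (hne : ∀ a ∈ J₁, a ≠ 0)
    (hproj : ∀ r ∈ J, ∃ s ∈ J₁, IsFixedProjection T r s)
    (hsurj : ∀ s ∈ J₁, ∃ r ∈ J, IsFixedProjection T r s)
    (hG₁ : ∀ g, g ∈ G₁ ↔ g ∈ G ∧ ∀ j ∈ J, (g : E ≃ₗᵢ[ℝ] E) (T j) = T ((g : E ≃ₗᵢ[ℝ] E) j)) :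
    IsExtendedSubsystem Φ J₀ G₀ J₁ G₁ := by
  let fixed : Submodule ℝ E := LinearMap.eqLocus T.toLinearEquiv.toLinearMap LinearMap.id
  have starProjection_eq {r s : E} (hrs : IsFixedProjection T r s) : fixed.starProjection r = s :=
    Submodule.eq_starProjection_of_mem_of_inner_eq_zero hrs.1 hrs.2
  refine h.fold T (fun r hr => ⟨1, one_pos, T r, hT r hr, (one_smul ℝ _).symm⟩) fixed
    (fun v => by simp [hspan, fixed]) J₁ (fun s hs => ?_) (fun r hr => ?_) G₁ fun g => ?_
  · obtain ⟨r, hr, hrs⟩ := hsurj s hs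
    exact ⟨r, hr, starProjection_eq hrs⟩
  · obtain ⟨s, hs, hrs⟩ := hproj r hr
    rw [starProjection_eq hrs]
    exact existsUnique_mem_and_eq_pos_smul hobtuse hne hs
  · rw [hG₁]
    refine and_congr_right fun _ =>
      ⟨fun hg => ?_, fun hg j hj => hg j (Submodule.subset_span hj)⟩
    let gE : E →ₗ[ℝ] E := (g : E ≃ₗᵢ[ℝ] E).toLinearEquiv.toLinearMap
    let TE : E →ₗ[ℝ] E := T.toLinearEquiv.toLinearMap
    exact LinearMap.eqOn_span (f := gE ∘ₗ TE) (g := TE ∘ₗ gE) hg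

end Folding

section G2

/-- The triality `α₁ ↦ α₃ ↦ α₄ ↦ α₁`. -/
def triality : V4 ≃ₗᵢ[ℝ] V4 := refl (α 0 - α 2) * refl (α 2 - α 3)

/-- The permutation of the simple roots induced by the triality. -/
def trialityIndex : Fin 4 → Fin 4 := ![2, 1, 3, 0]

theorem triality_apply (v : V4) : triality v = WithLp.toLp 2
    ![(v 0 + v 1 + v 2 + v 3) / 2, (v 0 + v 1 - v 2 - v 3) / 2, (v 0 - v 1 + v 2 - v 3) / 2,
      (-v 0 + v 1 + v 2 - v 3) / 2] := by
  rw [triality, LinearIsometryEquiv.coe_mul, Function.comp_apply, refl_apply, refl_apply]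
  ext i
  fin_cases i <;>
    simp [α, ε, EuclideanSpace.norm_sq_eq, PiLp.inner_apply, Fin.sum_univ_four] <;> ring

/-- The coordinates of the image under the triality, multiplied by `2`. -/
def twiceTriality (c : Fin 4 → ℤ) : Fin 4 → ℤ := ![c 0 + c 1 + c 2 + c 3, c 0 + c 1 - c 2 - c 3,
  c 0 - c 1 + c 2 - c 3, -c 0 + c 1 + c 2 - c 3]

theorem eq_triality_iff {u v : V4} {a b : Fin 4 → ℤ} (hu : ∀ i, u i = a i) (hv : ∀ i, v i = b i) :
    u = triality v ↔ ∀ i, 2 * a i = twiceTriality b i := by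
  have htwice (i : Fin 4) : triality v i = (twiceTriality b i : ℝ) / 2 := by
    rw [triality_apply]
    fin_cases i <;> simp [twiceTriality, hv]
  rw [PiLp.ext_iff]
  refine forall_congr' fun i => ?_
  rw [hu, htwice, eq_div_iff two_ne_zero, mul_comm]
  exact_mod_cast Iff.rfl

theorem triality_α (i : Fin 4) : triality (α i) = α (trialityIndex i) := by
  have hcoord : ∀ i k : Fin 4, 2 * pairCoord simplePairs[trialityIndex i] k =
      twiceTriality (pairCoord simplePairs[i]) k := by decide
  rw [α_eq_pairVec, α_eq_pairVec]
  exact ((eq_triality_iff (pairVec_apply _) (pairVec_apply _)).2 (hcoord i)).symm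

/-- The element with code `x` commutes with the triality on the simple roots. -/
def CommutesWithTriality (x : ℕ) : Prop :=
  ∀ i k : Fin 4, 2 * pairCoord (actPair x simplePairs[trialityIndex i]) k =
    twiceTriality (pairCoord (actPair x simplePairs[i])) k

instance (x : ℕ) : Decidable (CommutesWithTriality x) :=
  inferInstanceAs (Decidable (∀ _ _ : Fin 4, _))

theorem mem_groupG2_iff : ∀ x ∈ weylCodes, x ∈ groupG2 ↔ CommutesWithTriality x := by
  decide +kernel

theorem mem_WG2_iff (g : W) : g ∈ WG2 ↔ ∀ j ∈ π,
    (g : V4 ≃ₗᵢ[ℝ] V4) (triality j) = triality ((g : V4 ≃ₗᵢ[ℝ] V4) j) := by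
  have hlt (i : Fin 4) : simplePairs[i].1 < 8 ∧ simplePairs[i].2 < 8 :=
    lt_eight_of_mem_rootPairs _ (simplePairs_subset (List.getElem_mem _))
  rw [presents_WG2.mem_iff, mem_groupG2_iff _ (code_mem_weylCodes g)]
  refine Iff.trans (forall_congr' fun i => ?_) (Set.forall_mem_range (f := α)).symm
  rw [triality_α, α_eq_pairVec, α_eq_pairVec, apply_pairVec g (hlt _), apply_pairVec g (hlt _),
    eq_triality_iff (pairVec_apply _) (pairVec_apply _)]

/-- The short simple root of `G₂`, the average of the orbit `α₁, α₃, α₄` of the triality. -/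
def shortRootG2 : V4 := (1 / 3 : ℝ) • (rt 1 0 0 0 + rt 0 0 1 0 + rt 0 0 0 1)

theorem shortRootG2_eq : shortRootG2 = WithLp.toLp 2 ![1 / 3, -1 / 3, 2 / 3, 0] := by
  rw [shortRootG2, rt_apply, rt_apply, rt_apply]
  ext i
  fin_cases i <;> norm_num

theorem JG2_eq : JG2 = {α 1, shortRootG2} := by
  rw [JG2, ← shortRootG2]
  congr 1
  simp [rt]

theorem isFixedProjection_shortRootG2 {i : Fin 4} (hi : i ≠ 1) :
    IsFixedProjection triality (α i) shortRootG2 := by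
  have hpow (k : ℕ) : (triality ^ k) (α i) = α (trialityIndex^[k] i) := by
    induction k with
    | zero => rfl
    | succ k ih =>
      rw [pow_succ', LinearIsometryEquiv.coe_mul, Function.comp_apply, ih, triality_α,
        Function.iterate_succ_apply']
  have hperiod : (triality ^ 3) (α i) = α i := by
    rw [hpow, (by decide : ∀ i, trialityIndex^[3] i = i) i]
  have hsum : ∑ k ∈ Finset.range 3, (triality ^ k) (α i) = α 0 + α 2 + α 3 := by
    simp only [hpow, Finset.sum_range_succ, Finset.sum_range_zero, zero_add]
    fin_cases i
    · rfl
    · exact absurd rfl hi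
    · exact (add_rotate (α 0) (α 2) (α 3)).symm
    · exact add_rotate (α 3) (α 0) (α 2)
  have haverage : shortRootG2 = ((3 : ℕ) : ℝ)⁻¹ • (α 0 + α 2 + α 3) := by simp [shortRootG2, rt]
  exact haverage ▸ hsum ▸ isFixedProjection_orbit_average three_ne_zero hperiod

theorem inner_α_one_shortRootG2_neg : ⟪α 1, shortRootG2⟫ < 0 := by
  rw [shortRootG2_eq]
  simp [α, ε, PiLp.inner_apply, Fin.sum_univ_four]
  norm_num

theorem isExtendedSubsystem_G2 : IsExtendedSubsystem Φ π ⊤ JG2 WG2 := by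
  have hneg := inner_α_one_shortRootG2_neg
  rw [JG2_eq]
  refine isExtendedSubsystem_fold .base span_π triality ?_ ?_ ?_ ?_ ?_
    fun g => by rw [mem_WG2_iff]; exact (and_iff_right (Subgroup.mem_top g)).symm
  · rintro _ ⟨i, rfl⟩
    exact ⟨_, (triality_α i).symm⟩
  · rintro a (rfl | rfl) b (rfl | rfl) hab
    · exact absurd rfl hab
    · exact hneg.le
    · rw [real_inner_comm]; exact hneg.le
    · exact absurd rfl hab
  · rintro a (rfl | rfl) hzero
    · exact hneg.ne (by rw [hzero, inner_zero_left])
    · exact hneg.ne (by rw [hzero, inner_zero_right])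
  · rintro _ ⟨i, rfl⟩
    rcases eq_or_ne i 1 with rfl | hi
    · exact ⟨α 1, .inl rfl, isFixedProjection_self (triality_α 1)⟩
    · exact ⟨shortRootG2, .inr rfl, isFixedProjection_shortRootG2 hi⟩
  · rintro s (rfl | rfl)
    · exact ⟨α 1, ⟨1, rfl⟩, isFixedProjection_self (triality_α 1)⟩
    · exact ⟨α 0, ⟨0, rfl⟩, isFixedProjection_shortRootG2 (by decide)⟩

end G2

section B3

/-- The part `A₃` of the extended Dynkin diagram that is folded to `B₃`. -/
def listB3 : List (ℕ × ℕ) := [(0, 5), (4, 5), (1, 6), (2, 3)]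

theorem pairVecs_listB3 :
    pairVecs listB3 = {pairVec (0, 5), pairVec (4, 5), pairVec (1, 6), pairVec (2, 3)} := by
  simp [listB3, pairVecs_cons, pairVecs_nil]

/-- The change of sign of the first coordinate. -/
def coordFlip : V4 ≃ₗᵢ[ℝ] V4 := refl (ε 0)

/-- The code of `coordFlip`. -/
def codeFlip : ℕ := ofOctalDigits 4 1 2 3

theorem coordFlip_apply (v : V4) : coordFlip v = WithLp.toLp 2 ![-v 0, v 1, v 2, v 3] := by
  rw [coordFlip, refl_apply]
  ext i
  fin_cases i
  · simp [ε, PiLp.inner_apply]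
    ring
  all_goals simp [ε, PiLp.inner_apply]

theorem hasCode_coordFlip : HasCode coordFlip codeFlip := by
  have hcoord : ∀ x < 8, ∀ i, (![-signedεCoord x 0, signedεCoord x 1, signedεCoord x 2,
      signedεCoord x 3] : Fin 4 → ℤ) i = signedεCoord (codeAct codeFlip x) i := by decide
  intro x hx
  rw [coordFlip_apply]
  ext i
  rw [signedε_apply (codeAct _ _), ← hcoord x hx i]
  fin_cases i <;> simp [signedε_apply]

theorem coordFlip_pairVec {p : ℕ × ℕ} (hp : p.1 < 8 ∧ p.2 < 8) :
    coordFlip (pairVec p) = pairVec (actPair codeFlip p) := by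
  rw [pairVec, map_add, hasCode_coordFlip _ hp.1, hasCode_coordFlip _ hp.2, pairVec, actPair]

/-- The element with code `x` commutes with `coordFlip` on the roots listed by `listB3`. -/
def CommutesWithFlip (x : ℕ) : Prop :=
  ∀ p ∈ listB3, pairCoord (actPair x (actPair codeFlip p)) =
    pairCoord (actPair codeFlip (actPair x p))

instance (x : ℕ) : Decidable (CommutesWithFlip x) :=
  inferInstanceAs (Decidable (∀ p ∈ listB3, _))

theorem mem_groupB3_iff :
    ∀ x ∈ weylCodes, x ∈ groupB3 ↔ x ∈ pairGroup listB3 ∧ CommutesWithFlip x := by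
  decide +kernel

theorem mem_WB3_iff (g : W) : g ∈ WB3 ↔ g ∈ WJ (pairVecs listB3) ∧ ∀ j ∈ pairVecs listB3,
    (g : V4 ≃ₗᵢ[ℝ] V4) (coordFlip j) = coordFlip ((g : V4 ≃ₗᵢ[ℝ] V4) j) := by
  have hlt : ∀ p ∈ listB3, p.1 < 8 ∧ p.2 < 8 := by decide
  have hpresents : Presents (WJ (pairVecs listB3)) (pairGroup listB3) :=
    presents_WJ (by decide) (by decide +kernel)
  rw [presents_WB3.mem_iff, mem_groupB3_iff _ (code_mem_weylCodes g), hpresents.mem_iff]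
  have hpairs (P : V4 → Prop) : (∀ v ∈ pairVecs listB3, P v) ↔ ∀ p ∈ listB3, P (pairVec p) :=
    ⟨fun hP p hp => hP _ ⟨p, hp, rfl⟩, by rintro hP _ ⟨p, hp, rfl⟩; exact hP p hp⟩
  rw [hpairs]
  refine and_congr_right fun _ => forall₂_congr fun p hp => ?_
  rw [coordFlip_pairVec (hlt p hp), apply_pairVec g (hlt p hp), apply_pairVec g (actPair_lt _ _),
    coordFlip_pairVec (actPair_lt _ _)]
  exact ⟨pairVec_eq_of_pairCoord_eq, pairCoord_eq_of_pairVec_eq⟩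

theorem span_listB3 : Submodule.span ℝ (pairVecs listB3) = ⊤ := by
  refine Submodule.eq_top_iff'.2 fun v => ?_
  have hmem (p) (hp : p ∈ listB3) (c : ℝ) : c • pairVec p ∈ Submodule.span ℝ (pairVecs listB3) :=
    Submodule.smul_mem _ _ (Submodule.subset_span ⟨p, hp, rfl⟩)
  have hv : v = ((v 3 - v 2 - v 1 + v 0) / 2) • pairVec (0, 5) +
      ((v 3 - v 2 - v 1 - v 0) / 2) • pairVec (4, 5) + (v 3 - v 2) • pairVec (1, 6) +
      v 3 • pairVec (2, 3) := by
    ext i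
    fin_cases i
    all_goals
      simp only [PiLp.add_apply, PiLp.smul_apply, pairVec_apply, smul_eq_mul]
      simp [pairCoord, signedεCoord]
      try ring
  rw [hv]
  exact add_mem (add_mem (add_mem (hmem _ (by decide) _) (hmem _ (by decide) _))
    (hmem _ (by decide) _)) (hmem _ (by decide) _)

theorem isFixedProjection_signedε_five {p : ℕ × ℕ} (hp : p = (0, 5) ∨ p = (4, 5)) :
    IsFixedProjection coordFlip (pairVec p) (signedε 5) := by
  have hperiod : (coordFlip ^ 2) (pairVec p) = pairVec p := by
    rw [sq, coordFlip, refl_mul_self, LinearIsometryEquiv.coe_one, id]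
  have hlt : p.1 < 8 ∧ p.2 < 8 := by rcases hp with rfl | rfl <;> decide
  have hcoord : ∀ i, pairCoord p i + pairCoord (actPair codeFlip p) i = 2 * signedεCoord 5 i := by
    rcases hp with rfl | rfl <;> decide
  have hsum : ∑ k ∈ Finset.range 2, (coordFlip ^ k) (pairVec p) = (2 : ℝ) • signedε 5 := by
    rw [Finset.sum_range_succ, Finset.sum_range_one, pow_zero, pow_one,
      LinearIsometryEquiv.coe_one, id, coordFlip_pairVec hlt]
    ext i
    rw [PiLp.add_apply, pairVec_apply, pairVec_apply, PiLp.smul_apply, signedε_apply, smul_eq_mul]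
    exact_mod_cast hcoord i
  have haverage := isFixedProjection_orbit_average two_ne_zero hperiod
  rwa [hsum, Nat.cast_ofNat, inv_smul_smul₀ two_ne_zero] at haverage

theorem isFixedProjection_pairVec {p : ℕ × ℕ} (hp : p = (1, 6) ∨ p = (2, 3)) :
    IsFixedProjection coordFlip (pairVec p) (pairVec p) := by
  rcases hp with rfl | rfl <;> exact isFixedProjection_self (coordFlip_pairVec (by decide))

theorem JB3_eq : JB3 = {pairVec (1, 6), pairVec (2, 3), signedε 5} := by
  rw [JB3, rt_0100, rt_0001, rt_1000, rt_1211]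
  congr 3
  have hcoord : ∀ i, pairCoord (0, 5) i - pairCoord (0, 1) i = 2 * signedεCoord 5 i := by decide
  have htwice : pairVec (0, 5) - pairVec (0, 1) = (2 : ℝ) • signedε 5 := by
    ext i
    rw [PiLp.sub_apply, pairVec_apply, pairVec_apply, PiLp.smul_apply, signedε_apply, smul_eq_mul]
    exact_mod_cast hcoord i
  rw [htwice, one_div, inv_smul_smul₀ two_ne_zero]

theorem inner_nonpos_JB3 : ∀ a ∈ JB3, ∀ b ∈ JB3, a ≠ b → ⟪a, b⟫ ≤ 0 := by
  have hnonpos {u v : V4} {a b : Fin 4 → ℤ} (hu : ∀ i, u i = a i) (hv : ∀ i, v i = b i)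
      (hab : dot a b ≤ 0) : ⟪u, v⟫ ≤ 0 := by
    rw [inner_eq_dot hu hv]
    exact_mod_cast hab
  rw [JB3_eq]
  rintro a (rfl | rfl | rfl) b (rfl | rfl | rfl) hab
  · exact absurd rfl hab
  · exact hnonpos (pairVec_apply _) (pairVec_apply _) (by decide)
  · exact hnonpos (pairVec_apply _) (signedε_apply _) (by decide)
  · exact hnonpos (pairVec_apply _) (pairVec_apply _) (by decide)
  · exact absurd rfl hab
  · exact hnonpos (pairVec_apply _) (signedε_apply _) (by decide)
  · exact hnonpos (signedε_apply _) (pairVec_apply _) (by decide)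
  · exact hnonpos (signedε_apply _) (pairVec_apply _) (by decide)
  · exact absurd rfl hab

theorem ne_zero_of_mem_JB3 : ∀ a ∈ JB3, a ≠ 0 := by
  have hne {v : V4} {c : Fin 4 → ℤ} (hv : ∀ i, v i = c i) (hc : ∃ i, c i ≠ 0) : v ≠ 0 := by
    rintro rfl
    obtain ⟨i, hi⟩ := hc
    exact hi (Int.cast_eq_zero.1 (hv i).symm)
  rw [JB3_eq]
  rintro a (rfl | rfl | rfl)
  · exact hne (pairVec_apply _) (by decide)
  · exact hne (pairVec_apply _) (by decide)
  · exact hne (signedε_apply _) (by decide)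

theorem isExtendedSubsystem_listB3 :
    IsExtendedSubsystem Φ π ⊤ (pairVecs listB3) (WJ (pairVecs listB3)) := by
  have hsubset : ∀ p ∈ listB3, p ∈ extendedPairs := by decide
  refine isExtendedSubsystem_of_ssubset
    ⟨fun v ⟨p, hp, hv⟩ => ⟨p, hsubset p hp, hv⟩, fun hsub => ?_⟩
  obtain ⟨p, hp, hpe⟩ := hsub ⟨(2, 7), by decide, rfl⟩
  have hne : ∀ p ∈ listB3, pairCoord (2, 7) ≠ pairCoord p := by decide
  exact hne p hp (pairCoord_eq_of_pairVec_eq hpe)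

theorem isExtendedSubsystem_B3 : IsExtendedSubsystem Φ π ⊤ JB3 WB3 := by
  refine isExtendedSubsystem_fold isExtendedSubsystem_listB3 span_listB3 coordFlip ?_
    inner_nonpos_JB3 ne_zero_of_mem_JB3 ?_ ?_ mem_WB3_iff
  · have hflip : ∀ p ∈ listB3, (p.1 < 8 ∧ p.2 < 8) ∧ actPair codeFlip p ∈ listB3 := by decide
    rintro _ ⟨p, hp, rfl⟩
    rw [coordFlip_pairVec (hflip p hp).1]
    exact ⟨_, (hflip p hp).2, rfl⟩
  · rw [pairVecs_listB3, JB3_eq]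
    rintro _ (rfl | rfl | rfl | rfl)
    · exact ⟨_, .inr (.inr rfl), isFixedProjection_signedε_five (.inl rfl)⟩
    · exact ⟨_, .inr (.inr rfl), isFixedProjection_signedε_five (.inr rfl)⟩
    · exact ⟨_, .inl rfl, isFixedProjection_pairVec (.inl rfl)⟩
    · exact ⟨_, .inr (.inl rfl), isFixedProjection_pairVec (.inr rfl)⟩
  · rw [pairVecs_listB3, JB3_eq]
    rintro _ (rfl | rfl | rfl)
    · exact ⟨_, .inr (.inr (.inl rfl)), isFixedProjection_pairVec (.inl rfl)⟩
    · exact ⟨_, .inr (.inr (.inr rfl)), isFixedProjection_pairVec (.inr rfl)⟩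
    · exact ⟨_, .inl rfl, isFixedProjection_signedε_five (.inl rfl)⟩

end B3

/-! ### Deleting nodes inside proper subgroups -/

section Deletion

/-- Among the elements with codes in `h`, the reflection in a root of `L'` is determined by its
values on the roots of `L`. -/
def AreReflectionsDetermined (h : List ℕ) (L L' : List (ℕ × ℕ)) : Prop :=
  ∀ a ∈ L', reflCode a ∈ h ∧ ∀ x ∈ h, x = reflCode a ∨
    ∃ p ∈ L, pairCoord (actPair x p) ≠ pairCoord (actPair (reflCode a) p)

instance (h : List ℕ) (L L' : List (ℕ × ℕ)) : Decidable (AreReflectionsDetermined h L L') :=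
  inferInstanceAs (Decidable (∀ a ∈ L', _ ∧ ∀ x ∈ h, _ ∨ ∃ p ∈ L, _))

theorem refl_pairVec_apply_pairVec {a p : ℕ × ℕ} (ha : a ∈ rootPairs) (hp : p.1 < 8 ∧ p.2 < 8) :
    refl (pairVec a) (pairVec p) = pairVec (actPair (reflCode a) p) := by
  rw [← code_pairRefl ha, ← apply_pairVec _ hp]
  rfl

theorem closure_agree_eq_WJ {G : Subgroup W} {J : Set V4} {h : List ℕ} (hG : Presents G h)
    {L L' : List (ℕ × ℕ)} (hL : ∀ p ∈ L, (p.1 < 8 ∧ p.2 < 8) ∧ pairVec p ∈ Submodule.span ℝ J)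
    (hL' : ∀ a ∈ L', a ∈ rootPairs) (hdet : AreReflectionsDetermined h L L') :
    Subgroup.closure {g : W | g ∈ G ∧ ∃ α ∈ pairVecs L', ∀ v ∈ Submodule.span ℝ J,
      (g : V4 ≃ₗᵢ[ℝ] V4) v = refl α v} = WJ (pairVecs L') := by
  rw [WJ, reflSubgroup]
  congr 1
  ext g
  constructor
  · rintro ⟨hg, _, ⟨a, ha, rfl⟩, hga⟩
    refine ⟨pairVec a, ⟨a, ha, rfl⟩, ?_⟩
    rcases (hdet a ha).2 _ ((hG.mem_iff g).1 hg) with hcode | ⟨p, hp, hne⟩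
    · rw [← code_pairRefl (hL' a ha)] at hcode
      rw [code_injective hcode]
      rfl
    · have hgp := hga _ (hL p hp).2
      rw [apply_pairVec g (hL p hp).1, refl_pairVec_apply_pairVec (hL' a ha) (hL p hp).1] at hgp
      exact absurd (pairCoord_eq_of_pairVec_eq hgp) hne
  · rintro ⟨_, ⟨a, ha, rfl⟩, hga⟩
    refine ⟨?_, pairVec a, ⟨a, ha, rfl⟩, fun v _ => by rw [hga]⟩
    rw [show g = pairRefl a (hL' a ha) from Subtype.ext hga, hG.mem_iff, code_pairRefl]
    exact (hdet a ha).1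

theorem inner_pairVec_zero_three_one_two : ⟪pairVec (0, 3), pairVec (1, 2)⟫ = 0 := by
  have hdot : dot (pairCoord (0, 3)) (pairCoord (1, 2)) = 0 := by decide
  rw [inner_pairVec, hdot, Int.cast_zero]

theorem pairVecs_colL_zero : pairVecs (colL 0) = {pairVec (0, 3), pairVec (1, 2)} := by
  have hmem : ∀ p, p ∈ colL 0 ↔ p = (0, 3) ∨ p = (1, 2) := by
    simp [colL]
  ext v
  simp [pairVecs, hmem, or_and_right, exists_or]

theorem sub_apply_mem_span_of_2A1 {g : W} (hg : g ∈ WJ (pairVecs (colL 0))) {j : V4}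
    (hj : j ∈ pairVecs (colL 0))
    (hspan : (g : V4 ≃ₗᵢ[ℝ] V4) j ∈ Submodule.span ℝ {pairVec (1, 2)}) :
    pairVec (1, 2) - (g : V4 ≃ₗᵢ[ℝ] V4) j ∈ Submodule.span ℝ≥0 {pairVec (1, 2)} := by
  have horbit : ∀ x ∈ pairGroup (colL 0), ∀ p ∈ colL 0,
      dot (pairCoord (0, 3)) (pairCoord (actPair x p)) ≠ 0 ∨
        pairCoord (actPair x p) = pairCoord (1, 2) ∨
        ∀ i, pairCoord (1, 2) i - pairCoord (actPair x p) i = 2 * pairCoord (1, 2) i := by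
    decide +kernel
  have hlt : ∀ p ∈ colL 0, p.1 < 8 ∧ p.2 < 8 := by decide
  obtain ⟨p, hp, rfl⟩ := hj
  rw [apply_pairVec g (hlt p hp)] at hspan ⊢
  rcases horbit _ (((isSimpleList_colL 0).presents.mem_iff g).1 hg) p hp with hdot | heq | htwice
  · obtain ⟨c, hc⟩ := Submodule.mem_span_singleton.1 hspan
    have horth : ⟪pairVec (0, 3), pairVec (actPair (code g) p)⟫ = 0 := by
      rw [← hc, real_inner_smul_right, inner_pairVec_zero_three_one_two, mul_zero]
    rw [inner_pairVec] at horth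
    exact absurd (by exact_mod_cast horth) hdot
  · rw [pairVec_eq_of_pairCoord_eq heq, sub_self]
    exact zero_mem _
  · have hsub : pairVec (1, 2) - pairVec (actPair (code g) p) = (2 : ℝ) • pairVec (1, 2) := by
      ext i
      rw [PiLp.sub_apply, PiLp.smul_apply, pairVec_apply, pairVec_apply, smul_eq_mul]
      exact_mod_cast htwice i
    rw [hsub]
    exact smul_mem_span_nnreal zero_le_two (Submodule.subset_span rfl)

theorem isExtendedSubsystem_2A1_A1 : IsExtendedSubsystem Φ J2A1 (WJ J2A1) JA1 (WJ JA1) := by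
  have hne : pairVec (1, 2) ≠ pairVec (0, 3) := fun h =>
    absurd (pairCoord_eq_of_pairVec_eq h) (by decide)
  have hmem : pairVec (1, 2) ∈ pairVecs (colL 0) := ⟨(1, 2), by decide, rfl⟩
  have hL : ∀ p ∈ colL 0, (p.1 < 8 ∧ p.2 < 8) ∧ pairVec p ∈ Submodule.span ℝ (pairVecs (colL 0)) :=
    fun p hp => ⟨lt_eight_of_mem_rootPairs p ((isSimpleList_colL 0).subset hp),
      Submodule.subset_span ⟨p, hp, rfl⟩⟩
  rw [show J2A1 = pairVecs (colL 0) from colJ_eq 0, JA1_eq,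
    ← closure_agree_eq_WJ (L' := listA1) (isSimpleList_colL 0).presents hL (by decide)
      (by decide +kernel)]
  refine IsExtendedSubsystem.base.delete {pairVec (1, 2)} ?_ ?_ (pairVec (1, 2))
    ⟨1, Subgroup.one_mem _, pairVec (1, 2), hmem, rfl⟩
    (Submodule.mem_span_singleton_self _) (fun g hg j hj => sub_apply_mem_span_of_2A1 hg hj)
    (pairVecs listA1) ?_ ?_
  · exact Set.singleton_subset_iff.2 hmem
  · rw [pairVecs_colL_zero]
    rintro _ rfl _ ⟨rfl | rfl, hnot⟩
    · rw [real_inner_comm]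
      exact inner_pairVec_zero_three_one_two
    · exact absurd rfl hnot
  · rw [listA1, pairVecs_cons, pairVecs_nil, pairVecs_colL_zero]
    rintro _ (rfl | h)
    · exact .inr (.inl rfl)
    · exact absurd h (Set.notMem_empty _)
  · rw [listA1, pairVecs_cons, pairVecs_nil]
    exact fun hsub => hne ((hsub (.inr rfl)).resolve_right (Set.notMem_empty _))

theorem eq_sum_JB3_of_apply_zero {v : V4} (hv : v 0 = 0) :
    v = (v 3 - v 2) • pairVec (1, 6) + v 3 • pairVec (2, 3) + (v 3 - v 2 - v 1) • signedε 5 := by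
  ext i
  fin_cases i <;> simp [pairVec_apply, signedε_apply, pairCoord, signedεCoord, hv]

theorem mem_span_JB3 {v : V4} (hv : v 0 = 0) : v ∈ Submodule.span ℝ JB3 := by
  rw [eq_sum_JB3_of_apply_zero hv, JB3_eq]
  exact add_mem (add_mem (Submodule.smul_mem _ _ (Submodule.subset_span (.inl rfl)))
    (Submodule.smul_mem _ _ (Submodule.subset_span (.inr (.inl rfl)))))
    (Submodule.smul_mem _ _ (Submodule.subset_span (.inr (.inr rfl))))

theorem mem_span_nnreal_JB3 {v : V4} {c : Fin 4 → ℤ} (hv : ∀ i, v i = c i) (hzero : c 0 = 0)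
    (hlong : 0 ≤ c 3 - c 2) (hlong' : 0 ≤ c 3) (hshort : 0 ≤ c 3 - c 2 - c 1) :
    v ∈ Submodule.span ℝ≥0 JB3 := by
  have hlong_cast : (0 : ℝ) ≤ c 3 - c 2 := by exact_mod_cast hlong
  have hlong_cast' : (0 : ℝ) ≤ c 3 := by exact_mod_cast hlong'
  have hshort_cast : (0 : ℝ) ≤ c 3 - c 2 - c 1 := by exact_mod_cast hshort
  rw [eq_sum_JB3_of_apply_zero (v := v) (by rw [hv, hzero, Int.cast_zero]), JB3_eq, hv, hv, hv]
  exact add_mem (add_mem (smul_mem_span_nnreal hlong_cast (Submodule.subset_span (.inl rfl)))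
    (smul_mem_span_nnreal hlong_cast' (Submodule.subset_span (.inr (.inl rfl)))))
    (smul_mem_span_nnreal hshort_cast (Submodule.subset_span (.inr (.inr rfl))))

/-- The highest root of `B₃` minus the vector with coordinates `c` is a nonnegative combination of
the simple roots. -/
abbrev IsBelowHighest (c : Fin 4 → ℤ) : Prop :=
  c 0 = 0 ∧ 0 ≤ 2 - c 3 + c 2 ∧ 0 ≤ 1 - c 3 ∧ 0 ≤ 2 - c 3 + c 2 + c 1

theorem IsBelowHighest.sub_mem_span_JB3 {v : V4} {c : Fin 4 → ℤ} (hc : IsBelowHighest c)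
    (hv : ∀ i, v i = c i) : pairVec (3, 6) - v ∈ Submodule.span ℝ≥0 JB3 := by
  obtain ⟨hzero, hlong, hlong', hshort⟩ := hc
  have hhighest : ∀ i, pairCoord (3, 6) i = ![0, 0, -1, 1] i := by decide
  have hsub (i) : (pairVec (3, 6) - v) i = ((![0, 0, -1, 1] i - c i : ℤ) : ℝ) := by
    rw [PiLp.sub_apply, hv, pairVec_apply, hhighest, Int.cast_sub]
  refine mem_span_nnreal_JB3 hsub ?_ ?_ ?_ ?_ <;> simp only [Matrix.cons_val] <;> lia

theorem isBelowHighest_orbit_JB3 : ∀ x ∈ groupB3,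
    IsBelowHighest (pairCoord (actPair x (1, 6))) ∧ IsBelowHighest (pairCoord (actPair x (2, 3))) ∧
      IsBelowHighest (signedεCoord (codeAct x 5)) := by
  decide +kernel

theorem sub_apply_mem_span_JB3 {g : W} (hg : g ∈ WB3) {j : V4} (hj : j ∈ JB3) :
    pairVec (3, 6) - (g : V4 ≃ₗᵢ[ℝ] V4) j ∈ Submodule.span ℝ≥0 JB3 := by
  obtain ⟨hleft, hmiddle, hshort⟩ := isBelowHighest_orbit_JB3 _ ((presents_WB3.mem_iff g).1 hg)
  rw [JB3_eq] at hj
  rcases hj with rfl | rfl | rfl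
  · rw [apply_pairVec g (by decide)]
    exact hleft.sub_mem_span_JB3 (pairVec_apply _)
  · rw [apply_pairVec g (by decide)]
    exact hmiddle.sub_mem_span_JB3 (pairVec_apply _)
  · rw [hasCode_code g 5 (by decide)]
    exact hshort.sub_mem_span_JB3 (signedε_apply _)

theorem exists_mem_WB3_apply_eq_highest : ∃ g ∈ WB3, ∃ j ∈ JB3,
    pairVec (3, 6) = (g : V4 ≃ₗᵢ[ℝ] V4) j := by
  have hcode : ∃ x ∈ groupB3, pairCoord (3, 6) = pairCoord (actPair x (2, 3)) := by decide +kernel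
  obtain ⟨x, hx, heq⟩ := hcode
  obtain ⟨g, rfl⟩ := exists_code_eq (presents_WB3.subset hx)
  refine ⟨g, (presents_WB3.mem_iff g).2 hx, pairVec (2, 3), ?_, ?_⟩
  · rw [JB3_eq]
    exact .inr (.inl rfl)
  · rw [apply_pairVec g (by decide), pairVec_eq_of_pairCoord_eq heq]

theorem signedε_five_notMem_pairVecs_listA3' : signedε 5 ∉ pairVecs listA3' := by
  rintro ⟨p, hp, heq⟩
  have hne : ∀ p ∈ listA3', ¬ ∀ i, signedεCoord 5 i = pairCoord p i := by decide
  refine hne p hp fun i => ?_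
  have hi := congrArg (fun v : V4 => v i) heq
  simp only [signedε_apply, pairVec_apply] at hi
  exact_mod_cast hi

theorem isExtendedSubsystem_B3_A3 : IsExtendedSubsystem Φ JB3 WB3 JA3' (WJ JA3') := by
  have hL : ∀ p ∈ listA3', (p.1 < 8 ∧ p.2 < 8) ∧ pairVec p ∈ Submodule.span ℝ JB3 := by
    have hcoord : ∀ p ∈ listA3', (p.1 < 8 ∧ p.2 < 8) ∧ pairCoord p 0 = 0 := by decide
    refine fun p hp => ⟨(hcoord p hp).1, mem_span_JB3 ?_⟩
    rw [pairVec_apply, (hcoord p hp).2, Int.cast_zero]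
  have hhighest : (pairVec (3, 6)) 0 = 0 := by
    rw [pairVec_apply, show pairCoord (3, 6) 0 = 0 by decide, Int.cast_zero]
  have hneg : -pairVec (3, 6) = pairVec (2, 7) := by
    have hcoord : ∀ i, -pairCoord (3, 6) i = pairCoord (2, 7) i := by decide
    ext i
    rw [PiLp.neg_apply, pairVec_apply, pairVec_apply]
    exact_mod_cast hcoord i
  rw [JA3'_eq, ← closure_agree_eq_WJ (L' := listA3') presents_WB3 hL (by decide)
      (by decide +kernel)]
  refine IsExtendedSubsystem.base.delete JB3 subset_rfl (fun _ _ _ hb => absurd hb.1 hb.2)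
    (pairVec (3, 6)) exists_mem_WB3_apply_eq_highest (mem_span_JB3 hhighest)
    (fun g hg j hj _ => sub_apply_mem_span_JB3 hg hj) (pairVecs listA3') ?_ fun hsub => ?_
  · rw [hneg, JB3_eq, listA3', pairVecs_cons, pairVecs_cons, pairVecs_cons, pairVecs_nil]
    rintro _ (rfl | rfl | rfl | h)
    · exact .inr (.inl rfl)
    · exact .inr (.inr (.inl rfl))
    · exact .inl rfl
    · exact absurd h (Set.notMem_empty _)
  · refine signedε_five_notMem_pairVecs_listA3' (hsub (.inr ?_))
    rw [JB3_eq]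
    exact .inr (.inr rfl)

end Deletion

end WeylSpecht

end

open WeylSpecht in
theorem mainTheorem4 (K : Type*) [Field K] [CharZero K] :
    -- the listed elements represent the conjugacy classes of `W(D₄)`
    (∀ g : W, ∃! j : Fin 13, IsConj (classRep j) g) ∧
    -- the eleven pairs of subsystems
    (∀ r : Fin 11,
      IsExtendedSubsystem Φ π ⊤ (rowJ r) (WJ (rowJ r)) ∧
      IsExtendedSubsystem Φ π ⊤ (colJ r) (WJ (colJ r)) ∧
      IsGoodSystem K Φ π (rowJ r) (colJ r) ∧
      IsGoodDual K Φ π (WJ (rowJ r)) (WJ (colJ r)) ∧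
      Affords (S K (WJ (rowJ r)) (WJ (colJ r))).toRepresentation (rowChar r)) ∧
    -- the pair `A₃`, `2A₁` in detail: tabloids, polytabloids, a basis, the action of `τ₂`
    (let t : W → MonoidAlgebra K (W ⧸ WJ JA3) := fun w => tabloid w
     let ρ : Representation K W (MonoidAlgebra K (W ⧸ WJ JA3)) := tabloidRep K (WJ JA3)
     let e : MonoidAlgebra K (W ⧸ WJ JA3) := polytabloid K (sign Φ π) (WJ JA3) (WJ J2A1)
     Function.Bijective (fun i : Fin 8 =>
        ((![1, τ₄, τ₂ * τ₄, τ₁ * τ₂ * τ₄, τ₃ * τ₂ * τ₄, τ₁ * τ₃ * τ₂ * τ₄,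
          τ₂ * τ₁ * τ₃ * τ₂ * τ₄, τ₄ * τ₂ * τ₁ * τ₃ * τ₂ * τ₄] i : W) : W ⧸ WJ JA3)) ∧
      e = t 1 - t (τ₁ * τ₂ * τ₄) - t (τ₃ * τ₂ * τ₄) + t (τ₄ * τ₂ * τ₁ * τ₃ * τ₂ * τ₄) ∧
      ρ τ₄ e = t τ₄ - t (τ₁ * τ₂ * τ₄) - t (τ₃ * τ₂ * τ₄) + t (τ₂ * τ₁ * τ₃ * τ₂ * τ₄) ∧
      ρ (τ₂ * τ₄) e =
        t (τ₂ * τ₄) - t (τ₁ * τ₂ * τ₄) - t (τ₃ * τ₂ * τ₄) + t (τ₁ * τ₃ * τ₂ * τ₄) ∧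
      LinearIndependent K ![e, ρ τ₄ e, ρ (τ₂ * τ₄) e] ∧
      (S K (WJ JA3) (WJ J2A1)).toSubmodule = Submodule.span K {e, ρ τ₄ e, ρ (τ₂ * τ₄) e} ∧
      ρ τ₂ e = e ∧ ρ τ₂ (ρ τ₄ e) = ρ (τ₂ * τ₄) e ∧ ρ τ₂ (ρ (τ₂ * τ₄) e) = ρ τ₄ e) ∧
    -- `χ₁₂` from the Steinberg subgroup `W(G₂)`
    (IsExtendedSubsystem Φ π ⊤ JG2 WG2 ∧
      IsExtendedSubsystem Φ π ⊤ JA2 (WJ JA2) ∧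
      IsGoodDual K Φ π WG2 (WJ JA2) ∧
      Affords (S K WG2 (WJ JA2)).toRepresentation 12) ∧
    -- `χ₁₁` as a quotient
    (IsExtendedSubsystem Φ π ⊤ JA1 (WJ JA1) ∧
      IsExtendedSubsystem Φ J2A1 (WJ J2A1) JA1 (WJ JA1) ∧
      IsGoodDual K Φ π (WJ JA3) (WJ J2A1) ∧
      IsUsefulDual Φ π (WJ JA3) (WJ JA1) ∧
      S K (WJ JA3) (WJ J2A1) ≤ S K (WJ JA3) (WJ JA1) ∧
      Affords (subquotient (S K (WJ JA3) (WJ JA1)) (S K (WJ JA3) (WJ J2A1))) 11) ∧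
    -- `χ₁₀` as a quotient, from the Steinberg subgroup `W(B₃)`
    (IsExtendedSubsystem Φ π ⊤ JA1' (WJ JA1') ∧
      IsExtendedSubsystem Φ π ⊤ JA3' (WJ JA3') ∧
      IsExtendedSubsystem Φ π ⊤ JB3 WB3 ∧
      IsExtendedSubsystem Φ JB3 WB3 JA3' (WJ JA3') ∧
      IsUsefulDual Φ π (WJ JA1') (WJ JA3') ∧
      IsGoodDual K Φ π (WJ JA1') WB3 ∧
      S K (WJ JA1') WB3 ≤ S K (WJ JA1') (WJ JA3') ∧
      Affords (subquotient (S K (WJ JA1') (WJ JA3')) (S K (WJ JA1') WB3)) 10) ∧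
    -- the list is complete
    (∀ (M : Type*) [AddCommGroup M] [Module K M] (ρ : Representation K W M),
      ρ.IsIrreducible →
      (∃! n : ℕ, Affords ρ n) ∧
      ((∃ r : Fin 11,
          Nonempty (ρ.Equiv (S K (WJ (rowJ r)) (WJ (colJ r))).toRepresentation)) ∨
        Nonempty (ρ.Equiv (S K WG2 (WJ JA2)).toRepresentation) ∨
        Nonempty (ρ.Equiv (subquotient (S K (WJ JA3) (WJ JA1)) (S K (WJ JA3) (WJ J2A1)))) ∨
        Nonempty (ρ.Equiv
          (subquotient (S K (WJ JA1') (WJ JA3')) (S K (WJ JA1') WB3))))) := by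
  refine ⟨existsUnique_isConj, fun r => ?pairs, ?A3, ?G2, ?A3_quotient, ?A1_quotient,
    fun M _ _ ρ _ => existsUnique_affords_and_isListed ρ⟩
  case pairs =>
    exact ⟨isExtendedSubsystem_rowJ r, isExtendedSubsystem_colJ r, isGoodSystem_rowJ_colJ K r,
      isGoodDual_rowJ_colJ K r, affords_rowJ_colJ K r⟩
  case A3 =>
    exact ⟨bijective_mk_tabloidRepresentative, polytabloidA3_eq K, tabloidRep_τ₄_polytabloidA3 K,
      tabloidRep_τ₂_mul_τ₄_polytabloidA3 K, linearIndependent_polytabloidA3 K, S_A3_2A1_eq_span K,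
      tabloidRep_τ₂_polytabloidA3 K, tabloidRep_τ₂_tabloidRep_τ₄ K _,
      tabloidRep_τ₂_tabloidRep_τ₂_mul_τ₄ K _⟩
  case G2 =>
    exact ⟨isExtendedSubsystem_G2, isExtendedSubsystem_JA2,
      isGoodDual_G2_A2 K ⟨_, isExtendedSubsystem_G2⟩, affords_G2_A2 K⟩
  case A3_quotient =>
    exact ⟨isExtendedSubsystem_JA1, isExtendedSubsystem_2A1_A1, isGoodDual_rowJ_colJ K 0,
      isUsefulDual_A3_A1, S_A3_2A1_le K, affords_subquotient_A3 K⟩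
  case A1_quotient =>
    exact ⟨isExtendedSubsystem_JA1', isExtendedSubsystem_JA3', isExtendedSubsystem_B3,
      isExtendedSubsystem_B3_A3, isUsefulDual_A1_A3, isGoodDual_A1_B3 K ⟨_, isExtendedSubsystem_B3⟩,
      S_A1_B3_le K, affords_subquotient_A1 K⟩
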